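/- **Theorem 4.7 (Continuity of the risk-averse multistage stochastic optimization problem).** *Setting.* Let $\Xi_1,\dots,\Xi_T$ be non-empty Polish spaces, $\Xi=\Xi_{1:T}=\Xi_1\times\dots\times\Xi_T$, and let $d$ be a metric on $\Xi$ inducing the product topology. Write $x_{1:t}=(x_1,\dots,x_t)$ and let $\mathcal F_t$ be the $\sigma$-algebra generated by $x\mapsto x_{1:t}$ ($\mathcal F_0$ is trivial). Let $r\in[1,\infty)$ and $q\in(1,\infty]$ with $\frac1r+\frac1q=1$. Let $P,\tilde P$ be Borel probability measures on $\Xi$ with finite $r$-th moment, i.e. $\int d(x_0,x)^r\,P(\mathrm dx)<\infty$ for some $x_0$, and likewise for $\tilde P$; $P_t(\cdot\mid x_{1:t-1})$ denotes the regular conditional distribution of $x_t$ given $x_{1:t-1}$ under $P$. *Risk.* A distortion function is a nondecreasing $\sigma\colon[0,1)\to[0,\infty)$ with $\int_0^1\sigma(u)\,\mathrm du=1$; $\|\sigma\|_q$ is its norm in $L^q([0,1))$. For a set $\mathcal S$ of distortion functions and a probability measure $\mu$ put $$\mathcal R_{\mathcal S;\mu}(Y)=\sup\Big\{\mathbb E_\mu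 Y\zeta:\ \zeta\ge0,\ \mathbb E_\mu\zeta=1,\ \exists\,\sigma\in\mathcal S\ \forall\alpha\in(0,1)\ \ \mathrm{AVaR}_{\alpha;\mu}(\zeta)\le\tfrac1{1-\alpha}\textstyle\int_\alpha^1\sigma(u)\,\mathrm du\Big\},$$ where $\mathrm{AVaR}_{\alpha;\mu}(\zeta)=\inf_{s\in\mathbb R}\{s+\frac1{1-\alpha}\mathbb E_\mu(\zeta-s)_+\}$. Let $\mathcal S_1,\dots,\mathcal S_T$ be non-empty sets of distortion functions with $$K:=\sup_{\sigma_t\in\mathcal S_t,\ t=1,\dots,T}\|\sigma_1\|_q\cdots\|\sigma_T\|_q<\infty .$$ For $Y\in L^r(P)$ the nested risk functional is $\mathcal R_{\mathcal S_{1:T};P}(Y):=Y_0$, where $Y_T:=Y$ and $Y_{t-1}(x_{1:t-1}):=\mathcal R_{\mathcal S_t;P_t(\cdot\mid x_{1:t-1})}\big(Y_t(x_{1:t-1},\cdot)\big)$ for $t=T,\dots,1$. *Nested distance.* For a cost function $c\ge0$ let $w_r(\mu,\nu;c)=\inf_\pi\big(\int c^r\,\mathrm d\pi\big)^{1/r}$,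 the infimum being over all couplings $\pi$ of $\mu$ and $\nu$. Put $c_T:=d$ and $c_{t-1}(x_{1:t-1},y_{1:t-1}):=w_r\big(P_t(\cdot\mid x_{1:t-1}),\tilde P_t(\cdot\mid y_{1:t-1});\,c_t(x_{1:t-1},\cdot\,;y_{1:t-1},\cdot)\big)$ for $t=T,\dots,1$. The nested distance is $\mathsf{nd}_r(P,\tilde P):=c_0$. *Optimization problem.* For $t=0,\dots,T$ let $\mathcal Z_t$ be a closed convex subset of a separable real Banach space (for instance the whole space), $\mathcal Z=\mathcal Z_0\times\dots\times\mathcal Z_T$, and let $Q\colon\mathcal Z\times\Xi\to\mathbb R$ be lower semicontinuous. The optimal value is $$v_P:=\inf_{z}\ \mathcal R_{\mathcal S_{1:T};P}\big(Q(z(\cdot);\cdot)\big)\in[-\infty,\infty],$$ the infimum being over all adapted policies $z=(z_0,\dots,z_T)$, i.e. $z_t\colon\Xi\to\mathcal Z_t$ is $\mathcal F_t$-measurable, for which $x\mapsto Q(z(x);x)$ belongs to $L^r(P)$ (so that its risk is defined). *Claim.* Suppose that $|Q(z;x)-Q(z;y)|\le L\,d(x,y)$ for all $x,y\in\Xi$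 and $z\in\mathcal Z$, with a constant $L\ge0$, and that $z\mapsto Q(z;x)$ is convex for every $x\in\Xi$. Then $$v_P\le v_{\tilde P}+K\cdot L\cdot\mathsf{nd}_r(P,\tilde P)\quad\text{and}\quad v_{\tilde P}\le v_P+K\cdot L\cdot\mathsf{nd}_r(P,\tilde P).$$ In particular, if the optimal values are finite, then $$|v_P-v_{\tilde P}|\le\sup_{\sigma_t\in\mathcal S_t,\ t=1,\dots,T}\|\sigma_1\|_q\cdots\|\sigma_T\|_q\cdot L\cdot\mathsf{nd}_r(P,\tilde P).$$ -/

import Mathlib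

open MeasureTheory ProbabilityTheory Set
open scoped ENNReal NNReal

noncomputable section

/-! ### Distortion functions, Average Value-at-Risk, law invariant coherent risk functionals -/

/-- A distortion function `σ : [0,1) → ℝ`: nondecreasing, nonnegative, with integral one.
Values of `σ` outside `[0,1)` play no role anywhere. -/
structure IsDistortion (σ : ℝ → ℝ) : Prop where
  monotoneOn : MonotoneOn σ (Ico 0 1)
  nonneg : ∀ u ∈ Ico (0 : ℝ) 1, 0 ≤ σ u
  integral_eq_one : ∫ u in (0 : ℝ)..1, σ u = 1

/-- The norm `‖σ‖_q` in `L^q([0,1))`. -/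
def distortionNorm (q : ℝ≥0∞) (σ : ℝ → ℝ) : ℝ≥0∞ :=
  eLpNorm σ q (volume.restrict (Ico (0 : ℝ) 1))

/-- The Average Value-at-Risk `inf_q { q + (1 - α)⁻¹ E (Y - q)₊ }` at level `α`
(used for integrable `Y` and `0 < α < 1`, where the set of values is bounded below). -/
def AVaR {Ω : Type*} [MeasurableSpace Ω] (μ : Measure Ω) (α : ℝ) (Y : Ω → ℝ) : ℝ :=
  ⨅ q : ℝ, (q + (1 - α)⁻¹ * ∫ ω, max (Y ω - q) 0 ∂μ)

/-- The densities `ζ` admissible in the dual representation of the risk functional given by the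
collection `S` of distortion functions. -/
structure IsRiskDensity {Ω : Type*} [MeasurableSpace Ω] (S : Set (ℝ → ℝ)) (μ : Measure Ω)
    (ζ : Ω → ℝ) : Prop where
  measurable : Measurable ζ
  nonneg : ∀ ω, 0 ≤ ζ ω
  integrable : Integrable ζ μ
  integral_eq_one : ∫ ω, ζ ω ∂μ = 1
  avar_le : ∃ σ ∈ S, ∀ α ∈ Ioo (0 : ℝ) 1,
    AVaR μ α ζ ≤ (1 - α)⁻¹ * ∫ u in α..1, σ u

/-- The risk functional `R_{S;μ}(Y) = sup { E_μ (Y ζ) : ζ admissible }`. -/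
def riskFunctional {Ω : Type*} [MeasurableSpace Ω] (S : Set (ℝ → ℝ)) (μ : Measure Ω)
    (Y : Ω → ℝ) : ℝ :=
  sSup {v : ℝ | ∃ ζ : Ω → ℝ, IsRiskDensity S μ ζ ∧ v = ∫ ω, Y ω * ζ ω ∂μ}

/-! ### Wasserstein distance of order `r` for a general cost function -/

/-- `π` is a bivariate measure with marginals `μ` and `ν`. -/
def IsCoupling {X Y : Type*} [MeasurableSpace X] [MeasurableSpace Y]
    (μ : Measure X) (ν : Measure Y) (π : Measure (X × Y)) : Prop :=
  π.map Prod.fst = μ ∧ π.map Prod.snd = ν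

/-- `w_r(μ, ν; c) = inf_π (E_π c^r)^{1/r}`, the infimum over all couplings `π` of `μ` and `ν`. -/
def wasserstein {X Y : Type*} [MeasurableSpace X] [MeasurableSpace Y] (r : ℝ)
    (μ : Measure X) (ν : Measure Y) (c : X → Y → ℝ≥0∞) : ℝ≥0∞ :=
  ⨅ (π : Measure (X × Y)) (_ : IsCoupling μ ν π), (∫⁻ p, c p.1 p.2 ^ r ∂π) ^ (1 / r)

/-! ### Paths

The stages are `1, …, T`. The coordinate `i : Fin T` of a path `x : ∀ i, Ξ i` belongs to stage
`i + 1`, so that `x_{1:t}` consists of the coordinates `i` with `i < t`. -/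

/-- The canonical projection `x ↦ x_{1:t}`. -/
def pathRestrict {T : ℕ} {Ξ : Fin T → Type*} (t : ℕ) (x : ∀ i, Ξ i) :
    ∀ i : {i : Fin T // i.val < t}, Ξ i.val :=
  fun i => x i.val

/-- The coordinate σ-algebra `F_t` generated by `x ↦ x_{1:t}`; `F_0` is trivial. -/
abbrev coordFiltration {T : ℕ} (Ξ : Fin T → Type*) [∀ i, MeasurableSpace (Ξ i)] (t : ℕ) :
    MeasurableSpace (∀ i, Ξ i) :=
  MeasurableSpace.comap (pathRestrict t) inferInstance

/-- The regular conditional distribution of the coordinate `i` under `P` given the coordinates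
`j < i`, at the path `x`; for `t = i + 1` this is `P_t(· | x_{1:t-1})`. -/
def stageKernel {T : ℕ} {Ξ : Fin T → Type*} [∀ i, MeasurableSpace (Ξ i)]
    [∀ i, StandardBorelSpace (Ξ i)] [∀ i, Nonempty (Ξ i)]
    (P : Measure (∀ i, Ξ i)) [IsFiniteMeasure P] (i : Fin T) (x : ∀ i, Ξ i) : Measure (Ξ i) :=
  condDistrib (fun y : ∀ i, Ξ i => y i) (pathRestrict i.val) P (pathRestrict i.val x)

/-! ### Nested risk functional -/

/-- The process `Y_T = Y`, `Y_{t-1}(x_{1:t-1}) = R_{S_t}(Y_t | x_{1:t-1})`, that is,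
`Y_t = R_{S_{t+1:T};P}(Y | x_{1:t})`, written as a function of the whole path which depends on
`x_{1:t}` only. -/
def riskProcess {T : ℕ} {Ξ : Fin T → Type*} [∀ i, MeasurableSpace (Ξ i)]
    [∀ i, StandardBorelSpace (Ξ i)] [∀ i, Nonempty (Ξ i)] (S : Fin T → Set (ℝ → ℝ))
    (P : Measure (∀ i, Ξ i)) [IsFiniteMeasure P] (Y : (∀ i, Ξ i) → ℝ) (t : ℕ) :
    (∀ i, Ξ i) → ℝ :=
  if h : t < T then
    fun x => riskFunctional (S ⟨t, h⟩) (stageKernel P ⟨t, h⟩ x)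
      (fun u => riskProcess S P Y (t + 1) (Function.update x ⟨t, h⟩ u))
  else Y
termination_by T - t

/-- The nested risk functional `R_{S_{1:T};P}(Y)`. The process at time `0` does not depend on the
path (`nestedRisk_eq`), so that it may be evaluated anywhere. -/
def nestedRisk {T : ℕ} {Ξ : Fin T → Type*} [∀ i, MeasurableSpace (Ξ i)]
    [∀ i, StandardBorelSpace (Ξ i)] [∀ i, Nonempty (Ξ i)] (S : Fin T → Set (ℝ → ℝ))
    (P : Measure (∀ i, Ξ i)) [IsFiniteMeasure P] (Y : (∀ i, Ξ i) → ℝ) : ℝ :=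
  riskProcess S P Y 0 (fun _ => Classical.arbitrary _)

/-! ### Nested distance -/

/-- The cost process `c_T = c`,
`c_{t-1}(x, y) = w_r(P_t(· | x_{1:t-1}), P'_t(· | y_{1:t-1}); c_t)`, written as a function of whole
paths which depends on `x_{1:t}`, `y_{1:t}` only. -/
def costProcess {T : ℕ} {Ξ : Fin T → Type*} [∀ i, MeasurableSpace (Ξ i)]
    [∀ i, StandardBorelSpace (Ξ i)] [∀ i, Nonempty (Ξ i)] (r : ℝ)
    (c : (∀ i, Ξ i) → (∀ i, Ξ i) → ℝ≥0∞)
    (P P' : Measure (∀ i, Ξ i)) [IsFiniteMeasure P] [IsFiniteMeasure P'] (t : ℕ) :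
    (∀ i, Ξ i) → (∀ i, Ξ i) → ℝ≥0∞ :=
  if h : t < T then
    fun x y => wasserstein r (stageKernel P ⟨t, h⟩ x) (stageKernel P' ⟨t, h⟩ y)
      (fun u v => costProcess r c P P' (t + 1)
        (Function.update x ⟨t, h⟩ u) (Function.update y ⟨t, h⟩ v))
  else c
termination_by T - t

/-- The nested distance `nd_r(P, P') = c_0` for the terminal cost `c_T = d`. The cost at time `0`
does not depend on the paths (`nestedDist_eq`), so that it may be evaluated anywhere. -/
def nestedDist {T : ℕ} {Ξ : Fin T → Type*} [∀ i, MeasurableSpace (Ξ i)]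
    [∀ i, StandardBorelSpace (Ξ i)] [∀ i, Nonempty (Ξ i)] (r : ℝ)
    (d : (∀ i, Ξ i) → (∀ i, Ξ i) → ℝ)
    (P P' : Measure (∀ i, Ξ i)) [IsFiniteMeasure P] [IsFiniteMeasure P'] : ℝ≥0∞ :=
  costProcess r (fun x y => ENNReal.ofReal (d x y)) P P' 0
    (fun _ => Classical.arbitrary _) (fun _ => Classical.arbitrary _)

/-- `P` has a finite moment of order `r` with respect to `d`. -/
def HasFiniteMoment {X : Type*} [MeasurableSpace X] (r : ℝ) (d : X → X → ℝ)
    (P : Measure X) : Prop :=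
  ∃ x₀, ∫⁻ x, ENNReal.ofReal (d x₀ x) ^ r ∂P < ∞

/-! ### The risk-averse multistage problem -/

/-- The adapted policies `z = (z_0, …, z_T)`, `z_t` being `F_t`-measurable with values in the
decision space `Z t`, whose cost `Q(z(·); ·)` belongs to the domain `L^r(P)` of the risk
functional. -/
structure IsPolicy {T : ℕ} {Ξ : Fin T → Type*} {E : Fin (T + 1) → Type*}
    [∀ i, MeasurableSpace (Ξ i)] [∀ t, MeasurableSpace (E t)] (r : ℝ)
    (Z : ∀ t, Set (E t)) (Q : (∀ t, E t) → (∀ i, Ξ i) → ℝ) (P : Measure (∀ i, Ξ i))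
    (z : ∀ t, (∀ i, Ξ i) → E t) : Prop where
  mem : ∀ t x, z t x ∈ Z t
  adapted : ∀ t : Fin (T + 1), Measurable[coordFiltration Ξ t.val] (z t)
  memLp : MemLp (fun x => Q (fun t => z t x) x) (ENNReal.ofReal r) P

/-- The optimal value `v_P = inf_z R_{S_{1:T};P}(Q(z(·); ·))` over the adapted policies, an extended
real number. -/
def optimalValue {T : ℕ} {Ξ : Fin T → Type*} {E : Fin (T + 1) → Type*}
    [∀ i, MeasurableSpace (Ξ i)] [∀ i, StandardBorelSpace (Ξ i)] [∀ i, Nonempty (Ξ i)]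
    [∀ t, MeasurableSpace (E t)] (r : ℝ) (Z : ∀ t, Set (E t))
    (Q : (∀ t, E t) → (∀ i, Ξ i) → ℝ) (S : Fin T → Set (ℝ → ℝ))
    (P : Measure (∀ i, Ξ i)) [IsFiniteMeasure P] : EReal :=
  ⨅ (z : ∀ t, (∀ i, Ξ i) → E t) (_ : IsPolicy r Z Q P z),
    ((nestedRisk S P (fun x => Q (fun t => z t x) x) : ℝ) : EReal)

/-! ### The processes depend on the history only -/

theorem stageKernel_congr {T : ℕ} {Ξ : Fin T → Type*} [∀ i, MeasurableSpace (Ξ i)]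
    [∀ i, StandardBorelSpace (Ξ i)] [∀ i, Nonempty (Ξ i)]
    (P : Measure (∀ i, Ξ i)) [IsFiniteMeasure P] (i : Fin T) {x x' : ∀ i, Ξ i}
    (hx : ∀ j : Fin T, j.val < i.val → x j = x' j) : stageKernel P i x = stageKernel P i x' := by
  have : pathRestrict i.val x = pathRestrict i.val x' := by
    funext j
    exact hx j.val j.property
  simp only [stageKernel, this]

theorem update_agree {T : ℕ} {Ξ : Fin T → Type*} {t : ℕ} (h : t < T) {x x' : ∀ i, Ξ i}
    (hx : ∀ j : Fin T, j.val < t → x j = x' j) (u : Ξ ⟨t, h⟩) (j : Fin T) (hj : j.val < t + 1) :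
    Function.update x ⟨t, h⟩ u j = Function.update x' ⟨t, h⟩ u j := by
  by_cases hjt : j = ⟨t, h⟩
  · subst hjt
    simp
  · have : j.val ≠ t := fun e => hjt (Fin.ext e)
    rw [Function.update_of_ne hjt, Function.update_of_ne hjt]
    exact hx j (by omega)

theorem riskProcess_congr {T : ℕ} {Ξ : Fin T → Type*} [∀ i, MeasurableSpace (Ξ i)]
    [∀ i, StandardBorelSpace (Ξ i)] [∀ i, Nonempty (Ξ i)] (S : Fin T → Set (ℝ → ℝ))
    (P : Measure (∀ i, Ξ i)) [IsFiniteMeasure P] (Y : (∀ i, Ξ i) → ℝ) (t : ℕ)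
    (x x' : ∀ i, Ξ i) (hx : ∀ j : Fin T, j.val < t → x j = x' j) :
    riskProcess S P Y t x = riskProcess S P Y t x' := by
  by_cases h : t < T
  · rw [riskProcess, dif_pos h]
    rw [stageKernel_congr P ⟨t, h⟩ hx]
    congr 1
    funext u
    exact riskProcess_congr S P Y (t + 1) _ _ (update_agree h hx u)
  · have : x = x' := funext fun j => hx j (by omega)
    rw [this]
termination_by T - t

theorem costProcess_congr {T : ℕ} {Ξ : Fin T → Type*} [∀ i, MeasurableSpace (Ξ i)]
    [∀ i, StandardBorelSpace (Ξ i)] [∀ i, Nonempty (Ξ i)] (r : ℝ)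
    (c : (∀ i, Ξ i) → (∀ i, Ξ i) → ℝ≥0∞)
    (P P' : Measure (∀ i, Ξ i)) [IsFiniteMeasure P] [IsFiniteMeasure P'] (t : ℕ)
    (x x' y y' : ∀ i, Ξ i) (hx : ∀ j : Fin T, j.val < t → x j = x' j)
    (hy : ∀ j : Fin T, j.val < t → y j = y' j) :
    costProcess r c P P' t x y = costProcess r c P P' t x' y' := by
  by_cases h : t < T
  · rw [costProcess, dif_pos h]
    rw [stageKernel_congr P ⟨t, h⟩ hx, stageKernel_congr P' ⟨t, h⟩ hy]
    congr 1
    funext u v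
    exact costProcess_congr r c P P' (t + 1) _ _ _ _ (update_agree h hx u) (update_agree h hy v)
  · have h1 : x = x' := funext fun j => hx j (by omega)
    have h2 : y = y' := funext fun j => hy j (by omega)
    rw [h1, h2]
termination_by T - t

theorem nestedRisk_eq {T : ℕ} {Ξ : Fin T → Type*} [∀ i, MeasurableSpace (Ξ i)]
    [∀ i, StandardBorelSpace (Ξ i)] [∀ i, Nonempty (Ξ i)] (S : Fin T → Set (ℝ → ℝ))
    (P : Measure (∀ i, Ξ i)) [IsFiniteMeasure P] (Y : (∀ i, Ξ i) → ℝ) (x : ∀ i, Ξ i) :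
    nestedRisk S P Y = riskProcess S P Y 0 x :=
  riskProcess_congr S P Y 0 _ _ fun _ hj => absurd hj (Nat.not_lt_zero _)

theorem nestedDist_eq {T : ℕ} {Ξ : Fin T → Type*} [∀ i, MeasurableSpace (Ξ i)]
    [∀ i, StandardBorelSpace (Ξ i)] [∀ i, Nonempty (Ξ i)] (r : ℝ)
    (d : (∀ i, Ξ i) → (∀ i, Ξ i) → ℝ)
    (P P' : Measure (∀ i, Ξ i)) [IsFiniteMeasure P] [IsFiniteMeasure P'] (x y : ∀ i, Ξ i) :
    nestedDist r d P P' = costProcess r (fun x y => ENNReal.ofReal (d x y)) P P' 0 x y :=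
  costProcess_congr r _ P P' 0 _ _ _ _ (fun _ hj => absurd hj (Nat.not_lt_zero _))
    fun _ hj => absurd hj (Nat.not_lt_zero _)

end

set_option linter.unusedSectionVars false
set_option linter.unusedVariables false

noncomputable section

/-! ### Distortion functions -/

/-! A policy `z` for `P'` is carried to `P` along a causal map `η` of paths: the beginning of `η x`
depends on the beginning of `x` only, so `z ∘ η` is again adapted. By the Lipschitz condition,
playing the decisions `z (η x)` against `x` costs at most `L d(x, η x)` more than playing them
against `η x`. It remains to choose `η` so that the nested risks compare.

One stage. Let a coupling of the two conditional laws be given. A density admissible for one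
marginal, averaged over the coupling, is admissible for the other (`IsRiskDensity.average`), because
the Average Value-at-Risk does not increase under conditional expectation. An admissible density
lies below its distortion function in the stop-loss order, so its `L^q` norm is at most that of the
distortion function (`IsRiskDensity.eLpNorm_le`), and Hölder's inequality turns an error `ℓ` into a
multiple of its `L^r` norm along the coupling. The density depends on the first coordinate `u` only,
so a comparison of `V u` with `W v + ℓ (u, v)` is needed only after averaging over `v` given `u`
(`riskFunctional_le_add_of_average`). Hence `v` may be chosen as a function of `u`: any point where
`W + ℓ` does not exceed its conditional mean will do, and such points can be selected measurably
(`exists_measurable_le_lintegral`).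

All stages. The next coordinate of `η` is selected in this way, with the risk process under `P'` as
`W` and a multiple of the iterated norm of the cost as `ℓ`; the multipliers of the stages form the
product of the norm bounds (`TransferAt.stage`, `transferAt`). To keep the selected points
integrable, the error also contains `2 (|Q| - a)₊`, whose norm is made small by a large `a`.

Two measurability questions are settled on the way. Conditional risk is measurable because, for
functions with finitely many values, it is a continuous function of their probabilities
(`exists_measurable_riskFunctional`). Nearly optimal couplings can be chosen measurably in the
histories because countable infima of rectangle functions are stable under optimal transport: it
suffices to consider countably many plans, with rational masses, between finite partitions
(`exists_isRectInf_transport`, `exists_nested_couplings`). -/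

theorem IsDistortion.intervalIntegrable {σ : ℝ → ℝ} (hσ : IsDistortion σ) :
    IntervalIntegrable σ volume 0 1 := by
  by_contra h
  have := hσ.integral_eq_one
  rw [intervalIntegral.integral_undef h] at this
  exact zero_ne_one this

theorem IsDistortion.aemeasurable {σ : ℝ → ℝ} (hσ : IsDistortion σ) :
    AEMeasurable σ (volume.restrict (Ico (0 : ℝ) 1)) :=
  aemeasurable_restrict_of_monotoneOn measurableSet_Ico hσ.monotoneOn

theorem IsDistortion.integrableOn {σ : ℝ → ℝ} (hσ : IsDistortion σ) :
    IntegrableOn σ (Ico (0 : ℝ) 1) := by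
  rw [integrableOn_Ico_iff_integrableOn_Ioo, ← integrableOn_Ioc_iff_integrableOn_Ioo]
  exact (intervalIntegrable_iff_integrableOn_Ioc_of_le zero_le_one).1 hσ.intervalIntegrable

theorem integral_unit_eq_setIntegral_Ico (f : ℝ → ℝ) :
    ∫ u in (0 : ℝ)..1, f u = ∫ u in Ico (0 : ℝ) 1, f u := by
  rw [intervalIntegral.integral_of_le zero_le_one, integral_Ioc_eq_integral_Ioo,
    integral_Ico_eq_integral_Ioo]

instance isProbabilityMeasure_restrict_unit :
    IsProbabilityMeasure (volume.restrict (Ico (0 : ℝ) 1)) := ⟨by simp⟩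

/-- The `L^1` norm is one, and on a probability space norms increase with the exponent. This is what
lets a bound on the product of the norms bound each factor. -/
theorem IsDistortion.one_le_distortionNorm {σ : ℝ → ℝ} (hσ : IsDistortion σ) {q : ℝ≥0∞}
    (hq : 1 ≤ q) : 1 ≤ distortionNorm q σ := by
  have h1 : eLpNorm σ 1 (volume.restrict (Ico (0 : ℝ) 1)) = 1 := by
    rw [eLpNorm_one_eq_lintegral_enorm]
    have : ∫⁻ u in Ico (0 : ℝ) 1, ‖σ u‖ₑ = ∫⁻ u in Ico (0 : ℝ) 1, ENNReal.ofReal (σ u) := by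
      refine setLIntegral_congr_fun measurableSet_Ico fun u hu => ?_
      exact Real.enorm_of_nonneg (hσ.nonneg u hu)
    rw [this, ← ofReal_integral_eq_lintegral_ofReal hσ.integrableOn, ←
      integral_unit_eq_setIntegral_Ico, hσ.integral_eq_one, ENNReal.ofReal_one]
    exact (ae_restrict_iff' measurableSet_Ico).2 (ae_of_all _ hσ.nonneg)
  rw [← h1]
  exact eLpNorm_le_eLpNorm_of_exponent_le hq hσ.aemeasurable.aestronglyMeasurable

/-- The upper tail of a nondecreasing function has at least the overall average, which is one. The
constant density is admissible for this reason. -/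
theorem IsDistortion.one_sub_le_integral {σ : ℝ → ℝ} (hσ : IsDistortion σ) {α : ℝ}
    (hα : α ∈ Ioo (0 : ℝ) 1) : 1 - α ≤ ∫ u in α..1, σ u := by
  have hmem : α ∈ Icc (0 : ℝ) 1 := Ioo_subset_Icc_self hα
  have hi1 : IntervalIntegrable σ volume 0 α :=
    hσ.intervalIntegrable.mono_set (by
      rw [uIcc_of_le hα.1.le, uIcc_of_le zero_le_one]; exact Icc_subset_Icc_right hα.2.le)
  have hi2 : IntervalIntegrable σ volume α 1 :=
    hσ.intervalIntegrable.mono_set (by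
      rw [uIcc_of_le hα.2.le, uIcc_of_le zero_le_one]; exact Icc_subset_Icc_left hα.1.le)
  have hsum := intervalIntegral.integral_add_adjacent_intervals hi1 hi2
  rw [hσ.integral_eq_one] at hsum
  have h1 : ∫ u in (0 : ℝ)..α, σ u ≤ ∫ _ in (0 : ℝ)..α, σ α := by
    refine intervalIntegral.integral_mono_on hα.1.le hi1 intervalIntegrable_const fun u hu => ?_
    exact hσ.monotoneOn ⟨hu.1, hu.2.trans_lt hα.2⟩ ⟨hα.1.le, hα.2⟩ hu.2
  have h2 : ∫ _ in α..1, σ α ≤ ∫ u in α..1, σ u := by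
    refine intervalIntegral.integral_mono_on_of_le_Ioo hα.2.le intervalIntegrable_const hi2
      fun u hu => ?_
    exact hσ.monotoneOn ⟨hα.1.le, hα.2⟩ ⟨hα.1.le.trans hu.1.le, hu.2⟩ hu.1.le
  simp only [intervalIntegral.integral_const, smul_eq_mul, sub_zero] at h1 h2
  -- If `σ α ≥ 1` the tail is bounded below directly; otherwise the head `[0, α]` contributes at
  -- most `α` to the total mass one.
  by_cases hc : 1 ≤ σ α
  · nlinarith [hα.2]
  · push Not at hc
    nlinarith [hα.1]

/-! ### Densities admissible in the dual representation -/

section Density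

variable {Ω : Type*} [MeasurableSpace Ω] {μ : Measure Ω} [IsProbabilityMeasure μ]

theorem integrable_max_sub {ζ : Ω → ℝ} (hζ : Integrable ζ μ) (s : ℝ) :
    Integrable (fun ω => max (ζ ω - s) 0) μ :=
  (hζ.sub (integrable_const s)).pos_part

theorem integral_le_add_integral_max_sub {ζ : Ω → ℝ} (hζ : Integrable ζ μ) {α : ℝ}
    (hα : α ∈ Ioo (0 : ℝ) 1) (s : ℝ) :
    ∫ ω, ζ ω ∂μ ≤ s + (1 - α)⁻¹ * ∫ ω, max (ζ ω - s) 0 ∂μ := by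
  have h1 : ∫ ω, ζ ω ∂μ ≤ ∫ ω, (s + max (ζ ω - s) 0) ∂μ := by
    refine integral_mono hζ ((integrable_const s).add (integrable_max_sub hζ s)) fun ω => ?_
    have := le_max_left (ζ ω - s) 0
    simp only
    linarith
  rw [integral_add (integrable_const s) (integrable_max_sub hζ s)] at h1
  have h2 : 0 ≤ ∫ ω, max (ζ ω - s) 0 ∂μ := integral_nonneg fun ω => le_max_right _ _
  have h3 : 1 ≤ (1 - α)⁻¹ := (one_le_inv₀ (by linarith [hα.2])).2 (by linarith [hα.1])
  have h4 : ∫ ω, max (ζ ω - s) 0 ∂μ ≤ (1 - α)⁻¹ * ∫ ω, max (ζ ω - s) 0 ∂μ :=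
    le_mul_of_one_le_left h2 h3
  simp at h1
  linarith

theorem bddBelow_avar {ζ : Ω → ℝ} (hζ : Integrable ζ μ) {α : ℝ} (hα : α ∈ Ioo (0 : ℝ) 1) :
    BddBelow (range fun s : ℝ => s + (1 - α)⁻¹ * ∫ ω, max (ζ ω - s) 0 ∂μ) :=
  ⟨∫ ω, ζ ω ∂μ, by rintro _ ⟨s, rfl⟩; exact integral_le_add_integral_max_sub hζ hα s⟩

/-- The infimum defining the Average Value-at-Risk is attained at a quantile. -/
theorem add_integral_max_sub_le_avar {ζ : Ω → ℝ} (hm : Measurable ζ) (hζ : Integrable ζ μ)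
    {s : ℝ} (hp : 0 < μ.real {ω | s < ζ ω}) :
    s + (μ.real {ω | s < ζ ω})⁻¹ * ∫ ω, max (ζ ω - s) 0 ∂μ ≤
      AVaR μ (1 - μ.real {ω | s < ζ ω}) ζ := by
  set p := μ.real {ω | s < ζ ω} with hpdef
  have hset : MeasurableSet {ω | s < ζ ω} := measurableSet_lt measurable_const hm
  refine le_ciInf fun s' => ?_
  -- Pointwise, `(ζ - s)₊ ≤ (ζ - s')₊ + 1_{s < ζ} (s' - s)`, a subgradient inequality in the
  -- threshold.
  have h : ∫ ω, max (ζ ω - s) 0 ∂μ ≤ (∫ ω, max (ζ ω - s') 0 ∂μ) + p * (s' - s) := by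
    have hind : ∫ ω, ({ω | s < ζ ω}.indicator (fun _ => s' - s)) ω ∂μ = p * (s' - s) := by
      rw [integral_indicator_const _ hset, smul_eq_mul]
    have hint : Integrable ({ω | s < ζ ω}.indicator (fun _ => s' - s)) μ :=
      (integrable_const _).indicator hset
    rw [← hind, ← integral_add (integrable_max_sub hζ s') hint]
    refine integral_mono (integrable_max_sub hζ s) ((integrable_max_sub hζ s').add hint)
      fun ω => ?_
    by_cases hω : s < ζ ω
    · have e : {ω | s < ζ ω}.indicator (fun _ => s' - s) ω = s' - s :=
        indicator_of_mem (show ω ∈ {ω | s < ζ ω} from hω) _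
      simp only [e]
      rw [max_eq_left (by linarith)]
      have := le_max_left (ζ ω - s') 0
      linarith
    · have e : {ω | s < ζ ω}.indicator (fun _ => s' - s) ω = 0 :=
        indicator_of_notMem (show ω ∉ {ω | s < ζ ω} from hω) _
      simp only [e]
      rw [max_eq_right (by linarith)]
      have := le_max_right (ζ ω - s') 0
      linarith
  have h2 := mul_le_mul_of_nonneg_left h (inv_nonneg.2 hp.le)
  rw [mul_add, ← mul_assoc, inv_mul_cancel₀ hp.ne', one_mul] at h2
  have e : 1 - (1 - p) = p := by ring
  rw [e]
  linarith

/-- Stop-loss domination of an admissible density by the distortion function. -/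
theorem IsDistortion.integral_max_sub_le {σ : ℝ → ℝ} (hσ : IsDistortion σ) {ζ : Ω → ℝ}
    (hm : Measurable ζ) (hζ : Integrable ζ μ) (h1 : ∫ ω, ζ ω ∂μ = 1)
    (havar : ∀ α ∈ Ioo (0 : ℝ) 1, AVaR μ α ζ ≤ (1 - α)⁻¹ * ∫ u in α..1, σ u) (s : ℝ) :
    ∫ ω, max (ζ ω - s) 0 ∂μ ≤ ∫ u in Ico (0 : ℝ) 1, max (σ u - s) 0 := by
  have hset : MeasurableSet {ω | s < ζ ω} := measurableSet_lt measurable_const hm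
  have hnn : 0 ≤ ∫ u in Ico (0 : ℝ) 1, max (σ u - s) 0 :=
    integral_nonneg fun u => le_max_right _ _
  have hint : IntegrableOn (fun u => max (σ u - s) 0) (Ico (0 : ℝ) 1) :=
    integrable_max_sub hσ.integrableOn s
  -- The level `1 - p`, with `p` the probability of exceeding `s`, lies in `(0, 1)` only for `0 < p
  -- < 1`. For `p = 0` the left side vanishes; for `p = 1` it is `1 - s`, and `σ` also has mean one.
  rcases eq_or_lt_of_le (measureReal_nonneg (μ := μ) (s := {ω | s < ζ ω})) with h0 | h0
  · have : ∀ᵐ ω ∂μ, max (ζ ω - s) 0 = 0 := by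
      have hz : μ {ω | s < ζ ω} = 0 := by
        rw [eq_comm, measureReal_eq_zero_iff] at h0; exact h0
      filter_upwards [measure_eq_zero_iff_ae_notMem.1 hz] with ω hω
      simp only [not_lt] at hω
      exact max_eq_right (by linarith)
    rw [integral_congr_ae this]
    simpa using hnn
  rcases eq_or_lt_of_le (measureReal_le_one (μ := μ) (s := {ω | s < ζ ω})) with hp1 | hp1
  · have : ∀ᵐ ω ∂μ, max (ζ ω - s) 0 = ζ ω - s := by
      have hz : ∀ᵐ ω ∂μ, s < ζ ω := by
        have := (prob_compl_eq_zero_iff hset).2 (by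
          rw [measureReal_def] at hp1
          exact (ENNReal.toReal_eq_one_iff _).1 hp1)
        exact this
      filter_upwards [hz] with ω hω
      exact max_eq_left (by linarith)
    rw [integral_congr_ae this, integral_sub hζ (integrable_const s), h1]
    have hσ1 := hσ.integral_eq_one
    rw [integral_unit_eq_setIntegral_Ico] at hσ1
    have : ∫ _ : Ω, s ∂μ = ∫ _ in Ico (0 : ℝ) 1, s := by simp
    have e : (1 : ℝ) - ∫ _ in Ico (0 : ℝ) 1, s = ∫ u in Ico (0 : ℝ) 1, (σ u - s) := by
      rw [integral_sub hσ.integrableOn (integrable_const s), hσ1]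
    rw [this, e]
    exact integral_mono (hσ.integrableOn.sub (integrable_const s)) hint fun u => le_max_left _ _
  · set p := μ.real {ω | s < ζ ω} with hp
    have hα : 1 - p ∈ Ioo (0 : ℝ) 1 := ⟨by linarith, by linarith⟩
    have h2 := (add_integral_max_sub_le_avar hm hζ h0).trans (havar _ hα)
    rw [← hp] at h2
    have e : 1 - (1 - p) = p := by ring
    rw [e] at h2
    have h3 := mul_le_mul_of_nonneg_left h2 h0.le
    rw [mul_add, ← mul_assoc, ← mul_assoc, mul_inv_cancel₀ h0.ne', one_mul, one_mul] at h3
    -- The left side is the integral of `σ - s` over an interval of length `p`, hence at most that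
    -- of the positive part over the whole unit interval.
    have h4 : (∫ u in (1 - p)..1, σ u) - p * s ≤ ∫ u in Ico (0 : ℝ) 1, max (σ u - s) 0 := by
      have hi2 : IntervalIntegrable σ volume (1 - p) 1 :=
        hσ.intervalIntegrable.mono_set (by
          rw [uIcc_of_le hα.2.le, uIcc_of_le zero_le_one]; exact Icc_subset_Icc_left hα.1.le)
      have e2 : (∫ u in (1 - p)..1, σ u) - p * s = ∫ u in (1 - p)..1, (σ u - s) := by
        rw [intervalIntegral.integral_sub hi2 intervalIntegrable_const]
        simp
      rw [e2, intervalIntegral.integral_of_le hα.2.le, integral_Ioc_eq_integral_Ioo]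
      have hsub : Ioo (1 - p) 1 ⊆ Ico (0 : ℝ) 1 :=
        fun u hu => ⟨by linarith [hu.1, hα.1], hu.2⟩
      calc ∫ u in Ioo (1 - p) 1, (σ u - s) ≤ ∫ u in Ioo (1 - p) 1, max (σ u - s) 0 :=
            integral_mono ((hσ.integrableOn.mono_set hsub).sub (integrable_const s))
              (hint.mono_set hsub) fun u => le_max_left _ _
        _ ≤ _ := setIntegral_mono_set hint (ae_of_all _ fun u => le_max_right _ _)
              hsub.eventuallyLE
    linarith

/-- The representation of the `q`-th power as a mixture of stop-loss functions. -/
theorem ofReal_rpow_eq_lintegral {q : ℝ} (hq : 1 < q) {x : ℝ} (hx : 0 ≤ x) :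
    ENNReal.ofReal x ^ q = ∫⁻ s in Ioi (0 : ℝ),
      ENNReal.ofReal (q * (q - 1) * s ^ (q - 2)) * ENNReal.ofReal (x - s) := by
  have hq1 : 0 < q - 1 := by linarith
  -- For `s > x` the integrand vanishes; below `x` it is a difference of two powers, integrable at
  -- zero since `q - 2 > -1`.
  have e1 : ∫⁻ s in Ioi (0 : ℝ), ENNReal.ofReal (q * (q - 1) * s ^ (q - 2)) *
      ENNReal.ofReal (x - s) = ∫⁻ s in Ioc (0 : ℝ) x,
      ENNReal.ofReal (q * (q - 1) * (x * s ^ (q - 2) - s ^ (q - 1))) := by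
    rw [← lintegral_indicator measurableSet_Ioi, ← lintegral_indicator measurableSet_Ioc]
    refine lintegral_congr fun s => ?_
    by_cases h0 : 0 < s
    · by_cases hs : s ≤ x
      · rw [indicator_of_mem (show s ∈ Ioi (0 : ℝ) from h0),
          indicator_of_mem (show s ∈ Ioc (0 : ℝ) x from ⟨h0, hs⟩),
          ← ENNReal.ofReal_mul (by positivity)]
        congr 1
        have : s ^ (q - 1) = s ^ (q - 2) * s := by
          rw [← Real.rpow_add_one h0.ne']; congr 1; ring
        rw [this]; ring
      · rw [indicator_of_mem (show s ∈ Ioi (0 : ℝ) from h0),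
          indicator_of_notMem (fun h => hs h.2), ENNReal.ofReal_of_nonpos (p := x - s)
          (by linarith), mul_zero]
    · rw [indicator_of_notMem (show s ∉ Ioi (0 : ℝ) from h0),
        indicator_of_notMem (show s ∉ Ioc (0 : ℝ) x from fun h => h0 h.1)]
  have hi1 : IntervalIntegrable (fun s : ℝ => x * s ^ (q - 2)) volume 0 x :=
    (intervalIntegral.intervalIntegrable_rpow' (by linarith)).const_mul x
  have hi2 : IntervalIntegrable (fun s : ℝ => s ^ (q - 1)) volume 0 x :=
    intervalIntegral.intervalIntegrable_rpow' (by linarith)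
  have hi : IntervalIntegrable (fun s : ℝ => q * (q - 1) * (x * s ^ (q - 2) - s ^ (q - 1)))
      volume 0 x := (hi1.sub hi2).const_mul _
  rw [e1, ← ofReal_integral_eq_lintegral_ofReal
    ((intervalIntegrable_iff_integrableOn_Ioc_of_le hx).1 hi),
    ← intervalIntegral.integral_of_le hx, intervalIntegral.integral_const_mul,
    intervalIntegral.integral_sub hi1 hi2, intervalIntegral.integral_const_mul,
    integral_rpow (Or.inl (by linarith)), integral_rpow (Or.inl (by linarith)),
    ENNReal.ofReal_rpow_of_nonneg hx (by linarith)]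
  · congr 1
    have e2 : q - 2 + 1 = q - 1 := by ring
    have e3 : q - 1 + 1 = q := by ring
    rw [e2, e3, Real.zero_rpow hq1.ne', Real.zero_rpow (by linarith : q ≠ 0)]
    rcases hx.eq_or_lt with h | h
    · rw [← h, Real.zero_rpow (by linarith : q ≠ 0)]; simp
    · have : x ^ q = x * x ^ (q - 1) := by
        rw [mul_comm, ← Real.rpow_add_one h.ne', e3]
      have hq0 : q ≠ 0 := by linarith
      field_simp
      rw [this]; ring
  · refine (ae_restrict_iff' measurableSet_Ioc).2 (ae_of_all _ fun s hs => ?_)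
    have : s ^ (q - 1) = s ^ (q - 2) * s := by
      rw [← Real.rpow_add_one hs.1.ne']; congr 1; ring
    simp only [Pi.zero_apply]
    rw [this]
    have h3 : x * s ^ (q - 2) - s ^ (q - 2) * s = s ^ (q - 2) * (x - s) := by ring
    rw [h3]
    have := Real.rpow_nonneg hs.1.le (q - 2)
    have h5 : 0 ≤ x - s := sub_nonneg.2 hs.2
    positivity

theorem lintegral_ofReal_rpow {q : ℝ} (hq : 1 < q) {f : Ω → ℝ} (hf : AEMeasurable f μ)
    (hf0 : ∀ᵐ ω ∂μ, 0 ≤ f ω) :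
    ∫⁻ ω, ENNReal.ofReal (f ω) ^ q ∂μ = ∫⁻ s in Ioi (0 : ℝ),
      ENNReal.ofReal (q * (q - 1) * s ^ (q - 2)) * ∫⁻ ω, ENNReal.ofReal (f ω - s) ∂μ := by
  have hw : Measurable fun s : ℝ => ENNReal.ofReal (q * (q - 1) * s ^ (q - 2)) := by fun_prop
  rw [lintegral_congr_ae (hf0.mono fun ω hω => ofReal_rpow_eq_lintegral hq hω),
    lintegral_lintegral_swap]
  · refine lintegral_congr fun s => ?_
    rw [lintegral_const_mul'' _ (by fun_prop)]
  · have h1 : AEMeasurable (fun p : Ω × ℝ => f p.1) (μ.prod (volume.restrict (Ioi 0))) :=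
      hf.comp_fst
    have h2 : AEMeasurable (fun p : Ω × ℝ => p.2) (μ.prod (volume.restrict (Ioi 0))) :=
      measurable_snd.aemeasurable
    exact (hw.comp measurable_snd).aemeasurable.mul (h1.sub h2).ennreal_ofReal

/-- Stop-loss domination holds at every level `s`; integrating it against the weight `q (q - 1) s ^
(q - 2)` compares the `q`-th moments. -/
theorem IsDistortion.lintegral_rpow_le {σ : ℝ → ℝ} (hσ : IsDistortion σ) {ζ : Ω → ℝ}
    (hm : Measurable ζ) (hnn : ∀ ω, 0 ≤ ζ ω) (hζ : Integrable ζ μ) (h1 : ∫ ω, ζ ω ∂μ = 1)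
    (havar : ∀ α ∈ Ioo (0 : ℝ) 1, AVaR μ α ζ ≤ (1 - α)⁻¹ * ∫ u in α..1, σ u)
    {q : ℝ} (hq : 1 < q) :
    ∫⁻ ω, ENNReal.ofReal (ζ ω) ^ q ∂μ ≤
      ∫⁻ u in Ico (0 : ℝ) 1, ENNReal.ofReal (σ u) ^ q := by
  have hlayer : ∀ s : ℝ, ∫⁻ ω, ENNReal.ofReal (ζ ω - s) ∂μ ≤
      ∫⁻ u in Ico (0 : ℝ) 1, ENNReal.ofReal (σ u - s) := by
    intro s
    have h := ENNReal.ofReal_le_ofReal (hσ.integral_max_sub_le hm hζ h1 havar s)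
    rw [ofReal_integral_eq_lintegral_ofReal (integrable_max_sub hζ s)
      (ae_of_all _ fun _ => le_max_right _ _), ofReal_integral_eq_lintegral_ofReal
      (integrable_max_sub hσ.integrableOn s) (ae_of_all _ fun _ => le_max_right _ _)] at h
    have e : ∀ a : ℝ, ENNReal.ofReal (max a 0) = ENNReal.ofReal a := fun a => by
      rw [ENNReal.ofReal_max, ENNReal.ofReal_zero, max_eq_left zero_le]
    simpa only [e] using h
  rw [lintegral_ofReal_rpow hq hm.aemeasurable (ae_of_all _ hnn), lintegral_ofReal_rpow hq hσ.aemeasurable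
    ((ae_restrict_iff' measurableSet_Ico).2 (ae_of_all _ hσ.nonneg))]
  exact lintegral_mono fun s => mul_le_mul_right (hlayer s) _

end Density

/-- A non-empty collection of distortion functions, bounded in `L^q`. -/
structure IsBoundedFamily (q : ℝ≥0∞) (S : Set (ℝ → ℝ)) (k : ℝ≥0) : Prop where
  nonempty : S.Nonempty
  isDistortion : ∀ σ ∈ S, IsDistortion σ
  norm_le : ∀ σ ∈ S, distortionNorm q σ ≤ k

/-- For finite `q` this is the comparison of moments. For `q = ∞`, the stop-loss integral of `σ` at
the level of its essential supremum is zero, hence so is that of `ζ`. -/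
theorem IsRiskDensity.eLpNorm_le {Ω : Type*} [MeasurableSpace Ω] {μ : Measure Ω}
    [IsProbabilityMeasure μ] {q : ℝ≥0∞} (hq : 1 < q) {S : Set (ℝ → ℝ)} {k : ℝ≥0}
    (hS : IsBoundedFamily q S k) {ζ : Ω → ℝ} (hζ : IsRiskDensity S μ ζ) :
    eLpNorm ζ q μ ≤ k := by
  obtain ⟨σ, hσS, havar⟩ := hζ.avar_le
  have hσ := hS.isDistortion σ hσS
  refine le_trans ?_ (hS.norm_le σ hσS)
  rw [distortionNorm]
  rcases eq_or_ne q ∞ with rfl | hqt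
  · rw [eLpNorm_exponent_top, eLpNorm_exponent_top]
    set M := eLpNormEssSup σ (volume.restrict (Ico (0 : ℝ) 1)) with hM
    have hMt : M ≠ ∞ := by
      have := hS.norm_le σ hσS
      rw [distortionNorm, eLpNorm_exponent_top] at this
      exact ne_top_of_le_ne_top ENNReal.coe_ne_top this
    have hσM : ∀ᵐ u ∂volume.restrict (Ico (0 : ℝ) 1), max (σ u - M.toReal) 0 = 0 := by
      filter_upwards [ae_le_eLpNormEssSup (f := σ) (μ := volume.restrict (Ico (0 : ℝ) 1))]
        with u hu
      refine max_eq_right (sub_nonpos.2 ?_)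
      have := ENNReal.toReal_mono hMt hu
      rw [toReal_enorm] at this
      exact (le_abs_self _).trans this
    have h := hσ.integral_max_sub_le hζ.measurable hζ.integrable hζ.integral_eq_one havar M.toReal
    rw [integral_congr_ae hσM, integral_zero] at h
    have h0 := (integral_eq_zero_iff_of_nonneg (fun ω => le_max_right _ _)
      (integrable_max_sub hζ.integrable M.toReal)).1
      (le_antisymm h (integral_nonneg fun ω => le_max_right _ _))
    refine eLpNormEssSup_le_of_ae_enorm_bound ?_
    filter_upwards [h0] with ω hω
    have h2 : ζ ω ≤ M.toReal := sub_nonpos.1 (max_eq_right_iff.1 hω)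
    rw [Real.enorm_of_nonneg (hζ.nonneg ω)]
    exact ENNReal.ofReal_le_of_le_toReal h2
  · have hq0 : q ≠ 0 := (zero_lt_one.trans hq).ne'
    have hq1 : 1 < q.toReal := by
      rw [← ENNReal.toReal_one]; exact (ENNReal.toReal_lt_toReal ENNReal.one_ne_top hqt).2 hq
    rw [eLpNorm_eq_lintegral_rpow_enorm_toReal hq0 hqt,
      eLpNorm_eq_lintegral_rpow_enorm_toReal hq0 hqt]
    refine ENNReal.rpow_le_rpow ?_ (by positivity)
    have h := hσ.lintegral_rpow_le hζ.measurable hζ.nonneg hζ.integrable hζ.integral_eq_one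
      havar hq1
    refine le_trans (le_of_eq ?_) (h.trans (le_of_eq ?_))
    · exact lintegral_congr fun ω => by rw [Real.enorm_of_nonneg (hζ.nonneg ω)]
    · refine setLIntegral_congr_fun measurableSet_Ico fun u hu => ?_
      rw [Real.enorm_of_nonneg (hσ.nonneg u hu)]

/-- The constant density. -/
theorem IsBoundedFamily.isRiskDensity_one {Ω : Type*} [MeasurableSpace Ω] {μ : Measure Ω}
    [IsProbabilityMeasure μ] {q : ℝ≥0∞} {S : Set (ℝ → ℝ)} {k : ℝ≥0}
    (hS : IsBoundedFamily q S k) : IsRiskDensity S μ (fun _ => (1 : ℝ)) where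
  measurable := measurable_const
  nonneg _ := zero_le_one
  integrable := integrable_const _
  integral_eq_one := by simp
  avar_le := by
    obtain ⟨σ, hσ⟩ := hS.nonempty
    refine ⟨σ, hσ, fun α hα => ?_⟩
    have h1 : AVaR μ α (fun _ => (1 : ℝ)) ≤ 1 := by
      refine (ciInf_le (bddBelow_avar (integrable_const _) hα) 1).trans ?_
      simp
    have h2 := (hS.isDistortion σ hσ).one_sub_le_integral hα
    have h3 : 0 < 1 - α := by linarith [hα.2]
    calc AVaR μ α (fun _ => (1 : ℝ)) ≤ 1 := h1
      _ = (1 - α)⁻¹ * (1 - α) := (inv_mul_cancel₀ h3.ne').symm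
      _ ≤ _ := mul_le_mul_of_nonneg_left h2 (inv_nonneg.2 h3.le)

/-- Averaging an admissible density over a coupling yields an admissible density. -/
theorem IsRiskDensity.average {X Y : Type*} [MeasurableSpace X] [MeasurableSpace Y]
    {μ : Measure X} {ν : Measure Y} [IsProbabilityMeasure μ] [IsProbabilityMeasure ν]
    (ρ : Kernel Y X) [IsMarkovKernel ρ] (hρ : (ν ⊗ₘ ρ).map Prod.snd = μ) {S : Set (ℝ → ℝ)}
    {ζ : X → ℝ} (hζ : IsRiskDensity S μ ζ) :
    IsRiskDensity S ν (fun y => ∫ x, ζ x ∂ρ y) := by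
  have hint : ∀ {f : X → ℝ}, Integrable f μ → Integrable (fun p : Y × X => f p.2) (ν ⊗ₘ ρ) := by
    intro f hf
    rw [← hρ] at hf
    exact hf.comp_measurable measurable_snd
  have hint' : ∀ {f : X → ℝ}, Integrable f μ →
      ∫ y, ∫ x, f x ∂ρ y ∂ν = ∫ x, f x ∂μ := by
    intro f hf
    rw [← Measure.integral_compProd (f := fun p : Y × X => f p.2) (hint hf)]
    have h := integral_map (μ := ν ⊗ₘ ρ) (φ := Prod.snd) (f := f) measurable_snd.aemeasurable
      (by rw [hρ]; exact hf.aestronglyMeasurable)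
    rw [← h, hρ]
  have hae : ∀ {f : X → ℝ}, Integrable f μ → ∀ᵐ y ∂ν, Integrable f (ρ y) := fun hf =>
    ((Measure.integrable_compProd_iff (hint hf).aestronglyMeasurable).1 (hint hf)).1
  have hi : Integrable (fun y => ∫ x, ζ x ∂ρ y) ν := Integrable.integral_compProd (hint hζ.integrable)
  refine ⟨?_, fun y => integral_nonneg hζ.nonneg, hi, ?_, ?_⟩
  · exact (hζ.measurable.stronglyMeasurable.comp_measurable
      measurable_snd).integral_kernel_prod_right'.measurable
  · rw [hint' hζ.integrable, hζ.integral_eq_one]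
  · obtain ⟨σ, hσ, h⟩ := hζ.avar_le
    refine ⟨σ, hσ, fun α hα => le_trans ?_ (h α hα)⟩
    -- By Jensen's inequality for `x ↦ (x - s)₊`, averaging lowers the expression under the infimum
    -- for every threshold `s`.
    refine ciInf_mono (bddBelow_avar hi hα) fun s => ?_
    have hα' : 0 ≤ (1 - α)⁻¹ := inv_nonneg.2 (by linarith [hα.2])
    refine add_le_add_right (mul_le_mul_of_nonneg_left ?_ hα') _
    rw [← hint' (integrable_max_sub hζ.integrable s)]
    have h4 : Integrable (fun y => ∫ x, max (ζ x - s) 0 ∂ρ y) ν :=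
      Integrable.integral_compProd (hint (integrable_max_sub hζ.integrable s))
    refine integral_mono_ae (integrable_max_sub hi s) h4 ?_
    filter_upwards [hae hζ.integrable] with y hy
    refine max_le ?_ (integral_nonneg fun x => le_max_right _ _)
    have : (∫ x, ζ x ∂ρ y) - s = ∫ x, (ζ x - s) ∂ρ y := by
      rw [integral_sub hy (integrable_const s)]; simp
    rw [this]
    exact integral_mono (hy.sub (integrable_const s)) (integrable_max_sub hy s)
      fun x => le_max_left _ _

/-! ### Power means -/

/-- The `L^r`-norm of an extended nonnegative function. -/
def powMean {Ω : Type*} [MeasurableSpace Ω] (r : ℝ) (μ : Measure Ω) (f : Ω → ℝ≥0∞) : ℝ≥0∞ :=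
  (∫⁻ ω, f ω ^ r ∂μ) ^ (1 / r)

section PowMean

variable {Ω : Type*} [MeasurableSpace Ω] {μ : Measure Ω} {r : ℝ}

theorem powMean_rpow (hr : 1 ≤ r) (f : Ω → ℝ≥0∞) : powMean r μ f ^ r = ∫⁻ ω, f ω ^ r ∂μ := by
  rw [powMean, ← ENNReal.rpow_mul, one_div, inv_mul_cancel₀ (by linarith), ENNReal.rpow_one]

theorem powMean_congr_ae {f g : Ω → ℝ≥0∞} (h : ∀ᵐ ω ∂μ, f ω = g ω) :
    powMean r μ f = powMean r μ g := by
  rw [powMean, powMean, lintegral_congr_ae (h.mono fun ω hω => congrArg (· ^ r) hω)]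

theorem powMean_mono_ae (hr : 1 ≤ r) {f g : Ω → ℝ≥0∞} (h : ∀ᵐ ω ∂μ, f ω ≤ g ω) :
    powMean r μ f ≤ powMean r μ g :=
  ENNReal.rpow_le_rpow (lintegral_mono_ae (h.mono fun _ hω =>
    ENNReal.rpow_le_rpow hω (by linarith))) (by positivity)

theorem powMean_add_le (hr : 1 ≤ r) {f g : Ω → ℝ≥0∞} (hf : AEMeasurable f μ)
    (hg : AEMeasurable g μ) :
    powMean r μ (fun ω => f ω + g ω) ≤ powMean r μ f + powMean r μ g :=
  ENNReal.lintegral_Lp_add_le hf hg hr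

theorem powMean_const [IsProbabilityMeasure μ] (hr : 1 ≤ r) (c : ℝ≥0∞) :
    powMean r μ (fun _ => c) = c := by
  rw [powMean, lintegral_const, measure_univ, mul_one, ← ENNReal.rpow_mul, one_div,
    mul_inv_cancel₀ (by linarith), ENNReal.rpow_one]

theorem powMean_const_mul (hr : 1 ≤ r) {c : ℝ≥0∞} (hc : c ≠ ∞) (f : Ω → ℝ≥0∞) :
    powMean r μ (fun ω => c * f ω) = c * powMean r μ f := by
  have hr0 : 0 ≤ r := by linarith
  simp only [powMean, ENNReal.mul_rpow_of_nonneg _ _ hr0]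
  rw [lintegral_const_mul' _ _ (ENNReal.rpow_ne_top_of_nonneg hr0 hc),
    ENNReal.mul_rpow_of_nonneg _ _ (by positivity), ← ENNReal.rpow_mul, one_div,
    mul_inv_cancel₀ (by linarith), ENNReal.rpow_one]

theorem powMean_map {Ω' : Type*} [MeasurableSpace Ω'] {g : Ω → Ω'} (hg : Measurable g)
    {f : Ω' → ℝ≥0∞} (hf : Measurable f) :
    powMean r (μ.map g) f = powMean r μ (fun ω => f (g ω)) := by
  rw [powMean, powMean, lintegral_map (hf.pow_const r) hg]

theorem ae_lt_top_of_powMean (hr : 1 ≤ r) {f : Ω → ℝ≥0∞} (hf : AEMeasurable f μ)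
    (h : powMean r μ f ≠ ∞) : ∀ᵐ ω ∂μ, f ω < ∞ := by
  have h1 : ∫⁻ ω, f ω ^ r ∂μ ≠ ∞ := by
    rw [← powMean_rpow hr]
    exact ENNReal.rpow_ne_top_of_nonneg (by linarith) h
  filter_upwards [ae_lt_top' (hf.pow_const r) h1] with ω hω
  exact (ENNReal.rpow_lt_top_iff_of_pos (by linarith)).1 hω

theorem eLpNorm_eq_powMean (hr : 1 ≤ r) (Y : Ω → ℝ) :
    eLpNorm Y (ENNReal.ofReal r) μ = powMean r μ (fun ω => ‖Y ω‖ₑ) := by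
  rw [eLpNorm_eq_lintegral_rpow_enorm_toReal (by simp; linarith) ENNReal.ofReal_ne_top,
    ENNReal.toReal_ofReal (by linarith), powMean]

theorem eLpNorm_toReal_le (hr : 1 ≤ r) (f : Ω → ℝ≥0∞) :
    eLpNorm (fun ω => (f ω).toReal) (ENNReal.ofReal r) μ ≤ powMean r μ f := by
  rw [eLpNorm_eq_powMean hr]
  refine powMean_mono_ae hr (ae_of_all _ fun ω => ?_)
  rw [Real.enorm_of_nonneg ENNReal.toReal_nonneg]
  exact ENNReal.ofReal_toReal_le

theorem memLp_iff_powMean (hr : 1 ≤ r) {Y : Ω → ℝ} (hY : AEStronglyMeasurable Y μ) :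
    MemLp Y (ENNReal.ofReal r) μ ↔ powMean r μ (fun ω => ‖Y ω‖ₑ) ≠ ∞ := by
  rw [← eLpNorm_eq_powMean hr, ← lt_top_iff_ne_top]
  exact ⟨fun h => h.2, fun h => ⟨hY, h⟩⟩

theorem memLp_toReal (hr : 1 ≤ r) {f : Ω → ℝ≥0∞} (hf : AEMeasurable f μ)
    (h : powMean r μ f ≠ ∞) : MemLp (fun ω => (f ω).toReal) (ENNReal.ofReal r) μ :=
  ⟨hf.ennreal_toReal.aestronglyMeasurable, (eLpNorm_toReal_le hr f).trans_lt h.lt_top⟩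

/-- Hölder's inequality, including the limiting case of an essentially bounded density. -/
theorem lintegral_mul_ofReal_le (hr : 1 ≤ r) {q : ℝ≥0∞}
    (hq : (ENNReal.ofReal r)⁻¹ + q⁻¹ = 1) {f : Ω → ℝ≥0∞} (hf : AEMeasurable f μ) {ζ : Ω → ℝ}
    (hζ : AEMeasurable ζ μ) (h0 : ∀ ω, 0 ≤ ζ ω) {k : ℝ≥0} (hk : eLpNorm ζ q μ ≤ k) :
    ∫⁻ ω, f ω * ENNReal.ofReal (ζ ω) ∂μ ≤ powMean r μ f * k := by
  rcases hr.eq_or_lt with rfl | hr1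
  · have hqt : q = ∞ := by
      rw [ENNReal.ofReal_one, inv_one] at hq
      have : q⁻¹ = 0 := by
        have h1 : (1 : ℝ≥0∞) + q⁻¹ = 1 + 0 := by rw [hq, add_zero]
        exact (ENNReal.add_right_inj ENNReal.one_ne_top).1 h1
      exact ENNReal.inv_eq_zero.1 this
    subst hqt
    rw [eLpNorm_exponent_top] at hk
    have : ∀ᵐ ω ∂μ, f ω * ENNReal.ofReal (ζ ω) ≤ f ω * k := by
      filter_upwards [ae_le_eLpNormEssSup (f := ζ) (μ := μ)] with ω hω
      rw [Real.enorm_of_nonneg (h0 ω)] at hω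
      gcongr
      exact hω.trans hk
    refine (lintegral_mono_ae this).trans ?_
    rw [lintegral_mul_const'' _ hf, powMean]
    simp
  · have hqt : q ≠ ∞ := by
      rintro rfl
      rw [ENNReal.inv_top, add_zero, ENNReal.inv_eq_one, ENNReal.ofReal_eq_one] at hq
      exact hr1.ne' hq
    have hq0 : q ≠ 0 := by
      rintro rfl
      simp at hq
    have hqr : r⁻¹ + q.toReal⁻¹ = 1 := by
      have := congrArg ENNReal.toReal hq
      rw [ENNReal.toReal_add (by simp; linarith) (by simpa using hq0), ENNReal.toReal_inv,
        ENNReal.toReal_inv, ENNReal.toReal_ofReal (by linarith), ENNReal.toReal_one] at this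
      exact this
    have hc : r.HolderConjugate q.toReal := by
      rw [Real.holderConjugate_iff]
      exact ⟨hr1, hqr⟩
    refine (ENNReal.lintegral_mul_le_Lp_mul_Lq μ hc hf hζ.ennreal_ofReal).trans ?_
    rw [eLpNorm_eq_lintegral_rpow_enorm_toReal hq0 hqt] at hk
    rw [powMean]
    gcongr
    refine le_trans (le_of_eq ?_) hk
    congr 1
    exact lintegral_congr fun ω => by rw [Real.enorm_of_nonneg (h0 ω)]

end PowMean

/-- Since `r` is a real number, `1 / r` is positive and leaves less than one for `1 / q`. -/
theorem one_lt_conjugate {r : ℝ} {q : ℝ≥0∞}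
    (hq : (ENNReal.ofReal r)⁻¹ + q⁻¹ = 1) : 1 < q := by
  rw [← ENNReal.inv_lt_one]
  by_contra h
  push Not at h
  have h1 : (ENNReal.ofReal r)⁻¹ ≠ 0 := by simp
  have h2 : q⁻¹ ≠ ∞ := by
    intro h; rw [h] at hq; simp at hq
  have : q⁻¹ < (ENNReal.ofReal r)⁻¹ + q⁻¹ := by
    rw [add_comm]; exact ENNReal.lt_add_right h2 h1
  rw [hq] at this
  exact absurd h (not_le.2 this)

/-! ### The risk functional -/

section Risk

variable {r : ℝ} {q : ℝ≥0∞} {S : Set (ℝ → ℝ)} {k : ℝ≥0}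

theorem riskFunctional_congr_ae {Ω : Type*} [MeasurableSpace Ω] {μ : Measure Ω} {Y Y' : Ω → ℝ}
    (h : ∀ᵐ ω ∂μ, Y ω = Y' ω) : riskFunctional S μ Y = riskFunctional S μ Y' := by
  have : ∀ ζ : Ω → ℝ, ∫ ω, Y ω * ζ ω ∂μ = ∫ ω, Y' ω * ζ ω ∂μ := fun ζ =>
    integral_congr_ae (h.mono fun ω hω => by simp only [hω])
  simp only [riskFunctional, this]

/-- Hölder's inequality, for a density known only through its `L^q` norm, so that it also applies on
a coupling to a density of one coordinate. -/
theorem integrable_mul_of_eLpNorm {Ω : Type*} [MeasurableSpace Ω] {μ : Measure Ω}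
    (hr : 1 ≤ r) (hq : (ENNReal.ofReal r)⁻¹ + q⁻¹ = 1) {ζ : Ω → ℝ} (hζ : AEMeasurable ζ μ)
    (h0 : ∀ ω, 0 ≤ ζ ω) (hk : eLpNorm ζ q μ ≤ k) {Y : Ω → ℝ}
    (hY : MemLp Y (ENNReal.ofReal r) μ) :
    Integrable (fun ω => Y ω * ζ ω) μ ∧
      |∫ ω, Y ω * ζ ω ∂μ| ≤ k * (powMean r μ (fun ω => ‖Y ω‖ₑ)).toReal := by
  have hfin : powMean r μ (fun ω => ‖Y ω‖ₑ) ≠ ∞ := (memLp_iff_powMean hr hY.1).1 hY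
  have h := lintegral_mul_ofReal_le hr hq hY.1.enorm hζ h0 hk
  have e : ∫⁻ ω, ‖Y ω * ζ ω‖ₑ ∂μ = ∫⁻ ω, ‖Y ω‖ₑ * ENNReal.ofReal (ζ ω) ∂μ :=
    lintegral_congr fun ω => by rw [enorm_mul, Real.enorm_of_nonneg (h0 ω)]
  rw [← e] at h
  have ht : powMean r μ (fun ω => ‖Y ω‖ₑ) * k ≠ ∞ := ENNReal.mul_ne_top hfin ENNReal.coe_ne_top
  refine ⟨⟨hY.1.mul hζ.aestronglyMeasurable, h.trans_lt ht.lt_top⟩, ?_⟩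
  have h2 := (enorm_integral_le_lintegral_enorm (μ := μ) fun ω => Y ω * ζ ω).trans h
  have h3 := ENNReal.toReal_mono ht h2
  rw [toReal_enorm, Real.norm_eq_abs, ENNReal.toReal_mul, ENNReal.coe_toReal, mul_comm] at h3
  exact h3

theorem IsRiskDensity.integrable_mul {Ω : Type*} [MeasurableSpace Ω] {μ : Measure Ω}
    [IsProbabilityMeasure μ] (hr : 1 ≤ r) (hq : (ENNReal.ofReal r)⁻¹ + q⁻¹ = 1)
    (hS : IsBoundedFamily q S k) {ζ : Ω → ℝ} (hζ : IsRiskDensity S μ ζ) {Y : Ω → ℝ}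
    (hY : MemLp Y (ENNReal.ofReal r) μ) :
    Integrable (fun ω => Y ω * ζ ω) μ ∧
      |∫ ω, Y ω * ζ ω ∂μ| ≤ k * (powMean r μ (fun ω => ‖Y ω‖ₑ)).toReal :=
  integrable_mul_of_eLpNorm hr hq hζ.measurable.aemeasurable hζ.nonneg
    (hζ.eLpNorm_le (one_lt_conjugate hq) hS) hY

/-- Hölder's inequality bounds the set under the real supremum, which is therefore a genuine
supremum. -/
theorem integral_mul_le_riskFunctional {Ω : Type*} [MeasurableSpace Ω] {μ : Measure Ω}
    [IsProbabilityMeasure μ] (hr : 1 ≤ r) (hq : (ENNReal.ofReal r)⁻¹ + q⁻¹ = 1)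
    (hS : IsBoundedFamily q S k) {ζ : Ω → ℝ} (hζ : IsRiskDensity S μ ζ) {Y : Ω → ℝ}
    (hY : MemLp Y (ENNReal.ofReal r) μ) :
    ∫ ω, Y ω * ζ ω ∂μ ≤ riskFunctional S μ Y := by
  refine le_csSup ⟨k * (powMean r μ (fun ω => ‖Y ω‖ₑ)).toReal, ?_⟩ ⟨ζ, hζ, rfl⟩
  rintro _ ⟨ζ', hζ', rfl⟩
  exact (le_abs_self _).trans (hζ'.integrable_mul hr hq hS hY).2

theorem riskFunctional_le {Ω : Type*} [MeasurableSpace Ω] {μ : Measure Ω}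
    [IsProbabilityMeasure μ] (hS : IsBoundedFamily q S k) {Y : Ω → ℝ} {c : ℝ}
    (h : ∀ ζ, IsRiskDensity S μ ζ → ∫ ω, Y ω * ζ ω ∂μ ≤ c) : riskFunctional S μ Y ≤ c := by
  refine csSup_le ⟨_, _, hS.isRiskDensity_one, rfl⟩ ?_
  rintro _ ⟨ζ, hζ, rfl⟩
  exact h ζ hζ

theorem abs_riskFunctional_le {Ω : Type*} [MeasurableSpace Ω] {μ : Measure Ω}
    [IsProbabilityMeasure μ] (hr : 1 ≤ r) (hq : (ENNReal.ofReal r)⁻¹ + q⁻¹ = 1)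
    (hS : IsBoundedFamily q S k) {Y : Ω → ℝ} (hY : MemLp Y (ENNReal.ofReal r) μ) :
    |riskFunctional S μ Y| ≤ k * (powMean r μ (fun ω => ‖Y ω‖ₑ)).toReal := by
  rw [abs_le]
  constructor
  · exact (neg_le_of_abs_le (hS.isRiskDensity_one.integrable_mul hr hq hS hY).2).trans
      (integral_mul_le_riskFunctional hr hq hS hS.isRiskDensity_one hY)
  · exact riskFunctional_le hS fun ζ hζ =>
      (le_abs_self _).trans (hζ.integrable_mul hr hq hS hY).2

/-! ### Comparison of risks through couplings. -/

variable {X Y : Type*} [MeasurableSpace X] [MeasurableSpace Y] {μ : Measure X} {ν : Measure Y}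

theorem IsCoupling.isProbabilityMeasure [IsProbabilityMeasure μ] {π : Measure (X × Y)}
    (hπ : IsCoupling μ ν π) : IsProbabilityMeasure π := by
  refine ⟨?_⟩
  have : μ univ = 1 := measure_univ
  rw [← hπ.1, Measure.map_apply measurable_fst MeasurableSet.univ, preimage_univ] at this
  exact this

theorem IsCoupling.memLp_snd {π : Measure (X × Y)} (hπ : IsCoupling μ ν π) {f : Y → ℝ}
    {p : ℝ≥0∞} (hf : MemLp f p ν) : MemLp (fun z => f z.2) p π := by
  rw [← hπ.2] at hf
  exact hf.comp_of_map measurable_snd.aemeasurable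

theorem IsCoupling.memLp_fst {π : Measure (X × Y)} (hπ : IsCoupling μ ν π) {f : X → ℝ}
    {p : ℝ≥0∞} (hf : MemLp f p μ) : MemLp (fun z => f z.1) p π := by
  rw [← hπ.1] at hf
  exact hf.comp_of_map measurable_fst.aemeasurable

theorem IsCoupling.eLpNorm_fst {π : Measure (X × Y)} (hπ : IsCoupling μ ν π) {f : X → ℝ}
    (hf : Measurable f) (p : ℝ≥0∞) : eLpNorm (fun z : X × Y => f z.1) p π = eLpNorm f p μ := by
  rw [← hπ.1, eLpNorm_map_measure hf.aestronglyMeasurable measurable_fst.aemeasurable]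
  rfl

/-- Disintegrate the coupling over its second coordinate and let the new density be the conditional
mean of `ζ`; the identity is then Fubini's theorem. -/
theorem IsCoupling.exists_average [StandardBorelSpace X] [Nonempty X] [IsProbabilityMeasure μ]
    [IsProbabilityMeasure ν] {π : Measure (X × Y)} (hπ : IsCoupling μ ν π) {ζ : X → ℝ}
    (hζ : IsRiskDensity S μ ζ) :
    ∃ ζ' : Y → ℝ, IsRiskDensity S ν ζ' ∧ ∀ V : Y → ℝ,
      Integrable (fun z : X × Y => V z.2 * ζ z.1) π →
      ∫ z, V z.2 * ζ z.1 ∂π = ∫ y, V y * ζ' y ∂ν := by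
  have := hπ.isProbabilityMeasure
  have hsw : (π.map Prod.swap).fst = ν := by
    rw [Measure.fst, Measure.map_map measurable_fst measurable_swap, ← hπ.2]; rfl
  have hsw2 : (π.map Prod.swap).snd = μ := by
    rw [Measure.snd, Measure.map_map measurable_snd measurable_swap, ← hπ.1]; rfl
  have : IsProbabilityMeasure (π.map Prod.swap) :=
    Measure.isProbabilityMeasure_map measurable_swap.aemeasurable
  obtain ⟨ρ, hρ, hdis⟩ : ∃ ρ : Kernel Y X, IsMarkovKernel ρ ∧ ν ⊗ₘ ρ = π.map Prod.swap := by
    have := (π.map Prod.swap).disintegrate (π.map Prod.swap).condKernel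
    rw [hsw] at this
    exact ⟨_, inferInstance, this⟩
  refine ⟨fun y => ∫ x, ζ x ∂ρ y, hζ.average _ ?_, ?_⟩
  · rw [hdis]; exact hsw2
  · intro V hV
    have hV' : Integrable (fun z : Y × X => V z.1 * ζ z.2) (π.map Prod.swap) :=
      (integrable_map_equiv MeasurableEquiv.prodComm _).2 hV
    have e : ∫ z, V z.2 * ζ z.1 ∂π = ∫ z, V z.1 * ζ z.2 ∂(π.map Prod.swap) :=
      (integral_map_equiv MeasurableEquiv.prodComm (fun z : Y × X => V z.1 * ζ z.2)).symm
    rw [← hdis] at hV' e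
    rw [e, Measure.integral_compProd hV']
    exact integral_congr_ae (ae_of_all _ fun y => by simp only [integral_const_mul])

/-- Comparison of the risk of two random variables through a coupling. -/
theorem riskFunctional_le_add_of_integral_le [StandardBorelSpace X] [Nonempty X]
    [IsProbabilityMeasure μ] [IsProbabilityMeasure ν] (hr : 1 ≤ r)
    (hq : (ENNReal.ofReal r)⁻¹ + q⁻¹ = 1) (hS : IsBoundedFamily q S k) {π : Measure (X × Y)}
    (hπ : IsCoupling μ ν π) {V : X → ℝ} {W : Y → ℝ} (hW : MemLp W (ENNReal.ofReal r) ν)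
    {ℓ : X × Y → ℝ≥0∞} (hℓ : AEMeasurable ℓ π) (hfin : powMean r π ℓ ≠ ∞)
    (h : ∀ ζ, IsRiskDensity S μ ζ →
      ∫ x, V x * ζ x ∂μ ≤ ∫ z, (W z.2 + (ℓ z).toReal) * ζ z.1 ∂π) :
    riskFunctional S μ V ≤ riskFunctional S ν W + k * (powMean r π ℓ).toReal := by
  refine riskFunctional_le hS fun ζ hζ => (h ζ hζ).trans ?_
  have hk : eLpNorm (fun z : X × Y => ζ z.1) q π ≤ k := by
    rw [hπ.eLpNorm_fst hζ.measurable]; exact hζ.eLpNorm_le (one_lt_conjugate hq) hS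
  have hζm : AEMeasurable (fun z : X × Y => ζ z.1) π :=
    (hζ.measurable.comp measurable_fst).aemeasurable
  have h1 := integrable_mul_of_eLpNorm hr hq hζm (fun z => hζ.nonneg z.1) hk (hπ.memLp_snd hW)
  have h2 := integrable_mul_of_eLpNorm hr hq hζm (fun z => hζ.nonneg z.1) hk
    (memLp_toReal hr hℓ hfin)
  have e : ∀ z : X × Y, (W z.2 + (ℓ z).toReal) * ζ z.1 = W z.2 * ζ z.1 + (ℓ z).toReal * ζ z.1 :=
    fun z => add_mul _ _ _
  simp only [e]
  rw [integral_add h1.1 h2.1]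
  -- The term with `W` becomes an expectation under `ν` against an admissible density, so the risk
  -- of `W` bounds it; Hölder's inequality takes care of the term with `ℓ`.
  obtain ⟨ζ', hζ', he⟩ := hπ.exists_average hζ
  rw [he W h1.1]
  refine add_le_add (integral_mul_le_riskFunctional hr hq hS hζ' hW) ?_
  refine (le_abs_self _).trans (h2.2.trans ?_)
  refine mul_le_mul_of_nonneg_left (ENNReal.toReal_mono hfin ?_) k.2
  rw [← eLpNorm_eq_powMean hr]
  exact eLpNorm_toReal_le hr ℓ

theorem riskFunctional_le_add [StandardBorelSpace X] [Nonempty X]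
    [IsProbabilityMeasure μ] [IsProbabilityMeasure ν] (hr : 1 ≤ r)
    (hq : (ENNReal.ofReal r)⁻¹ + q⁻¹ = 1) (hS : IsBoundedFamily q S k) {π : Measure (X × Y)}
    (hπ : IsCoupling μ ν π) {V : X → ℝ} {W : Y → ℝ} (hV : MemLp V (ENNReal.ofReal r) μ)
    (hW : MemLp W (ENNReal.ofReal r) ν)
    {ℓ : X × Y → ℝ≥0∞} (hℓ : AEMeasurable ℓ π) (hfin : powMean r π ℓ ≠ ∞)
    (h : ∀ᵐ z ∂π, V z.1 ≤ W z.2 + (ℓ z).toReal) :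
    riskFunctional S μ V ≤ riskFunctional S ν W + k * (powMean r π ℓ).toReal := by
  refine riskFunctional_le_add_of_integral_le hr hq hS hπ hW hℓ hfin fun ζ hζ => ?_
  have hk : eLpNorm (fun z : X × Y => ζ z.1) q π ≤ k := by
    rw [hπ.eLpNorm_fst hζ.measurable]; exact hζ.eLpNorm_le (one_lt_conjugate hq) hS
  have hζm : AEMeasurable (fun z : X × Y => ζ z.1) π :=
    (hζ.measurable.comp measurable_fst).aemeasurable
  have e : ∫ x, V x * ζ x ∂μ = ∫ z : X × Y, V z.1 * ζ z.1 ∂π := by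
    have hm : AEStronglyMeasurable (fun x => V x * ζ x) (π.map Prod.fst) := by
      rw [hπ.1]; exact hV.1.mul hζ.measurable.aestronglyMeasurable
    rw [← integral_map measurable_fst.aemeasurable hm, hπ.1]
  rw [e]
  refine integral_mono_ae
    (integrable_mul_of_eLpNorm hr hq hζm (fun z => hζ.nonneg z.1) hk (hπ.memLp_fst hV)).1
    (integrable_mul_of_eLpNorm hr hq hζm (fun z => hζ.nonneg z.1) hk
      ((hπ.memLp_snd hW).add (memLp_toReal hr hℓ hfin))).1 ?_
  exact h.mono fun z hz => mul_le_mul_of_nonneg_right hz (hζ.nonneg z.1)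

/-- The inequality is required only after averaging over `y` given `x`: the density depends on `x`
alone and comes out of the inner integral. A map selecting points below the mean provides exactly
this inequality. -/
theorem riskFunctional_le_add_of_average [StandardBorelSpace X] [Nonempty X]
    [IsProbabilityMeasure μ] [IsProbabilityMeasure ν] (hr : 1 ≤ r)
    (hq : (ENNReal.ofReal r)⁻¹ + q⁻¹ = 1) (hS : IsBoundedFamily q S k) {ρ : Kernel X Y}
    [IsMarkovKernel ρ] (hπ : IsCoupling μ ν (μ ⊗ₘ ρ)) {V : X → ℝ} {W : Y → ℝ}
    (hV : MemLp V (ENNReal.ofReal r) μ) (hW : MemLp W (ENNReal.ofReal r) ν)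
    {ℓ : X × Y → ℝ≥0∞} (hℓ : AEMeasurable ℓ (μ ⊗ₘ ρ)) (hfin : powMean r (μ ⊗ₘ ρ) ℓ ≠ ∞)
    (h : ∀ᵐ x ∂μ, V x ≤ ∫ y, (W y + (ℓ (x, y)).toReal) ∂ρ x) :
    riskFunctional S μ V ≤ riskFunctional S ν W + k * (powMean r (μ ⊗ₘ ρ) ℓ).toReal := by
  refine riskFunctional_le_add_of_integral_le hr hq hS hπ hW hℓ hfin fun ζ hζ => ?_
  have hk : eLpNorm (fun z : X × Y => ζ z.1) q (μ ⊗ₘ ρ) ≤ k := by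
    rw [hπ.eLpNorm_fst hζ.measurable]; exact hζ.eLpNorm_le (one_lt_conjugate hq) hS
  have hζm : AEMeasurable (fun z : X × Y => ζ z.1) (μ ⊗ₘ ρ) :=
    (hζ.measurable.comp measurable_fst).aemeasurable
  have hint := (integrable_mul_of_eLpNorm hr hq hζm (fun z => hζ.nonneg z.1) hk
      ((hπ.memLp_snd hW).add (memLp_toReal hr hℓ hfin))).1
  simp only [Pi.add_apply] at hint
  rw [Measure.integral_compProd hint]
  refine integral_mono_ae (hζ.integrable_mul hr hq hS hV).1 (Integrable.integral_compProd hint) ?_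
  filter_upwards [h] with x hx
  simp only [integral_mul_const]
  exact mul_le_mul_of_nonneg_right hx (hζ.nonneg x)

/-- Law invariance of the risk functional. -/
theorem riskFunctional_map [StandardBorelSpace X] [Nonempty X] [StandardBorelSpace Y]
    [Nonempty Y] [IsProbabilityMeasure μ] (hr : 1 ≤ r)
    (hq : (ENNReal.ofReal r)⁻¹ + q⁻¹ = 1) (hS : IsBoundedFamily q S k) {f : X → Y}
    (hf : Measurable f) {W : Y → ℝ} (hm : Measurable W)
    (hW : MemLp (fun x => W (f x)) (ENNReal.ofReal r) μ) :
    riskFunctional S (μ.map f) W = riskFunctional S μ (fun x => W (f x)) := by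
  have : IsProbabilityMeasure (μ.map f) := Measure.isProbabilityMeasure_map hf.aemeasurable
  have hW' : MemLp W (ENNReal.ofReal r) (μ.map f) :=
    (memLp_map_measure_iff hm.aestronglyMeasurable hf.aemeasurable).2 hW
  have hr0 : 0 < r := by linarith
  have hg1 : Measurable fun x => (x, f x) := measurable_id.prodMk hf
  have hg2 : Measurable fun x => (f x, x) := hf.prodMk measurable_id
  apply le_antisymm
  -- The graph of `f` couples a law with its image at no cost; each inequality uses one orientation
  -- of the graph.
  · have hc : IsCoupling (μ.map f) μ (μ.map fun x => (f x, x)) :=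
      ⟨by rw [Measure.map_map measurable_fst hg2]; rfl,
        by rw [Measure.map_map measurable_snd hg2]; exact Measure.map_id⟩
    have hp : powMean r (μ.map fun x => (f x, x)) (fun _ => 0) = 0 := by simp [powMean, hr0]
    have := riskFunctional_le_add hr hq hS hc hW' hW (ℓ := fun _ => 0) aemeasurable_const
      (by rw [hp]; exact ENNReal.zero_ne_top) ((ae_map_iff hg2.aemeasurable
        (measurableSet_le (by fun_prop) (by fun_prop))).2 (ae_of_all _ fun x => by simp))
    rw [hp] at this
    simpa using this
  · have hc : IsCoupling μ (μ.map f) (μ.map fun x => (x, f x)) :=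
      ⟨by rw [Measure.map_map measurable_fst hg1]; exact Measure.map_id,
        by rw [Measure.map_map measurable_snd hg1]; rfl⟩
    have hp : powMean r (μ.map fun x => (x, f x)) (fun _ => 0) = 0 := by simp [powMean, hr0]
    have := riskFunctional_le_add hr hq hS hc hW hW' (ℓ := fun _ => 0) aemeasurable_const
      (by rw [hp]; exact ENNReal.zero_ne_top) ((ae_map_iff hg1.aemeasurable
        (measurableSet_le (by fun_prop) (by fun_prop))).2 (ae_of_all _ fun x => by simp))
    rw [hp] at this
    simpa using this

end Risk

/-! ### Measurability of the conditional risk -/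

section Measurability

open Filter Topology

variable {r : ℝ} {q : ℝ≥0∞} {S : Set (ℝ → ℝ)} {k : ℝ≥0}

theorem IsCoupling.swap {X Y : Type*} [MeasurableSpace X] [MeasurableSpace Y] {μ : Measure X}
    {ν : Measure Y} {π : Measure (X × Y)} (hπ : IsCoupling μ ν π) :
    IsCoupling ν μ (π.map Prod.swap) :=
  ⟨by rw [Measure.map_map measurable_fst measurable_swap]; exact hπ.2,
    by rw [Measure.map_map measurable_snd measurable_swap]; exact hπ.1⟩

/-- The coupling of `m` and of a mixture of `m` with another measure which keeps the common
part on the diagonal. -/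
theorem isCoupling_mixture {J : Type*} [MeasurableSpace J] (m s : Measure J)
    [IsProbabilityMeasure m] [IsProbabilityMeasure s] {δ : ℝ} (h0 : 0 ≤ δ) (h1 : δ ≤ 1) :
    IsCoupling m (ENNReal.ofReal (1 - δ) • m + ENNReal.ofReal δ • s)
      (ENNReal.ofReal (1 - δ) • m.map (fun j => (j, j)) + ENNReal.ofReal δ • m.prod s) := by
  have hd : Measurable fun j : J => (j, j) := measurable_id.prodMk measurable_id
  constructor
  · rw [Measure.map_add _ _ measurable_fst, Measure.map_smul, Measure.map_smul,
      Measure.map_map measurable_fst hd, Measure.map_fst_prod]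
    simp only [measure_univ, one_smul]
    rw [show (Prod.fst ∘ fun j : J => (j, j)) = id from rfl, Measure.map_id, ← add_smul,
      ← ENNReal.ofReal_add (by linarith) h0]
    simp
  · rw [Measure.map_add _ _ measurable_snd, Measure.map_smul, Measure.map_smul,
      Measure.map_map measurable_snd hd, Measure.map_snd_prod]
    simp only [measure_univ, one_smul]
    rw [show (Prod.snd ∘ fun j : J => (j, j)) = id from rfl, Measure.map_id]

/-- Only the mass `δ` leaves the diagonal, and it pays at most `2 A`. The coupling and its transpose
give the two inequalities. -/
theorem abs_riskFunctional_sub_mixture_le {J : Type*} [MeasurableSpace J] [StandardBorelSpace J]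
    [Nonempty J] (hr : 1 ≤ r) (hq : (ENNReal.ofReal r)⁻¹ + q⁻¹ = 1)
    (hS : IsBoundedFamily q S k) (m s : Measure J)
    [IsProbabilityMeasure m] [IsProbabilityMeasure s] {δ : ℝ} (h0 : 0 ≤ δ) (h1 : δ ≤ 1)
    {m' : Measure J} [IsProbabilityMeasure m']
    (hm' : m' = ENNReal.ofReal (1 - δ) • m + ENNReal.ofReal δ • s)
    {a : J → ℝ} (ha : Measurable a) {A : ℝ} (hA : ∀ j, |a j| ≤ A) :
    |riskFunctional S m' a - riskFunctional S m a| ≤ k * (2 * A * δ ^ (1 / r)) := by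
  have hr0 : 0 < r := by linarith
  have hc := isCoupling_mixture m s h0 h1
  rw [← hm'] at hc
  set π := ENNReal.ofReal (1 - δ) • m.map (fun j => (j, j)) + ENNReal.ofReal δ • m.prod s with hπ
  have hA0 : 0 ≤ A := (abs_nonneg _).trans (hA (Classical.arbitrary J))
  have hb : ∀ x y, |a x - a y| ≤ 2 * A := fun x y => by
    have := abs_sub (a x) (a y); linarith [hA x, hA y]
  have hmemLp : ∀ (n : Measure J) [IsProbabilityMeasure n], MemLp a (ENNReal.ofReal r) n :=
    fun n _ => MemLp.of_bound ha.aestronglyMeasurable A (ae_of_all _ hA)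
  have hℓm : Measurable fun z : J × J => ‖a z.1 - a z.2‖ₑ := by fun_prop
  have hcost : powMean r π (fun z => ‖a z.1 - a z.2‖ₑ) ≤ ENNReal.ofReal (2 * A * δ ^ (1 / r)) := by
    have e : ENNReal.ofReal (2 * A * δ ^ (1 / r)) =
        (ENNReal.ofReal δ * ENNReal.ofReal (2 * A) ^ r) ^ (1 / r) := by
      rw [ENNReal.mul_rpow_of_nonneg _ _ (by positivity), ← ENNReal.rpow_mul, mul_one_div_cancel
        hr0.ne', ENNReal.rpow_one, ENNReal.ofReal_rpow_of_nonneg h0 (by positivity),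
        ENNReal.ofReal_mul (by positivity), mul_comm]
    rw [e, powMean]
    refine ENNReal.rpow_le_rpow ?_ (by positivity)
    rw [hπ, lintegral_add_measure, lintegral_smul_measure, lintegral_smul_measure,
      lintegral_map (hℓm.pow_const r) (show Measurable fun j : J => (j, j) by fun_prop)]
    simp only [sub_self, enorm_zero, ENNReal.zero_rpow_of_pos hr0, lintegral_const, zero_mul,
      mul_zero, zero_add, smul_eq_mul]
    gcongr
    calc ∫⁻ z, ‖a z.1 - a z.2‖ₑ ^ r ∂m.prod s ≤ ∫⁻ _, ENNReal.ofReal (2 * A) ^ r ∂m.prod s := by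
          refine lintegral_mono fun z => ENNReal.rpow_le_rpow ?_ hr0.le
          rw [Real.enorm_eq_ofReal_abs]
          exact ENNReal.ofReal_le_ofReal (hb _ _)
      _ = _ := by simp
  have hcost' : powMean r (π.map Prod.swap) (fun z => ‖a z.1 - a z.2‖ₑ) ≤
      ENNReal.ofReal (2 * A * δ ^ (1 / r)) := by
    rw [powMean_map measurable_swap hℓm]
    refine le_trans (le_of_eq (powMean_congr_ae (ae_of_all _ fun z => ?_))) hcost
    rw [Prod.fst_swap, Prod.snd_swap, ← enorm_neg, neg_sub]
  have hrhs : 0 ≤ 2 * A * δ ^ (1 / r) := by positivity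
  have hbound : ∀ z : J × J, a z.1 ≤ a z.2 + (‖a z.1 - a z.2‖ₑ).toReal := fun z => by
    rw [toReal_enorm, Real.norm_eq_abs]; linarith [le_abs_self (a z.1 - a z.2)]
  have g1 := riskFunctional_le_add hr hq hS hc (hmemLp m) (hmemLp m') hℓm.aemeasurable
    (ne_top_of_le_ne_top ENNReal.ofReal_ne_top hcost) (ae_of_all _ hbound)
  have g2 := riskFunctional_le_add hr hq hS hc.swap (hmemLp m') (hmemLp m) hℓm.aemeasurable
    (ne_top_of_le_ne_top ENNReal.ofReal_ne_top hcost') (ae_of_all _ hbound)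
  have c1 := mul_le_mul_of_nonneg_left (ENNReal.toReal_le_of_le_ofReal hrhs hcost) k.2
  have c2 := mul_le_mul_of_nonneg_left (ENNReal.toReal_le_of_le_ofReal hrhs hcost') k.2
  simp only [NNReal.val_eq_coe] at c1 c2
  rw [abs_le]
  constructor <;> linarith

/-- The measure with given masses on a finite set. -/
def massMeasure {J : Type*} [Fintype J] [MeasurableSpace J] (p : J → ℝ) : Measure J :=
  ∑ j, ENNReal.ofReal (p j) • Measure.dirac j

theorem isProbabilityMeasure_massMeasure {J : Type*} [Fintype J] [MeasurableSpace J]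
    {p : J → ℝ} (hp : p ∈ stdSimplex ℝ J) : IsProbabilityMeasure (massMeasure p) := by
  refine ⟨?_⟩
  simp only [massMeasure, Measure.coe_finsetSum, Finset.sum_apply, Measure.smul_apply,
    measure_univ, smul_eq_mul, mul_one]
  rw [← ENNReal.ofReal_sum_of_nonneg fun j _ => hp.1 j, hp.2, ENNReal.ofReal_one]

theorem massMeasure_add {J : Type*} [Fintype J] [MeasurableSpace J] {p s : J → ℝ} {b c : ℝ}
    (hb : 0 ≤ b) (hc : 0 ≤ c) (hp : ∀ j, 0 ≤ p j) (hs : ∀ j, 0 ≤ s j) :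
    massMeasure (fun j => b * p j + c * s j) =
      ENNReal.ofReal b • massMeasure p + ENNReal.ofReal c • massMeasure s := by
  simp only [massMeasure, Finset.smul_sum, ← Finset.sum_add_distrib, smul_smul, ← add_smul]
  refine Finset.sum_congr rfl fun j _ => ?_
  rw [ENNReal.ofReal_add (mul_nonneg hb (hp j)) (mul_nonneg hc (hs j)), ENNReal.ofReal_mul hb,
    ENNReal.ofReal_mul hc]

/-- Every `p'` of the simplex close to `p` dominates `(1 - δ) p`, hence is a mixture of `p` with
weight `1 - δ` and of another probability vector, and the mixture estimate applies. -/
theorem continuousOn_riskFunctional_massMeasure {J : Type*} [Fintype J] [Nonempty J]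
    [MeasurableSpace J] [MeasurableSingletonClass J]
    (hr : 1 ≤ r) (hq : (ENNReal.ofReal r)⁻¹ + q⁻¹ = 1)
    (hS : IsBoundedFamily q S k) (a : J → ℝ) :
    ContinuousOn (fun p : J → ℝ => riskFunctional S (massMeasure p) a) (stdSimplex ℝ J) := by
  have hr0 : 0 < r := by linarith
  have ha : Measurable a := measurable_of_countable a
  obtain ⟨A, hA⟩ : ∃ A, ∀ j, |a j| ≤ A :=
    ⟨∑ j, |a j|, fun j => Finset.single_le_sum (f := fun j => |a j|)
      (fun _ _ => abs_nonneg _) (Finset.mem_univ j)⟩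
  intro p hp
  rw [ContinuousWithinAt, Metric.tendsto_nhds]
  intro ε hε
  have hlim : Tendsto (fun δ : ℝ => k * (2 * A * δ ^ (1 / r))) (𝓝[>] 0) (𝓝 0) := by
    have h : ContinuousAt (fun δ : ℝ => k * (2 * A * δ ^ (1 / r))) 0 :=
      ((continuousAt_id.rpow_const (Or.inr (by positivity))).const_mul _).const_mul _
    have h2 := h.tendsto
    rw [Real.zero_rpow (by positivity), mul_zero, mul_zero] at h2
    exact h2.mono_left nhdsWithin_le_nhds
  obtain ⟨δ, hδε, hδ0, hδ1⟩ := ((hlim.eventually (gt_mem_nhds hε)).and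
    (Ioo_mem_nhdsGT (zero_lt_one' ℝ))).exists
  have hev : ∀ᶠ p' in 𝓝[stdSimplex ℝ J] p, ∀ j, (1 - δ) * p j ≤ p' j := by
    rw [eventually_all]
    intro j
    -- At a coordinate where `p` vanishes, nonnegativity of `p'` suffices; elsewhere the inequality
    -- is strict at `p` and persists nearby.
    rcases (hp.1 j).eq_or_lt with h0 | h0
    · filter_upwards [self_mem_nhdsWithin] with p' hp'
      rw [← h0, mul_zero]; exact hp'.1 j
    · have : ∀ᶠ p' : J → ℝ in 𝓝 p, (1 - δ) * p j < p' j :=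
        (continuous_apply j).continuousAt.eventually (lt_mem_nhds (by nlinarith))
      filter_upwards [nhdsWithin_le_nhds this] with p' hp' using hp'.le
  filter_upwards [hev, self_mem_nhdsWithin] with p' h1 hp'
  set s : J → ℝ := fun j => (p' j - (1 - δ) * p j) / δ with hs
  have hsS : s ∈ stdSimplex ℝ J := by
    refine ⟨fun j => div_nonneg (sub_nonneg.2 (h1 j)) hδ0.le, ?_⟩
    rw [hs, ← Finset.sum_div, Finset.sum_sub_distrib, ← Finset.mul_sum, hp'.2, hp.2]
    field_simp
    ring
  have := isProbabilityMeasure_massMeasure hp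
  have := isProbabilityMeasure_massMeasure hp'
  have := isProbabilityMeasure_massMeasure hsS
  have e : massMeasure p' = ENNReal.ofReal (1 - δ) • massMeasure p +
      ENNReal.ofReal δ • massMeasure s := by
    rw [← massMeasure_add (by linarith) hδ0.le hp.1 hsS.1]
    congr 1
    funext j
    simp only [hs]
    field_simp
    ring
  rw [Real.dist_eq]
  exact (abs_riskFunctional_sub_mixture_le hr hq hS _ _ hδ0.le hδ1.le e ha hA).trans_lt hδε

/-- By law invariance the risk is a function of the probabilities of the finitely many values; these
are measurable in `x` and the function is continuous. -/
theorem measurable_riskFunctional_finite {X U J : Type*} [MeasurableSpace X] [MeasurableSpace U]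
    [StandardBorelSpace U] [Nonempty U] [Fintype J] [Nonempty J]
    [MeasurableSpace J] [MeasurableSingletonClass J]
    (hr : 1 ≤ r) (hq : (ENNReal.ofReal r)⁻¹ + q⁻¹ = 1)
    (hS : IsBoundedFamily q S k) (κ : Kernel X U) [IsMarkovKernel κ] {g : X × U → J}
    (hg : Measurable g) (a : J → ℝ) :
    Measurable fun x => riskFunctional S (κ x) (fun u => a (g (x, u))) := by
  have hgx : ∀ x, Measurable fun u => g (x, u) := fun x => hg.comp measurable_prodMk_left
  have ha : Measurable a := measurable_of_countable a
  obtain ⟨A, hA⟩ : ∃ A, ∀ j, |a j| ≤ A :=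
    ⟨∑ j, |a j|, fun j => Finset.single_le_sum (f := fun j => |a j|)
      (fun _ _ => abs_nonneg _) (Finset.mem_univ j)⟩
  set p : X → J → ℝ := fun x j => ((κ x) {u | g (x, u) = j}).toReal with hp
  have hset : ∀ x j, MeasurableSet {u | g (x, u) = j} := fun x j =>
    hgx x (measurableSet_singleton j)
  have hmap : ∀ x, (κ x).map (fun u => g (x, u)) = massMeasure (p x) := by
    intro x
    have h := Measure.sum_smul_dirac ((κ x).map (fun u => g (x, u)))
    rw [← h, Measure.sum_fintype, massMeasure]
    refine Finset.sum_congr rfl fun j _ => ?_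
    rw [Measure.map_apply (hgx x) (measurableSet_singleton j), hp]
    simp only
    rw [ENNReal.ofReal_toReal (measure_ne_top _ _)]
    rfl
  have hpS : ∀ x, p x ∈ stdSimplex ℝ J := by
    intro x
    refine ⟨fun j => ENNReal.toReal_nonneg, ?_⟩
    have h1 : massMeasure (p x) univ = 1 := by
      rw [← hmap x, Measure.map_apply (hgx x) MeasurableSet.univ, preimage_univ, measure_univ]
    simp only [massMeasure, Measure.coe_finsetSum, Finset.sum_apply, Measure.smul_apply,
      measure_univ, smul_eq_mul, mul_one] at h1
    rw [← ENNReal.ofReal_sum_of_nonneg fun j _ => ENNReal.toReal_nonneg] at h1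
    exact ENNReal.ofReal_eq_one.1 h1
  have hpm : Measurable p := by
    refine measurable_pi_lambda _ fun j => Measurable.ennreal_toReal ?_
    exact Kernel.measurable_kernel_prodMk_left (hg (measurableSet_singleton j))
  have hcont := (continuousOn_riskFunctional_massMeasure hr hq hS a)
  have hm : Measurable fun x => (⟨p x, hpS x⟩ : stdSimplex ℝ J) := hpm.subtype_mk
  have e : (fun x => riskFunctional S (κ x) (fun u => a (g (x, u)))) =
      (fun p : stdSimplex ℝ J => riskFunctional S (massMeasure p.1) a) ∘
        fun x => (⟨p x, hpS x⟩ : stdSimplex ℝ J) := by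
    funext x
    rw [Function.comp_apply, ← hmap x]
    exact (riskFunctional_map hr hq hS (hgx x) ha (MemLp.of_bound
      (ha.comp (hgx x)).aestronglyMeasurable A (ae_of_all _ fun u => hA _))).symm
  rw [e]
  exact (continuousOn_iff_continuous_domRestrict.1 hcont).measurable.comp hm

/-- By subadditivity and Hölder's inequality, the risk is Lipschitz with constant `k` for the `L^r`
norm. -/
theorem tendsto_riskFunctional {Ω : Type*} [MeasurableSpace Ω] {μ : Measure Ω}
    [StandardBorelSpace Ω] [Nonempty Ω] [IsProbabilityMeasure μ]
    (hr : 1 ≤ r) (hq : (ENNReal.ofReal r)⁻¹ + q⁻¹ = 1) (hS : IsBoundedFamily q S k)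
    {Y : Ω → ℝ} (hY : MemLp Y (ENNReal.ofReal r) μ) {Z : ℕ → Ω → ℝ}
    (hZ : ∀ n, MemLp (Z n) (ENNReal.ofReal r) μ)
    (hlim : Tendsto (fun n => powMean r μ fun ω => ‖Z n ω - Y ω‖ₑ) atTop (𝓝 0)) :
    Tendsto (fun n => riskFunctional S μ (Z n)) atTop (𝓝 (riskFunctional S μ Y)) := by
  have hbound : ∀ {V W : Ω → ℝ}, MemLp V (ENNReal.ofReal r) μ → MemLp W (ENNReal.ofReal r) μ →
      riskFunctional S μ V ≤ riskFunctional S μ W +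
        k * (powMean r μ fun ω => ‖V ω - W ω‖ₑ).toReal := by
    intro V W hV hW
    refine riskFunctional_le hS fun ζ hζ => ?_
    have h1 := hζ.integrable_mul hr hq hS (hV.sub hW)
    have h2 := hζ.integrable_mul hr hq hS hW
    have e : ∫ ω, V ω * ζ ω ∂μ = (∫ ω, W ω * ζ ω ∂μ) + ∫ ω, (V - W) ω * ζ ω ∂μ := by
      rw [← integral_add h2.1 h1.1]
      refine integral_congr_ae (ae_of_all _ fun ω => ?_)
      simp only [Pi.sub_apply]
      ring
    rw [e]
    exact add_le_add (integral_mul_le_riskFunctional hr hq hS hζ hW)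
      ((le_abs_self _).trans h1.2)
  rw [tendsto_iff_dist_tendsto_zero]
  have h0 : Tendsto (fun n => k * (powMean r μ fun ω => ‖Z n ω - Y ω‖ₑ).toReal) atTop (𝓝 0) := by
    have := ((ENNReal.tendsto_toReal ENNReal.zero_ne_top).comp hlim).const_mul (k : ℝ)
    simpa using this
  refine squeeze_zero (fun _ => dist_nonneg) (fun n => ?_) h0
  have e : (powMean r μ fun ω => ‖Y ω - Z n ω‖ₑ) = powMean r μ fun ω => ‖Z n ω - Y ω‖ₑ :=
    powMean_congr_ae (ae_of_all _ fun ω => by rw [← enorm_neg, neg_sub])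
  have g1 := hbound (hZ n) hY
  have g2 := hbound hY (hZ n)
  rw [e] at g2
  rw [Real.dist_eq, abs_le]
  constructor <;> linarith

/-- The conditional risk of a random variable is a measurable function of the condition, wherever
the random variable has a finite conditional norm. -/
theorem exists_measurable_riskFunctional {X U : Type*} [MeasurableSpace X] [MeasurableSpace U]
    [StandardBorelSpace U] [Nonempty U]
    (hr : 1 ≤ r) (hq : (ENNReal.ofReal r)⁻¹ + q⁻¹ = 1)
    (hS : IsBoundedFamily q S k) (κ : Kernel X U) [IsMarkovKernel κ] {f : X × U → ℝ}
    (hf : Measurable f) :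
    ∃ F : X → ℝ, Measurable F ∧ ∀ x, powMean r (κ x) (fun u => ‖f (x, u)‖ₑ) ≠ ∞ →
      F x = riskFunctional S (κ x) (fun u => f (x, u)) := by
  have hr0 : 0 < r := by linarith
  set G : Set X := {x | powMean r (κ x) (fun u => ‖f (x, u)‖ₑ) ≠ ∞} with hG
  have hGm : MeasurableSet G := by
    have hm : Measurable fun x => powMean r (κ x) (fun u => ‖f (x, u)‖ₑ) := by
      have h : Measurable fun z : X × U => ‖f z‖ₑ ^ r := hf.enorm.pow_const r
      exact (h.lintegral_kernel_prod_right' (κ := κ)).pow_const _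
    exact (measurableSet_eq_fun hm measurable_const).compl
  -- Approximating the identity of the real line, rather than `f`, gives finitely many values
  -- uniformly in the condition, and an error at most `|f|`, so convergence in `L^r` is dominated.
  set T : ℕ → SimpleFunc ℝ ℝ := fun n =>
    SimpleFunc.approxOn id measurable_id univ 0 (mem_univ _) n with hT
  have hTlim : ∀ w, Tendsto (fun n => T n w) atTop (𝓝 w) := fun w =>
    SimpleFunc.tendsto_approxOn measurable_id (mem_univ _) (by simp)
  have hTle : ∀ n w, ‖T n w - w‖ₑ ≤ ‖w‖ₑ := fun n w => by
    have := SimpleFunc.edist_approxOn_le measurable_id (mem_univ (0 : ℝ)) w n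
    simpa [edist_eq_enorm_sub] using this
  set F : ℕ → X → ℝ := fun n x => riskFunctional S (κ x) (fun u => T n (f (x, u))) with hF
  have hFm : ∀ n, Measurable (F n) := by
    intro n
    have : Nonempty (T n).range := ⟨⟨T n 0, (T n).mem_range_self 0⟩⟩
    exact measurable_riskFunctional_finite hr hq hS κ (J := (T n).range)
      (g := fun z => ⟨T n (f z), (T n).mem_range_self _⟩)
      (((T n).measurable.comp hf).subtype_mk) (fun j => j.1)
  refine ⟨G.indicator fun x => riskFunctional S (κ x) (fun u => f (x, u)), ?_,
    fun x hx => indicator_of_mem (show x ∈ G from hx) _⟩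
  -- The approximate risks are known to converge only where the conditional norm is finite; the
  -- indicator of this measurable set makes the limit hold everywhere.
  refine measurable_of_tendsto_metrizable (fun n => (hFm n).indicator hGm)
    (tendsto_pi_nhds.2 fun x => ?_)
  by_cases hx : x ∈ G
  · simp only [indicator_of_mem hx]
    have hfx : Measurable fun u => f (x, u) := hf.comp measurable_prodMk_left
    have hTm : ∀ n, Measurable fun u => T n (f (x, u)) := fun n => (T n).measurable.comp hfx
    have hY : MemLp (fun u => f (x, u)) (ENNReal.ofReal r) (κ x) :=
      (memLp_iff_powMean hr hfx.aestronglyMeasurable).2 hx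
    have hD : ∀ n, MemLp (fun u => T n (f (x, u)) - f (x, u)) (ENNReal.ofReal r) (κ x) := fun n =>
      (memLp_iff_powMean hr ((hTm n).sub hfx).aestronglyMeasurable).2
        (ne_top_of_le_ne_top hx (powMean_mono_ae hr (ae_of_all _ fun u => hTle n _)))
    refine tendsto_riskFunctional hr hq hS hY (fun n => ?_) ?_
    · have := (hD n).add hY
      refine this.ae_eq (ae_of_all _ fun u => ?_)
      simp
    · have h1 : Tendsto (fun n => ∫⁻ u, ‖T n (f (x, u)) - f (x, u)‖ₑ ^ r ∂κ x) atTop (𝓝 0) := by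
        have := tendsto_lintegral_of_dominated_convergence (μ := κ x)
          (F := fun n u => ‖T n (f (x, u)) - f (x, u)‖ₑ ^ r) (f := fun _ => 0)
          (fun u => ‖f (x, u)‖ₑ ^ r)
          (fun n => ((hTm n).sub hfx).enorm.pow_const r)
          (fun n => ae_of_all _ fun u => ENNReal.rpow_le_rpow (hTle n _) hr0.le)
          (by rw [← powMean_rpow hr]; exact ENNReal.rpow_ne_top_of_nonneg hr0.le hx)
          (ae_of_all _ fun u => ?_)
        · simpa using this
        · have h2 : Tendsto (fun n => ‖T n (f (x, u)) - f (x, u)‖ₑ) atTop (𝓝 0) := by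
            have h3 := ((hTlim (f (x, u))).sub_const (f (x, u))).enorm
            simpa using h3
          have h4 := (ENNReal.continuous_rpow_const (y := r)).continuousAt.tendsto.comp h2
          rw [ENNReal.zero_rpow_of_pos hr0] at h4
          exact h4
      have h5 := (ENNReal.continuous_rpow_const (y := 1 / r)).continuousAt.tendsto.comp h1
      rw [ENNReal.zero_rpow_of_pos (by positivity)] at h5
      exact h5
  · simp only [indicator_of_notMem hx]
    exact tendsto_const_nhds

end Measurability

/-! ### Completing a partial transport plan between finite partitions -/

section Plan

variable {I J : Type*} [Fintype I] [Fintype J]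

/-- The density with respect to the product measure of the transport plan which moves the mass
`M i j` from the cell `i` to the cell `j` and completes with the product of the residuals. -/
def planDensity (p : I → ℝ≥0∞) (q : J → ℝ≥0∞) (M : I → J → ℝ≥0∞) (i : I) (j : J) : ℝ≥0∞ :=
  M i j / (p i * q j) +
    (1 - (∑ j', M i j') / p i) * (1 - (∑ i', M i' j) / q j) / (1 - ∑ i', ∑ j', M i' j')

/-- Reduces every statement about columns to the one about rows. -/
theorem planDensity_swap (p : I → ℝ≥0∞) (q : J → ℝ≥0∞) (M : I → J → ℝ≥0∞) (i : I) (j : J) :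
    planDensity q p (fun j i => M i j) j i = planDensity p q M i j := by
  rw [planDensity, planDensity, mul_comm (q j), Finset.sum_comm, mul_comm (1 - _ / q j)]

/-- A plan may move less than all the mass. This slack makes it possible to round the masses down to
rational numbers. -/
structure IsPartialPlan (p : I → ℝ≥0∞) (q : J → ℝ≥0∞) (M : I → J → ℝ≥0∞) : Prop where
  row_le : ∀ i, ∑ j, M i j ≤ p i
  col_le : ∀ j, ∑ i, M i j ≤ q j

variable {p : I → ℝ≥0∞} {q : J → ℝ≥0∞} {M : I → J → ℝ≥0∞}

theorem IsPartialPlan.swap (h : IsPartialPlan p q M) : IsPartialPlan q p (fun j i => M i j) :=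
  ⟨h.col_le, h.row_le⟩

theorem IsPartialPlan.total_le (h : IsPartialPlan p q M) (hp : ∑ i, p i = 1) :
    ∑ i, ∑ j, M i j ≤ 1 := hp ▸ Finset.sum_le_sum fun i _ => h.row_le i

theorem IsPartialPlan.sum_residual_col (h : IsPartialPlan p q M) (hp : ∑ i, p i = 1)
    (hq : ∑ j, q j = 1) :
    ∑ j, q j * (1 - (∑ i, M i j) / q j) = 1 - ∑ i, ∑ j, M i j := by
  have hqt : ∀ j, q j ≠ ∞ := fun j => ne_top_of_le_ne_top ENNReal.one_ne_top
    (hq ▸ Finset.single_le_sum (f := q) (fun _ _ => zero_le) (Finset.mem_univ j))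
  have h1 : ∀ j, q j * (1 - (∑ i, M i j) / q j) = q j - ∑ i, M i j := by
    intro j
    rw [ENNReal.mul_sub (fun _ _ => hqt j), mul_one]
    -- In an empty cell the quotient has no meaning, but both sides vanish.
    rcases eq_or_ne (q j) 0 with h0 | h0
    · simp [h0]
    · rw [ENNReal.mul_div_cancel h0 (hqt j)]
  simp only [h1]
  have h2 : ∑ j, (q j - ∑ i, M i j) + ∑ j, ∑ i, M i j = 1 := by
    rw [← Finset.sum_add_distrib, ← hq]
    exact Finset.sum_congr rfl fun j _ => tsub_add_cancel_of_le (h.col_le j)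
  rw [Finset.sum_comm] at h2
  have ht : ∑ i, ∑ j, M i j ≠ ∞ := ne_top_of_le_ne_top ENNReal.one_ne_top (h.total_le hp)
  rw [← h2, ENNReal.add_sub_cancel_right ht]

/-- Rows bounded by `p` whose total is that of `p` cannot have a deficit. This covers the degenerate
case in which the residual has mass zero and cannot be normalized. -/
theorem IsPartialPlan.row_eq_of_total (h : IsPartialPlan p q M) (hp : ∑ i, p i = 1)
    (ht : ∑ i, ∑ j, M i j = 1) (i : I) : ∑ j, M i j = p i := by
  have hlt : ∀ i, p i ≠ ∞ := fun i => ne_top_of_le_ne_top ENNReal.one_ne_top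
    (hp ▸ Finset.single_le_sum (f := p) (fun _ _ => zero_le) (Finset.mem_univ i))
  by_contra hne
  classical
  have hl : ∑ i, ∑ j, M i j < ∑ i, p i := by
    have e1 := Finset.add_sum_erase Finset.univ (fun i => ∑ j, M i j) (Finset.mem_univ i)
    have e2 := Finset.add_sum_erase Finset.univ p (Finset.mem_univ i)
    rw [← e1, ← e2]
    refine ENNReal.add_lt_add_of_lt_of_le ?_ (lt_of_le_of_ne (h.row_le i) hne)
      (Finset.sum_le_sum fun i _ => h.row_le i)
    refine ne_top_of_le_ne_top ENNReal.one_ne_top ?_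
    rw [← ht]
    exact Finset.sum_le_sum_of_subset (Finset.erase_subset _ _)
  rw [ht, hp] at hl
  exact lt_irrefl _ hl

/-- The moved part contributes the moved fraction of the cell `i`, the normalized product of
residuals contributes the remaining fraction. Empty cells `j` do no harm, since no mass can be sent
to them. -/
theorem IsPartialPlan.sum_planDensity (h : IsPartialPlan p q M) (hp : ∑ i, p i = 1)
    (hq : ∑ j, q j = 1) {i : I} (hi : p i ≠ 0) : ∑ j, q j * planDensity p q M i j = 1 := by
  have hqt : ∀ j, q j ≠ ∞ := fun j => ne_top_of_le_ne_top ENNReal.one_ne_top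
    (hq ▸ Finset.single_le_sum (f := q) (fun _ _ => zero_le) (Finset.mem_univ j))
  have hpt : p i ≠ ∞ := ne_top_of_le_ne_top ENNReal.one_ne_top
    (hp ▸ Finset.single_le_sum (f := p) (fun _ _ => zero_le) (Finset.mem_univ i))
  have h1 : ∀ j, q j * (M i j / (p i * q j)) = M i j / p i := by
    intro j
    rcases eq_or_ne (q j) 0 with h0 | h0
    · have : M i j = 0 := by
        have := (Finset.single_le_sum (f := fun i => M i j) (fun _ _ => zero_le)
          (Finset.mem_univ i)).trans (h.col_le j)
        rw [h0] at this
        exact le_zero_iff.1 this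
      simp [h0, this]
    · rw [mul_comm (p i), ← ENNReal.mul_div_mul_left (M i j) (p i) h0 (hqt j), mul_div_assoc]
  have hw : (∑ j, M i j) / p i ≤ 1 := ENNReal.div_le_of_le_mul (by rw [one_mul]; exact h.row_le i)
  simp only [planDensity, mul_add, Finset.sum_add_distrib, h1]
  have h2 : ∑ j, q j * ((1 - (∑ j', M i j') / p i) * (1 - (∑ i', M i' j) / q j) /
      (1 - ∑ i', ∑ j', M i' j')) = 1 - (∑ j', M i j') / p i := by
    have e : ∀ j, q j * ((1 - (∑ j', M i j') / p i) * (1 - (∑ i', M i' j) / q j) /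
      (1 - ∑ i', ∑ j', M i' j')) = ((1 - (∑ j', M i j') / p i) / (1 - ∑ i', ∑ j', M i' j')) *
      (q j * (1 - (∑ i', M i' j) / q j)) := fun j => by
      simp only [div_eq_mul_inv]; ring
    simp only [e]
    rw [← Finset.mul_sum, h.sum_residual_col hp hq]
    -- When everything is moved, the normalizing factor is zero, but so is the residual fraction of
    -- the row.
    rcases eq_or_ne (∑ i', ∑ j', M i' j') 1 with ht | ht
    · rw [h.row_eq_of_total hp ht i, ENNReal.div_self hi hpt]
      simp
    · have h3 : 1 - ∑ i', ∑ j', M i' j' ≠ 0 := by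
        rw [Ne, tsub_eq_zero_iff_le, not_le]
        exact lt_of_le_of_ne (h.total_le hp) ht
      exact ENNReal.div_mul_cancel h3 (ne_top_of_le_ne_top ENNReal.one_ne_top tsub_le_self)
  rw [h2]
  simp only [div_eq_mul_inv] at hw ⊢
  rw [← Finset.sum_mul]
  exact add_tsub_cancel_of_le hw

end Plan

/-! ### Transport plans on the product space induced by plans between cells. -/

section PlanMeasure

variable {U V I J : Type*} [MeasurableSpace U] [MeasurableSpace V] [Fintype I] [Fintype J]
  [MeasurableSpace I] [MeasurableSpace J] [MeasurableSingletonClass I]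
  [MeasurableSingletonClass J]

theorem lintegral_comp_finite (μ : Measure U) {a : U → I} (ha : Measurable a) (g : I → ℝ≥0∞) :
    ∫⁻ u, g (a u) ∂μ = ∑ i, μ (a ⁻¹' {i}) * g i := by
  rw [← lintegral_map (measurable_of_countable g) ha, lintegral_fintype]
  refine Finset.sum_congr rfl fun i _ => ?_
  rw [Measure.map_apply ha (measurableSet_singleton i), mul_comm]

theorem sum_measure_preimage (μ : Measure U) [IsProbabilityMeasure μ] {a : U → I}
    (ha : Measurable a) : ∑ i, μ (a ⁻¹' {i}) = 1 := by
  have := lintegral_comp_finite μ ha (fun _ => 1)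
  simpa using this.symm

theorem ae_measure_preimage_ne_zero (μ : Measure U) {a : U → I} (ha : Measurable a) :
    ∀ᵐ u ∂μ, μ (a ⁻¹' {a u}) ≠ 0 := by
  have : ∫⁻ u, ((fun i => if μ (a ⁻¹' {i}) = 0 then (1 : ℝ≥0∞) else 0) ∘ a) u ∂μ = 0 := by
    simp only [Function.comp_apply]
    rw [lintegral_comp_finite μ ha (fun i => if μ (a ⁻¹' {i}) = 0 then 1 else 0)]
    exact Finset.sum_eq_zero fun i _ => by split_ifs with h <;> simp [h]
  rw [lintegral_eq_zero_iff ((measurable_of_countable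
    (fun i => if μ (a ⁻¹' {i}) = 0 then (1 : ℝ≥0∞) else 0)).comp ha)] at this
  filter_upwards [this] with u hu h0
  simp [h0] at hu

variable {μ : Measure U} {ν : Measure V} [IsProbabilityMeasure μ] [IsProbabilityMeasure ν]
  {a : U → I} {b : V → J} {M : I → J → ℝ≥0∞}

/-- The transport plan on `U × V` induced by a partial plan between the cells. -/
def planMeasure (μ : Measure U) (ν : Measure V) (a : U → I) (b : V → J) (M : I → J → ℝ≥0∞) :
    Measure (U × V) :=
  (μ.prod ν).withDensity fun z =>
    planDensity (fun i => μ (a ⁻¹' {i})) (fun j => ν (b ⁻¹' {j})) M (a z.1) (b z.2)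

theorem measurable_planDensity_comp (ha : Measurable a) (hb : Measurable b) (p : I → ℝ≥0∞)
    (q : J → ℝ≥0∞) : Measurable fun z : U × V => planDensity p q M (a z.1) (b z.2) :=
  (measurable_of_countable fun t : I × J => planDensity p q M t.1 t.2).comp
    ((ha.comp measurable_fst).prodMk (hb.comp measurable_snd))

/-- Outside the null cells, the density integrates to one in either variable with the other one
fixed. -/
theorem isCoupling_planMeasure (ha : Measurable a) (hb : Measurable b)
    (h : IsPartialPlan (fun i => μ (a ⁻¹' {i})) (fun j => ν (b ⁻¹' {j})) M) :
    IsCoupling μ ν (planMeasure μ ν a b M) := by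
  have hm := measurable_planDensity_comp (M := M) ha hb (fun i => μ (a ⁻¹' {i}))
    (fun j => ν (b ⁻¹' {j}))
  have hp := sum_measure_preimage μ ha
  have hq := sum_measure_preimage ν hb
  constructor
  · ext s hs
    rw [Measure.map_apply measurable_fst hs, planMeasure,
      withDensity_apply _ (measurable_fst hs), ← lintegral_indicator (measurable_fst hs),
      lintegral_prod _ ((hm.indicator (measurable_fst hs)).aemeasurable)]
    have : ∀ᵐ u ∂μ, ∫⁻ v, (Prod.fst ⁻¹' s).indicator (fun z : U × V => planDensity
        (fun i => μ (a ⁻¹' {i})) (fun j => ν (b ⁻¹' {j})) M (a z.1) (b z.2)) (u, v) ∂ν =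
        s.indicator 1 u := by
      filter_upwards [ae_measure_preimage_ne_zero μ ha] with u hu
      by_cases hus : u ∈ s
      · have e : ∀ v, (Prod.fst ⁻¹' s).indicator (fun z : U × V => planDensity
          (fun i => μ (a ⁻¹' {i})) (fun j => ν (b ⁻¹' {j})) M (a z.1) (b z.2)) (u, v) =
          planDensity (fun i => μ (a ⁻¹' {i})) (fun j => ν (b ⁻¹' {j})) M (a u) (b v) :=
          fun v => indicator_of_mem (show (u, v) ∈ Prod.fst ⁻¹' s from hus) _
        simp only [e]
        rw [lintegral_comp_finite ν hb (fun j => planDensity (fun i => μ (a ⁻¹' {i}))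
          (fun j => ν (b ⁻¹' {j})) M (a u) j), h.sum_planDensity hp hq hu, indicator_of_mem hus]
        rfl
      · have e : ∀ v, (Prod.fst ⁻¹' s).indicator (fun z : U × V => planDensity
          (fun i => μ (a ⁻¹' {i})) (fun j => ν (b ⁻¹' {j})) M (a z.1) (b z.2)) (u, v) = 0 :=
          fun v => indicator_of_notMem (show (u, v) ∉ Prod.fst ⁻¹' s from hus) _
        simp only [e]
        rw [indicator_of_notMem hus, lintegral_zero]
    rw [lintegral_congr_ae this, lintegral_indicator_one hs]
  · ext s hs
    rw [Measure.map_apply measurable_snd hs, planMeasure,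
      withDensity_apply _ (measurable_snd hs), ← lintegral_indicator (measurable_snd hs),
      lintegral_prod_symm _ ((hm.indicator (measurable_snd hs)).aemeasurable)]
    have : ∀ᵐ v ∂ν, ∫⁻ u, (Prod.snd ⁻¹' s).indicator (fun z : U × V => planDensity
        (fun i => μ (a ⁻¹' {i})) (fun j => ν (b ⁻¹' {j})) M (a z.1) (b z.2)) (u, v) ∂μ =
        s.indicator 1 v := by
      filter_upwards [ae_measure_preimage_ne_zero ν hb] with v hv
      by_cases hvs : v ∈ s
      · have e : ∀ u, (Prod.snd ⁻¹' s).indicator (fun z : U × V => planDensity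
          (fun i => μ (a ⁻¹' {i})) (fun j => ν (b ⁻¹' {j})) M (a z.1) (b z.2)) (u, v) =
          planDensity (fun j => ν (b ⁻¹' {j})) (fun i => μ (a ⁻¹' {i})) (fun j i => M i j)
            (b v) (a u) := fun u => by
          rw [planDensity_swap]
          exact indicator_of_mem (show (u, v) ∈ Prod.snd ⁻¹' s from hvs) _
        simp only [e]
        rw [lintegral_comp_finite μ ha (fun i => planDensity (fun j => ν (b ⁻¹' {j}))
          (fun i => μ (a ⁻¹' {i})) (fun j i => M i j) (b v) i),
          h.swap.sum_planDensity hq hp hv, indicator_of_mem hvs]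
        rfl
      · have e : ∀ u, (Prod.snd ⁻¹' s).indicator (fun z : U × V => planDensity
          (fun i => μ (a ⁻¹' {i})) (fun j => ν (b ⁻¹' {j})) M (a z.1) (b z.2)) (u, v) = 0 :=
          fun u => indicator_of_notMem (show (u, v) ∉ Prod.snd ⁻¹' s from hvs) _
        simp only [e]
        rw [indicator_of_notMem hvs, lintegral_zero]
    rw [lintegral_congr_ae this, lintegral_indicator_one hs]

/-- The fraction of the mass of the cell which is not moved by the partial plan. -/
def planResidual (μ : Measure U) (a : U → I) (R : I → ℝ≥0∞) (u : U) : ℝ≥0∞ :=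
  1 - R (a u) / μ (a ⁻¹' {a u})

theorem measurable_planResidual (ha : Measurable a) (R : I → ℝ≥0∞) : Measurable (planResidual μ a R) :=
  (measurable_of_countable fun i => 1 - R i / μ (a ⁻¹' {i})).comp ha

/-- An upper bound for the cost of the completed plan. -/
def planCost (μ : Measure U) (ν : Measure V) (a : U → I) (b : V → J) (M C : I → J → ℝ≥0∞)
    (α : U → ℝ≥0∞) (β : V → ℝ≥0∞) : ℝ≥0∞ :=
  ∑ i, ∑ j, M i j * C i j + ∫⁻ u, planResidual μ a (fun i => ∑ j, M i j) u * α u ∂μ +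
    ∫⁻ v, planResidual ν b (fun j => ∑ i, M i j) v * β v ∂ν

/-- The two bounds for `D` serve the two parts of the density: the cell cost for the mass that is
moved, the separable bound for the product of the residuals. In the latter, either residual
integrates to `1 - t`, which the normalization cancels. -/
theorem lintegral_planMeasure_le (ha : Measurable a) (hb : Measurable b)
    (h : IsPartialPlan (fun i => μ (a ⁻¹' {i})) (fun j => ν (b ⁻¹' {j})) M)
    {D : U × V → ℝ≥0∞} (hD : Measurable D) {C : I → J → ℝ≥0∞}
    {α : U → ℝ≥0∞} {β : V → ℝ≥0∞} (hα : Measurable α) (hβ : Measurable β)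
    (h1 : ∀ z, D z ≤ C (a z.1) (b z.2)) (h2 : ∀ z, D z ≤ α z.1 + β z.2) :
    ∫⁻ z, D z ∂planMeasure μ ν a b M ≤ planCost μ ν a b M C α β := by
  set p : I → ℝ≥0∞ := fun i => μ (a ⁻¹' {i}) with hpdef
  set q : J → ℝ≥0∞ := fun j => ν (b ⁻¹' {j}) with hqdef
  have hp : ∑ i, p i = 1 := sum_measure_preimage μ ha
  have hq : ∑ j, q j = 1 := sum_measure_preimage ν hb
  set t := ∑ i, ∑ j, M i j with htdef
  have hm := measurable_planDensity_comp (M := M) ha hb p q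
  set ρ : U → ℝ≥0∞ := planResidual μ a (fun i => ∑ j, M i j) with hρ
  set ρ' : V → ℝ≥0∞ := planResidual ν b (fun j => ∑ i, M i j) with hρ'
  have hρm : Measurable ρ := measurable_planResidual ha _
  have hρm' : Measurable ρ' := measurable_planResidual hb _
  have hI' : ∫⁻ v, ρ' v ∂ν = 1 - t := by
    rw [← h.sum_residual_col hp hq]
    exact lintegral_comp_finite ν hb (fun j => 1 - (∑ i, M i j) / q j)
  have hI : ∫⁻ u, ρ u ∂μ = 1 - t := by
    have := h.swap.sum_residual_col hq hp
    rw [Finset.sum_comm] at this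
    rw [htdef, ← this]
    exact lintegral_comp_finite μ ha (fun i => 1 - (∑ j, M i j) / p i)
  -- An inequality only, because for `t = 1` the quotient is zero.
  have ht1 : (1 - t) / (1 - t) ≤ 1 := ENNReal.div_self_le_one
  have hle : ∀ z : U × V, planDensity p q M (a z.1) (b z.2) * D z ≤
      M (a z.1) (b z.2) / (p (a z.1) * q (b z.2)) * C (a z.1) (b z.2) +
      (ρ z.1 * α z.1 * (ρ' z.2 / (1 - t)) + ρ' z.2 * β z.2 * (ρ z.1 / (1 - t))) := by
    intro z
    rw [planDensity, add_mul]
    refine add_le_add (mul_le_mul_right (h1 z) _) ((mul_le_mul_right (h2 z) _).trans (le_of_eq ?_))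
    change ρ z.1 * ρ' z.2 / (1 - t) * _ = _
    simp only [div_eq_mul_inv]
    ring
  have hmC : Measurable fun z : U × V =>
      M (a z.1) (b z.2) / (p (a z.1) * q (b z.2)) * C (a z.1) (b z.2) :=
    (measurable_of_countable fun s : I × J => M s.1 s.2 / (p s.1 * q s.2) * C s.1 s.2).comp
      ((ha.comp measurable_fst).prodMk (hb.comp measurable_snd))
  rw [planMeasure, lintegral_withDensity_eq_lintegral_mul _ hm hD]
  refine (lintegral_mono hle).trans ?_
  rw [lintegral_add_left hmC, lintegral_add_left (by fun_prop), planCost, add_assoc]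
  refine add_le_add ?_ (add_le_add ?_ ?_)
  · rw [lintegral_prod _ hmC.aemeasurable]
    simp only
    have e : ∀ u, ∫⁻ v, M (a u) (b v) / (p (a u) * q (b v)) * C (a u) (b v) ∂ν =
        ∑ j, q j * (M (a u) j / (p (a u) * q j) * C (a u) j) := fun u =>
      lintegral_comp_finite ν hb (fun j => M (a u) j / (p (a u) * q j) * C (a u) j)
    simp only [e]
    rw [lintegral_comp_finite μ ha (fun i => ∑ j, q j * (M i j / (p i * q j) * C i j))]
    refine Finset.sum_le_sum fun i _ => ?_
    rw [Finset.mul_sum]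
    refine Finset.sum_le_sum fun j _ => ?_
    have e2 : μ (a ⁻¹' {i}) * (q j * (M i j / (p i * q j) * C i j)) =
        (p i * q j) * (M i j / (p i * q j)) * C i j := by simp only [hpdef]; ring
    rw [e2]
    exact mul_le_mul_left ENNReal.mul_div_le _
  · rw [lintegral_prod_mul (f := fun u => ρ u * α u) (g := fun v => ρ' v / (1 - t))
      (by fun_prop) (by fun_prop)]
    simp only [div_eq_mul_inv]
    rw [lintegral_mul_const _ hρm', hI', ← div_eq_mul_inv]
    exact mul_le_of_le_one_right' ht1
  · have e : ∀ z : U × V, ρ' z.2 * β z.2 * (ρ z.1 / (1 - t)) =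
        (ρ z.1 / (1 - t)) * (ρ' z.2 * β z.2) := fun z => mul_comm _ _
    simp only [e]
    rw [lintegral_prod_mul (f := fun u => ρ u / (1 - t)) (g := fun v => ρ' v * β v)
      (by fun_prop) (by fun_prop)]
    simp only [div_eq_mul_inv]
    rw [lintegral_mul_const _ hρm, hI, ← div_eq_mul_inv]
    exact mul_le_of_le_one_left' ht1

end PlanMeasure

/-! ### Infima of rectangle functions -/

section RectInf

theorem exists_nnrat_between {s t : ℝ≥0∞} (h : s < t) :
    ∃ q : ℚ≥0, s < ((q : ℝ≥0) : ℝ≥0∞) ∧ ((q : ℝ≥0) : ℝ≥0∞) < t := by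
  obtain ⟨q, hq0, hq1, hq2⟩ := ENNReal.lt_iff_exists_rat_btwn.1 h
  have e : ((q.toNNRat : ℚ≥0) : ℝ≥0) = Real.toNNReal q := by
    ext
    rw [Real.coe_toNNReal _ (by exact_mod_cast hq0)]
    have : ((q.toNNRat : ℚ) : ℝ) = (q : ℝ) := by rw [Rat.coe_toNNRat _ hq0]
    rw [← this]
    rfl
  exact ⟨q.toNNRat, by rw [e]; exact hq1, by rw [e]; exact hq2⟩

open Classical in
/-- The infimum of the values `c n` over the rectangles `A n × B n` containing the point. -/
def rectInf {ι X Y : Type*} (A : ι → Set X) (B : ι → Set Y) (c : ι → ℝ≥0∞) (x : X) (y : Y) :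
    ℝ≥0∞ :=
  ⨅ n, if x ∈ A n ∧ y ∈ B n then c n else ∞

theorem rectInf_le {ι X Y : Type*} {A : ι → Set X} {B : ι → Set Y} {c : ι → ℝ≥0∞} {x : X} {y : Y}
    {n : ι} (hx : x ∈ A n) (hy : y ∈ B n) : rectInf A B c x y ≤ c n :=
  (iInf_le _ n).trans (by rw [if_pos ⟨hx, hy⟩])

theorem le_rectInf {ι X Y : Type*} {A : ι → Set X} {B : ι → Set Y} {c : ι → ℝ≥0∞} {x : X} {y : Y}
    {s : ℝ≥0∞} (h : ∀ n, x ∈ A n → y ∈ B n → s ≤ c n) : s ≤ rectInf A B c x y := by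
  refine le_iInf fun n => ?_
  split_ifs with hn
  · exact h n hn.1 hn.2
  · exact le_top

theorem exists_of_rectInf_lt {ι X Y : Type*} {A : ι → Set X} {B : ι → Set Y} {c : ι → ℝ≥0∞}
    {x : X} {y : Y} {s : ℝ≥0∞} (h : rectInf A B c x y < s) :
    ∃ n, x ∈ A n ∧ y ∈ B n ∧ c n < s := by
  obtain ⟨n, hn⟩ := iInf_lt_iff.1 h
  split_ifs at hn with h1
  · exact ⟨n, h1.1, h1.2, hn⟩
  · exact absurd hn not_top_lt

/-- The functions of two variables which are infima of countably many functions constant on a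
measurable rectangle and infinite elsewhere. -/
def IsRectInf {X Y : Type*} [MeasurableSpace X] [MeasurableSpace Y] (D : X → Y → ℝ≥0∞) : Prop :=
  ∃ (A : ℕ → Set X) (B : ℕ → Set Y) (c : ℕ → ℝ≥0∞), (∀ n, MeasurableSet (A n)) ∧
    (∀ n, MeasurableSet (B n)) ∧ D = rectInf A B c

variable {X Y : Type*} [MeasurableSpace X] [MeasurableSpace Y]

theorem isRectInf_rectInf {ι : Type*} [Countable ι] {A : ι → Set X} {B : ι → Set Y}
    (c : ι → ℝ≥0∞) (hA : ∀ n, MeasurableSet (A n)) (hB : ∀ n, MeasurableSet (B n)) :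
    IsRectInf (rectInf A B c) := by
  -- The extra index carries an empty rectangle with value `∞`; it ensures a nonempty index type.
  obtain ⟨e, he⟩ := exists_surjective_nat (Option ι)
  have hA' : ∀ o : Option ι, MeasurableSet (o.elim ∅ A) := fun o => by
    cases o with
    | none => exact MeasurableSet.empty
    | some i => exact hA i
  have hB' : ∀ o : Option ι, MeasurableSet (o.elim ∅ B) := fun o => by
    cases o with
    | none => exact MeasurableSet.empty
    | some i => exact hB i
  refine ⟨fun n => (e n).elim ∅ A, fun n => (e n).elim ∅ B, fun n => (e n).elim ∞ c,
    fun n => hA' _, fun n => hB' _, ?_⟩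
  · funext x y
    apply le_antisymm
    · refine le_rectInf fun n hx hy => ?_
      cases hn : e n with
      | none => exact le_top
      | some i =>
        rw [hn] at hx hy
        exact rectInf_le hx hy
    · refine le_rectInf fun i hx hy => ?_
      obtain ⟨n, hn⟩ := he (some i)
      have : rectInf (fun n => (e n).elim ∅ A) (fun n => (e n).elim ∅ B)
          (fun n => (e n).elim ∞ c) x y ≤ (e n).elim ∞ c :=
        rectInf_le (by rw [hn]; exact hx) (by rw [hn]; exact hy)
      rwa [hn] at this

theorem measurable_rectInf {A : ℕ → Set X} {B : ℕ → Set Y} (c : ℕ → ℝ≥0∞)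
    (hA : ∀ n, MeasurableSet (A n)) (hB : ∀ n, MeasurableSet (B n)) :
    Measurable fun z : X × Y => rectInf A B c z.1 z.2 :=
  Measurable.iInf fun n => Measurable.ite
    ((measurable_fst (hA n)).inter (measurable_snd (hB n))) measurable_const measurable_const

theorem IsRectInf.measurable {D : X → Y → ℝ≥0∞} (h : IsRectInf D) :
    Measurable fun z : X × Y => D z.1 z.2 := by
  obtain ⟨A, B, c, hA, hB, rfl⟩ := h
  exact measurable_rectInf c hA hB

theorem IsRectInf.iInf {ι : Type*} [Countable ι] {D : ι → X → Y → ℝ≥0∞}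
    (h : ∀ i, IsRectInf (D i)) : IsRectInf fun x y => ⨅ i, D i x y := by
  choose A B c hA hB hD using h
  have e : (fun x y => ⨅ i, D i x y) = rectInf (fun s : ι × ℕ => A s.1 s.2)
      (fun s => B s.1 s.2) (fun s => c s.1 s.2) := by
    funext x y
    simp only [hD]
    simp only [rectInf]
    rw [iInf_prod]
  rw [e]
  exact isRectInf_rectInf _ (fun s => hA _ _) (fun s => hB _ _)

theorem IsRectInf.comp {X' Y' : Type*} [MeasurableSpace X'] [MeasurableSpace Y']
    {D : X → Y → ℝ≥0∞} (h : IsRectInf D) {f : X' → X} {g : Y' → Y} (hf : Measurable f)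
    (hg : Measurable g) : IsRectInf fun x y => D (f x) (g y) := by
  obtain ⟨A, B, c, hA, hB, rfl⟩ := h
  exact ⟨fun n => f ⁻¹' A n, fun n => g ⁻¹' B n, c, fun n => hf (hA n), fun n => hg (hB n), rfl⟩

open Classical in
theorem IsRectInf.restrict {D : X → Y → ℝ≥0∞} (h : IsRectInf D) {G : Set X} {H : Set Y}
    (hG : MeasurableSet G) (hH : MeasurableSet H) :
    IsRectInf fun x y => if x ∈ G ∧ y ∈ H then D x y else ∞ := by
  obtain ⟨A, B, c, hA, hB, rfl⟩ := h
  refine ⟨fun n => A n ∩ G, fun n => B n ∩ H, c, fun n => (hA n).inter hG,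
    fun n => (hB n).inter hH, ?_⟩
  funext x y
  by_cases hxy : x ∈ G ∧ y ∈ H
  · rw [if_pos hxy]
    simp [rectInf, hxy.1, hxy.2]
  · rw [if_neg hxy]
    refine (top_le_iff.1 (le_rectInf fun n hx hy => ?_)).symm
    exact absurd ⟨hx.2, hy.2⟩ hxy

/-- The sum is the infimum of `s + t` over the rational numbers with `f x < s` and `g y < t`, and
the set of points with these two properties is a rectangle. -/
theorem isRectInf_add {f : X → ℝ≥0∞} {g : Y → ℝ≥0∞} (hf : Measurable f) (hg : Measurable g) :
    IsRectInf fun x y => f x + g y := by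
  have e : (fun x y => f x + g y) = rectInf (fun s : ℚ≥0 × ℚ≥0 => {x | f x < ((s.1 : ℝ≥0) : ℝ≥0∞)})
      (fun s => {y | g y < ((s.2 : ℝ≥0) : ℝ≥0∞)})
      (fun s => ((s.1 : ℝ≥0) : ℝ≥0∞) + ((s.2 : ℝ≥0) : ℝ≥0∞)) := by
    funext x y
    apply le_antisymm
    · exact le_rectInf fun s hx hy => add_le_add (le_of_lt hx) (le_of_lt hy)
    · rcases eq_or_ne (f x) ∞ with h1 | h1
      · rw [h1, top_add]; exact le_top
      rcases eq_or_ne (g y) ∞ with h2 | h2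
      · rw [h2, add_top]; exact le_top
      have approx : ∀ t : ℝ≥0∞, t ≠ ∞ → ∀ ε : ℝ≥0, 0 < ε →
          ∃ s : ℚ≥0, t < ((s : ℝ≥0) : ℝ≥0∞) ∧ ((s : ℝ≥0) : ℝ≥0∞) ≤ t + ε := fun t ht ε hε => by
        obtain ⟨s, h1, h2⟩ := exists_nnrat_between
          (ENNReal.lt_add_right ht (ENNReal.coe_ne_zero.2 hε.ne'))
        exact ⟨s, h1, h2.le⟩
      refine ENNReal.le_of_forall_pos_le_add fun ε hε _ => ?_
      obtain ⟨s, hs1, hs2⟩ := approx _ h1 (ε / 2) (half_pos hε)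
      obtain ⟨t, ht1, ht2⟩ := approx _ h2 (ε / 2) (half_pos hε)
      refine (rectInf_le (n := (s, t)) hs1 ht1).trans ((add_le_add hs2 ht2).trans (le_of_eq ?_))
      rw [add_add_add_comm, ← ENNReal.coe_add, add_halves]
  rw [e]
  exact isRectInf_rectInf _ (fun s => measurableSet_lt hf measurable_const)
    (fun s => measurableSet_lt hg measurable_const)

/-- Each strict sublevel set is open, hence a union of products of basic open sets, of which there
are countably many; rational levels suffice. -/
theorem isRectInf_of_continuous [TopologicalSpace X] [TopologicalSpace Y]
    [SecondCountableTopology X] [SecondCountableTopology Y] [OpensMeasurableSpace X]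
    [OpensMeasurableSpace Y] {D : X → Y → ℝ≥0∞} (hD : Continuous fun z : X × Y => D z.1 z.2) :
    IsRectInf D := by
  set bX := TopologicalSpace.countableBasis X
  set bY := TopologicalSpace.countableBasis Y
  have hbX := TopologicalSpace.isBasis_countableBasis X
  have hbY := TopologicalSpace.isBasis_countableBasis Y
  let ι := {s : ℚ≥0 × bX × bY // ∀ x ∈ s.2.1.1, ∀ y ∈ s.2.2.1, D x y < ((s.1 : ℝ≥0) : ℝ≥0∞)}
  have : Countable bX := (TopologicalSpace.countable_countableBasis X).to_subtype
  have : Countable bY := (TopologicalSpace.countable_countableBasis Y).to_subtype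
  have e : D = rectInf (fun s : ι => s.1.2.1.1) (fun s => s.1.2.2.1)
      (fun s => ((s.1.1 : ℝ≥0) : ℝ≥0∞)) := by
    funext x y
    apply le_antisymm
    · exact le_rectInf fun s hx hy => (s.2 x hx y hy).le
    · refine le_of_forall_gt_imp_ge_of_dense fun t ht => ?_
      obtain ⟨q, hq1, hq2⟩ := exists_nnrat_between ht
      have ho : IsOpen {z : X × Y | D z.1 z.2 < ((q : ℝ≥0) : ℝ≥0∞)} :=
        isOpen_lt hD continuous_const
      obtain ⟨W, hW, hxy, hsub⟩ := (hbX.prod hbY).exists_subset_of_mem_open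
        (show (x, y) ∈ {z : X × Y | D z.1 z.2 < ((q : ℝ≥0) : ℝ≥0∞)} from hq1) ho
      obtain ⟨U, hU, V, hV, rfl⟩ := hW
      exact (rectInf_le (A := fun s : ι => s.1.2.1.1) (B := fun s => s.1.2.2.1)
        (c := fun s => ((s.1.1 : ℝ≥0) : ℝ≥0∞)) (x := x) (y := y)
        (n := ⟨(q, ⟨U, hU⟩, ⟨V, hV⟩), fun x hx y hy => hsub (show (x, y) ∈ _ from ⟨hx, hy⟩)⟩)
        hxy.1 hxy.2).trans hq2.le
  rw [e]
  exact isRectInf_rectInf _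
    (fun s => (TopologicalSpace.isOpen_of_mem_countableBasis s.1.2.1.2).measurableSet)
    (fun s => (TopologicalSpace.isOpen_of_mem_countableBasis s.1.2.2.2).measurableSet)

end RectInf

/-! ### Approximation of a coupling by plans between finite partitions -/

/-- Absolute continuity of the integral, with weights in place of sets: `f ≤ N + (f - N)`, the
second term having a small integral and the first being bounded. -/
theorem exists_pos_lintegral_mul_le {U : Type*} [MeasurableSpace U] {μ : Measure U}
    {f : U → ℝ≥0∞} (hf : Measurable f) (hfin : ∫⁻ u, f u ∂μ ≠ ∞) {ε : ℝ≥0∞} (hε : ε ≠ 0) :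
    ∃ δ : ℝ≥0∞, δ ≠ 0 ∧ ∀ w : U → ℝ≥0∞, Measurable w → (∀ u, w u ≤ 1) → ∫⁻ u, w u ∂μ ≤ δ →
      ∫⁻ u, w u * f u ∂μ ≤ ε := by
  have hlim : Filter.Tendsto (fun n : ℕ => ∫⁻ u, (f u - n) ∂μ) Filter.atTop (nhds 0) := by
    have := tendsto_lintegral_of_dominated_convergence (μ := μ) (F := fun (n : ℕ) u => f u - n)
      (f := fun _ => 0) f (fun n => hf.sub measurable_const)
      (fun n => ae_of_all _ fun u => tsub_le_self) hfin ?_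
    · simpa using this
    · filter_upwards [ae_lt_top hf hfin] with u hu
      obtain ⟨N, hN⟩ := ENNReal.exists_nat_gt hu.ne
      refine tendsto_const_nhds.congr' ?_
      filter_upwards [Filter.eventually_ge_atTop N] with n hn
      exact (tsub_eq_zero_of_le (hN.le.trans (by exact_mod_cast hn))).symm
  obtain ⟨N, hN⟩ := (hlim.eventually (gt_mem_nhds (ENNReal.half_pos hε))).exists
  -- The denominator `N + 1` rather than `N`, since `N` may be zero.
  refine ⟨ε / 2 / (N + 1), ENNReal.div_ne_zero.2 ⟨(ENNReal.half_pos hε).ne', by simp⟩, ?_⟩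
  intro w hw hw1 hwδ
  calc ∫⁻ u, w u * f u ∂μ ≤ ∫⁻ u, (w u * N + (f u - N)) ∂μ := by
        refine lintegral_mono fun u => ?_
        calc w u * f u ≤ w u * (N + (f u - N)) := mul_le_mul_right le_add_tsub _
          _ = w u * N + w u * (f u - N) := mul_add _ _ _
          _ ≤ _ := add_le_add le_rfl (mul_le_of_le_one_left' (hw1 u))
    _ = (∫⁻ u, w u ∂μ) * N + ∫⁻ u, (f u - N) ∂μ := by
        rw [lintegral_add_left (hw.mul_const _), lintegral_mul_const _ hw]
    _ ≤ ε / 2 / (N + 1) * (N + 1) + ε / 2 := by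
        refine add_le_add (mul_le_mul' hwδ le_self_add) hN.le
    _ ≤ ε := by
        rw [ENNReal.div_mul_cancel (by simp) (by simp), ENNReal.add_halves]

section Approximation

open Classical in
/-- The cell of the partition generated by the first `n` sets. -/
def cell {U : Type*} (A : ℕ → Set U) (n : ℕ) (u : U) : Fin n → Bool := fun i => decide (u ∈ A i)

theorem measurable_cell {U : Type*} [MeasurableSpace U] {A : ℕ → Set U}
    (hA : ∀ n, MeasurableSet (A n)) (n : ℕ) : Measurable (cell A n) := by
  refine measurable_pi_lambda _ fun i => ?_
  refine measurable_to_bool ?_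
  convert hA i using 1
  ext u
  simp [cell]

/-- The cost of moving from one cell to another. -/
def cellCost (c : ℕ → ℝ≥0∞) (n : ℕ) (k l : Fin n → Bool) : ℝ≥0∞ :=
  ⨅ i : Fin n, if k i = true ∧ l i = true then c i else ∞

theorem rectInf_le_cellCost {U V : Type*} {A : ℕ → Set U} {B : ℕ → Set V} {c : ℕ → ℝ≥0∞} {n : ℕ}
    (u : U) (v : V) : rectInf A B c u v ≤ cellCost c n (cell A n u) (cell B n v) := by
  refine le_iInf fun i => ?_
  split_ifs with h
  · simp only [cell, decide_eq_true_eq] at h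
    exact rectInf_le h.1 h.2
  · exact le_top

theorem cellCost_le {U V : Type*} {A : ℕ → Set U} {B : ℕ → Set V} {c : ℕ → ℝ≥0∞} {n : ℕ}
    {u : U} {v : V} {i : ℕ} (hi : i < n) (hu : u ∈ A i) (hv : v ∈ B i) :
    cellCost c n (cell A n u) (cell B n v) ≤ c i := by
  refine (iInf_le _ (⟨i, hi⟩ : Fin n)).trans ?_
  rw [if_pos]
  simp [cell, hu, hv]

theorem sum_measure_preimage' {U I : Type*} [MeasurableSpace U] [Fintype I] [MeasurableSpace I]
    [MeasurableSingletonClass I] (μ : Measure U) {a : U → I} (ha : Measurable a) :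
    ∑ i, μ (a ⁻¹' {i}) = μ univ := by
  have := lintegral_comp_finite μ ha (fun _ => 1)
  simpa using this.symm

theorem lintegral_planResidual {U I J : Type*} [MeasurableSpace U] [Fintype I] [Fintype J]
    [MeasurableSpace I] [MeasurableSingletonClass I] {μ : Measure U} [IsProbabilityMeasure μ]
    {a : U → I} (ha : Measurable a) {q : J → ℝ≥0∞} (hq : ∑ j, q j = 1) {M : I → J → ℝ≥0∞}
    (h : IsPartialPlan (fun i => μ (a ⁻¹' {i})) q M) :
    ∫⁻ u, planResidual μ a (fun i => ∑ j, M i j) u ∂μ = 1 - ∑ i, ∑ j, M i j := by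
  have := h.swap.sum_residual_col hq (sum_measure_preimage μ ha)
  rw [Finset.sum_comm] at this
  rw [← this]
  exact lintegral_comp_finite μ ha (fun i => 1 - (∑ j, M i j) / μ (a ⁻¹' {i}))

/-- A matrix of rational masses. -/
def ratMass {I J : Type*} (N : ℕ) (K : I → J → ℕ) (i : I) (j : J) : ℝ≥0∞ := (K i j : ℝ≥0∞) / (N + 1)

theorem exists_nat_div_approx (m : ℝ≥0∞) (hm : m ≠ ∞) (N : ℕ) :
    ∃ K : ℕ, (K : ℝ≥0∞) / (N + 1) ≤ m ∧ m ≤ (K : ℝ≥0∞) / (N + 1) + 1 / (N + 1) := by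
  lift m to ℝ≥0 using hm
  have hN : ((N : ℝ≥0∞) + 1) ≠ 0 := by simp
  have hN' : ((N : ℝ≥0∞) + 1) ≠ ∞ := by simp
  refine ⟨⌊m * (N + 1)⌋₊, ?_, ?_⟩
  · rw [ENNReal.div_le_iff hN hN']
    have := Nat.floor_le (zero_le (a := m * (N + 1)))
    exact_mod_cast this
  · rw [← ENNReal.add_div, ENNReal.le_div_iff_mul_le (Or.inl hN) (Or.inl hN')]
    have := (Nat.lt_floor_add_one (m * (N + 1))).le
    exact_mod_cast this

/-- Keep only the part of `π` on which one of the first `n` rectangles nearly attains the infimum,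
record the masses of pairs of cells, and round them down to rationals. The mass lost is small, and
the integrable bounds `α`, `β` make completing the plan cheap. -/
theorem exists_partialPlan_cost_le {U V : Type*} [MeasurableSpace U] [MeasurableSpace V]
    {μ : Measure U} {ν : Measure V} [IsProbabilityMeasure μ] [IsProbabilityMeasure ν]
    {π : Measure (U × V)} (hπ : IsCoupling μ ν π) {A : ℕ → Set U} {B : ℕ → Set V}
    (hA : ∀ n, MeasurableSet (A n)) (hB : ∀ n, MeasurableSet (B n)) (c : ℕ → ℝ≥0∞)
    {α : U → ℝ≥0∞} {β : V → ℝ≥0∞} (hα : Measurable α) (hβ : Measurable β)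
    (hαi : ∫⁻ u, α u ∂μ ≠ ∞) (hβi : ∫⁻ v, β v ∂ν ≠ ∞)
    (hfin : ∫⁻ z, rectInf A B c z.1 z.2 ∂π ≠ ∞) {ε : ℝ≥0∞} (hε : ε ≠ 0) :
    ∃ (n N : ℕ) (K : (Fin n → Bool) → (Fin n → Bool) → ℕ),
      IsPartialPlan (fun k => μ (cell A n ⁻¹' {k})) (fun l => ν (cell B n ⁻¹' {l}))
        (ratMass N K) ∧
      planCost μ ν (cell A n) (cell B n) (ratMass N K) (cellCost c n) α β ≤
        ∫⁻ z, rectInf A B c z.1 z.2 ∂π + ε := by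
  have := hπ.isProbabilityMeasure
  have hε3 : ε / 3 ≠ 0 := ENNReal.div_ne_zero.2 ⟨hε, by simp⟩
  set D : U × V → ℝ≥0∞ := fun z => rectInf A B c z.1 z.2 with hD
  have hDm : Measurable D := measurable_rectInf c hA hB
  obtain ⟨δ₁, hδ₁, hα'⟩ := exists_pos_lintegral_mul_le hα hαi hε3
  obtain ⟨δ₂, hδ₂, hβ'⟩ := exists_pos_lintegral_mul_le hβ hβi hε3
  -- The mass that may be lost; the cap at one only makes it finite.
  set η := min (min δ₁ δ₂) 1 with hη
  have hη0 : η ≠ 0 := by simp [hη, hδ₁, hδ₂]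
  have hηt : η ≠ ∞ := ne_top_of_le_ne_top ENNReal.one_ne_top (min_le_right _ _)
  -- On `H n` the cost computed from the first `n` rectangles exceeds `D` by at most `ε / 3`. These
  -- sets increase to a set of full measure, as `D` is almost surely finite.
  set H : ℕ → Set (U × V) := fun n =>
    ⋃ i ∈ Finset.range n, (A i ×ˢ B i) ∩ {z | c i ≤ D z + ε / 3} with hH
  have hHm : ∀ n, MeasurableSet (H n) := fun n =>
    Finset.measurableSet_biUnion _ fun i _ => ((hA i).prod (hB i)).inter
      (measurableSet_le measurable_const (hDm.add measurable_const))
  have hmono : Monotone H := fun m n hmn =>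
    biUnion_subset_biUnion_left (by simpa using hmn)
  have hfull : ∀ᵐ z ∂π, z ∈ ⋃ n, H n := by
    filter_upwards [ae_lt_top hDm hfin] with z hz
    obtain ⟨i, h1, h2, h3⟩ := exists_of_rectInf_lt (ENNReal.lt_add_right hz.ne hε3)
    refine mem_iUnion.2 ⟨i + 1, ?_⟩
    exact mem_biUnion (show i ∈ ((Finset.range (i + 1) : Finset ℕ) : Set ℕ) by simp)
      ⟨⟨h1, h2⟩, h3.le⟩
  have hlim : Filter.Tendsto (fun n => π (H n)) Filter.atTop (nhds 1) := by
    have h1 := tendsto_measure_iUnion_atTop (μ := π) hmono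
    have h2 : π (⋃ n, H n) = 1 := by
      rw [← prob_compl_eq_zero_iff (MeasurableSet.iUnion hHm)]
      exact hfull
    rwa [h2] at h1
  obtain ⟨n, hn⟩ : ∃ n, 1 ≤ π (H n) + η / 2 := by
    have h1 : (1 : ℝ≥0∞) - η / 2 < 1 :=
      ENNReal.sub_lt_self ENNReal.one_ne_top one_ne_zero (ENNReal.half_pos hη0).ne'
    obtain ⟨n, hn⟩ := (hlim.eventually (lt_mem_nhds h1)).exists
    exact ⟨n, tsub_le_iff_right.1 hn.le⟩
  set a := cell A n with ha_def
  set b := cell B n with hb_def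
  have ha : Measurable a := measurable_cell hA n
  have hb : Measurable b := measurable_cell hB n
  have ha1 : Measurable fun z : U × V => a z.1 := ha.comp measurable_fst
  have hb1 : Measurable fun z : U × V => b z.2 := hb.comp measurable_snd
  set g : U × V → (Fin n → Bool) × (Fin n → Bool) := fun z => (a z.1, b z.2) with hg_def
  have hg : Measurable g := ha1.prodMk hb1
  set πH := π.restrict (H n) with hπH
  set m : (Fin n → Bool) → (Fin n → Bool) → ℝ≥0∞ := fun k l => πH (g ⁻¹' {(k, l)}) with hm
  have hmt : ∀ k l, m k l ≠ ∞ := fun k l => measure_ne_top _ _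
  set Q : ℝ≥0∞ := (Fintype.card ((Fin n → Bool) × (Fin n → Bool)) : ℝ≥0∞) with hQ
  -- Half of the admissible loss goes to the restriction to `H n`, the other half to rounding, which
  -- costs at most `1 / (N + 1)` for each of the `Q` pairs of cells.
  obtain ⟨N, hN⟩ : ∃ N : ℕ, Q * (1 / (N + 1)) ≤ η / 2 := by
    have hη2 := (ENNReal.half_pos hη0).ne'
    have hη2t : η / 2 ≠ ∞ := ENNReal.div_ne_top hηt (by simp)
    obtain ⟨N, hN⟩ := ENNReal.exists_nat_gt (ENNReal.div_ne_top (ENNReal.natCast_ne_top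
      (Fintype.card ((Fin n → Bool) × (Fin n → Bool)))) hη2)
    refine ⟨N, ?_⟩
    rw [mul_one_div]
    refine ENNReal.div_le_of_le_mul' ?_
    exact ((ENNReal.div_le_iff hη2 hη2t).1 hN.le).trans (mul_le_mul_left le_self_add _)
  choose K hK1 hK2 using fun k l => exists_nat_div_approx (m k l) (hmt k l) N
  have hle : ∀ k l, ratMass N K k l ≤ m k l := hK1
  have hrow : ∀ k, ∑ l, m k l ≤ μ (a ⁻¹' {k}) := by
    intro k
    have e : ∀ l, m k l = (πH.restrict ((fun z => a z.1) ⁻¹' {k})) ((fun z => b z.2) ⁻¹' {l}) := by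
      intro l
      rw [Measure.restrict_apply (hb1 (measurableSet_singleton l))]
      refine congrArg πH ?_
      ext z
      simp [hg_def, and_comm]
    simp only [e]
    rw [sum_measure_preimage' _ hb1, Measure.restrict_apply_univ]
    refine (Measure.restrict_apply_le _ _).trans (le_of_eq ?_)
    rw [← hπ.1, Measure.map_apply measurable_fst (ha (measurableSet_singleton k))]
    rfl
  have hcol : ∀ l, ∑ k, m k l ≤ ν (b ⁻¹' {l}) := by
    intro l
    have e : ∀ k, m k l = (πH.restrict ((fun z => b z.2) ⁻¹' {l})) ((fun z => a z.1) ⁻¹' {k}) := by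
      intro k
      rw [Measure.restrict_apply (ha1 (measurableSet_singleton k))]
      refine congrArg πH ?_
      ext z
      simp [hg_def]
    simp only [e]
    rw [sum_measure_preimage' _ ha1, Measure.restrict_apply_univ]
    refine (Measure.restrict_apply_le _ _).trans (le_of_eq ?_)
    rw [← hπ.2, Measure.map_apply measurable_snd (hb (measurableSet_singleton l))]
    rfl
  have hplan : IsPartialPlan (fun k => μ (a ⁻¹' {k})) (fun l => ν (b ⁻¹' {l})) (ratMass N K) :=
    ⟨fun k => (Finset.sum_le_sum fun l _ => hle k l).trans (hrow k),
      fun l => (Finset.sum_le_sum fun k _ => hle k l).trans (hcol l)⟩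
  have hres : 1 - ∑ k, ∑ l, ratMass N K k l ≤ η := by
    rw [tsub_le_iff_left]
    have h1 : π (H n) = ∑ k, ∑ l, m k l := by
      rw [← Fintype.sum_prod_type', sum_measure_preimage' πH hg, hπH, Measure.restrict_apply_univ]
    have h2 : ∑ k, ∑ l, m k l ≤ ∑ k, ∑ l, ratMass N K k l + Q * (1 / (N + 1)) := by
      have h3 : Q * (1 / (N + 1)) =
          ∑ _k : Fin n → Bool, ∑ _l : Fin n → Bool, 1 / ((N : ℝ≥0∞) + 1) := by
        simp only [Finset.sum_const, Finset.card_univ, nsmul_eq_mul, hQ, Fintype.card_prod,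
          Nat.cast_mul]
        ring
      rw [h3, ← Finset.sum_add_distrib]
      refine Finset.sum_le_sum fun k _ => ?_
      rw [← Finset.sum_add_distrib]
      exact Finset.sum_le_sum fun l _ => hK2 k l
    calc (1 : ℝ≥0∞) ≤ π (H n) + η / 2 := hn
      _ ≤ ∑ k, ∑ l, ratMass N K k l + η / 2 + η / 2 := by
          rw [h1]; exact add_le_add (h2.trans (add_le_add le_rfl hN)) le_rfl
      _ = _ := by rw [add_assoc, ENNReal.add_halves]
  have hcost : ∑ k, ∑ l, ratMass N K k l * cellCost c n k l ≤ ∫⁻ z, D z ∂π + ε / 3 := by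
    calc ∑ k, ∑ l, ratMass N K k l * cellCost c n k l ≤ ∑ k, ∑ l, m k l * cellCost c n k l :=
          Finset.sum_le_sum fun k _ => Finset.sum_le_sum fun l _ => mul_le_mul_left (hle k l) _
      _ = ∫⁻ z, cellCost c n (a z.1) (b z.2) ∂πH := by
          rw [← Fintype.sum_prod_type' (f := fun k l => m k l * cellCost c n k l)]
          exact (lintegral_comp_finite πH hg (fun s => cellCost c n s.1 s.2)).symm
      _ ≤ ∫⁻ z in H n, (D z + ε / 3) ∂π := by
          refine setLIntegral_mono' (hHm n) fun z hz => ?_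
          obtain ⟨i, hi, hz'⟩ := mem_iUnion₂.1 hz
          exact (cellCost_le (Finset.mem_range.1 hi) hz'.1.1 hz'.1.2).trans hz'.2
      _ ≤ ∫⁻ z, (D z + ε / 3) ∂π := setLIntegral_le_lintegral _ _
      _ = _ := by rw [lintegral_add_right _ measurable_const, lintegral_const, measure_univ, mul_one]
  refine ⟨n, N, K, hplan, ?_⟩
  have h1 : ∫⁻ u, planResidual μ a (fun k => ∑ l, ratMass N K k l) u * α u ∂μ ≤ ε / 3 :=
    hα' _ (measurable_planResidual ha _) (fun u => tsub_le_self) (by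
      rw [lintegral_planResidual ha (sum_measure_preimage ν hb) hplan]
      exact hres.trans ((min_le_left _ _).trans (min_le_left _ _)))
  have h2 : ∫⁻ v, planResidual ν b (fun l => ∑ k, ratMass N K k l) v * β v ∂ν ≤ ε / 3 :=
    hβ' _ (measurable_planResidual hb _) (fun u => tsub_le_self) (by
      rw [lintegral_planResidual hb (sum_measure_preimage μ ha) hplan.swap, Finset.sum_comm]
      exact hres.trans ((min_le_left _ _).trans (min_le_right _ _)))
  refine (add_le_add (add_le_add hcost h1) h2).trans (le_of_eq ?_)
  rw [add_assoc, add_assoc, ← add_assoc (ε / 3), ENNReal.add_thirds]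

end Approximation

/-! ### Measurable selection of nearly optimal couplings of two kernels -/

section KernelTransport

variable {X Y U V : Type*} [MeasurableSpace X] [MeasurableSpace Y] [MeasurableSpace U]
  [MeasurableSpace V]

/-- The mass which `κ x` gives to the cell `k`. -/
def cellMass (κ : Kernel X U) (A : ℕ → Set (X × U)) (n : ℕ) (x : X) (k : Fin n → Bool) : ℝ≥0∞ :=
  κ x ((fun u => cell A n (x, u)) ⁻¹' {k})

theorem measurable_cellMass (κ : Kernel X U) [IsSFiniteKernel κ] {A : ℕ → Set (X × U)}
    (hA : ∀ n, MeasurableSet (A n)) (n : ℕ) (k : Fin n → Bool) :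
    Measurable fun x => cellMass κ A n x k :=
  Kernel.measurable_kernel_prodMk_left (measurable_cell hA n (measurableSet_singleton k))

theorem measurable_comp_cell {Z I : Type*} [MeasurableSpace Z] [Countable I] [MeasurableSpace I]
    [MeasurableSingletonClass I] {f : Z → I → ℝ≥0∞} (hf : ∀ k, Measurable fun z => f z k)
    {a : Z → I} (ha : Measurable a) : Measurable fun z => f z (a z) := by
  have h : Measurable fun s : Z × I => f s.1 s.2 := measurable_from_prod_countable_left hf
  exact h.comp (measurable_id.prodMk ha)

theorem measurable_lintegral_planResidual (κ : Kernel X U) [IsSFiniteKernel κ]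
    {A : ℕ → Set (X × U)} (hA : ∀ n, MeasurableSet (A n)) (n : ℕ) (R : (Fin n → Bool) → ℝ≥0∞)
    {α : X × U → ℝ≥0∞} (hα : Measurable α) :
    Measurable fun x => ∫⁻ u, planResidual (κ x) (fun u => cell A n (x, u)) R u * α (x, u) ∂κ x := by
  have h : Measurable fun z : X × U =>
      (1 - R (cell A n z) / cellMass κ A n z.1 (cell A n z)) * α z := by
    refine Measurable.mul (measurable_comp_cell (f := fun (z : X × U) k =>
      1 - R k / cellMass κ A n z.1 k) (fun k => ?_) (measurable_cell hA n)) hα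
    exact measurable_const.sub (measurable_const.div
      ((measurable_cellMass κ hA n k).comp measurable_fst))
  exact h.lintegral_kernel_prod_right'

/-- The data of a partial transport plan: the number of sets generating the cells and the masses. -/
abbrev PlanIndex : Type := Σ n : ℕ, ℕ × ((Fin n → Bool) → (Fin n → Bool) → ℕ)

variable (κ : Kernel X U) (κ' : Kernel Y V) (A : ℕ → Set (X × U)) (B : ℕ → Set (Y × V))

/-- The points at which the row sums of the plan are admissible. -/
def planRow (j : PlanIndex) : Set X :=
  {x | ∀ k, ∑ l, ratMass j.2.1 j.2.2 k l ≤ cellMass κ A j.1 x k}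

/-- The points at which the column sums of the plan are admissible. -/
def planCol (j : PlanIndex) : Set Y :=
  {y | ∀ l, ∑ k, ratMass j.2.1 j.2.2 k l ≤ cellMass κ' B j.1 y l}

/-- The cost bound of the plan, as a function of the points. -/
def planBound (c : ℕ → ℝ≥0∞) (α : X × U → ℝ≥0∞) (β : Y × V → ℝ≥0∞) (j : PlanIndex) (x : X) (y : Y) :
    ℝ≥0∞ :=
  planCost (κ x) (κ' y) (fun u => cell A j.1 (x, u)) (fun v => cell B j.1 (y, v))
    (ratMass j.2.1 j.2.2) (cellCost c j.1) (fun u => α (x, u)) (fun v => β (y, v))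

variable {κ κ' A B}

theorem measurableSet_planRow [IsSFiniteKernel κ] (hA : ∀ n, MeasurableSet (A n)) (j : PlanIndex) :
    MeasurableSet (planRow κ A j) := by
  have e : planRow κ A j = ⋂ k, {x | ∑ l, ratMass j.2.1 j.2.2 k l ≤ cellMass κ A j.1 x k} := by
    ext x; simp [planRow]
  rw [e]
  exact MeasurableSet.iInter fun k =>
    measurableSet_le measurable_const (measurable_cellMass κ hA _ k)

theorem measurableSet_planCol [IsSFiniteKernel κ'] (hB : ∀ n, MeasurableSet (B n)) (j : PlanIndex) :
    MeasurableSet (planCol κ' B j) := by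
  have e : planCol κ' B j = ⋂ l, {y | ∑ k, ratMass j.2.1 j.2.2 k l ≤ cellMass κ' B j.1 y l} := by
    ext x; simp [planCol]
  rw [e]
  exact MeasurableSet.iInter fun k =>
    measurableSet_le measurable_const (measurable_cellMass κ' hB _ k)

theorem isRectInf_planBound [IsSFiniteKernel κ] [IsSFiniteKernel κ']
    (hA : ∀ n, MeasurableSet (A n)) (hB : ∀ n, MeasurableSet (B n)) (c : ℕ → ℝ≥0∞)
    {α : X × U → ℝ≥0∞} {β : Y × V → ℝ≥0∞} (hα : Measurable α) (hβ : Measurable β)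
    (j : PlanIndex) : IsRectInf (planBound κ κ' A B c α β j) :=
  isRectInf_add (measurable_const.add (measurable_lintegral_planResidual κ hA j.1 _ hα))
    (measurable_lintegral_planResidual κ' hB j.1 _ hβ)

theorem isPartialPlan_of_mem {j : PlanIndex} {x : X} {y : Y} (hx : x ∈ planRow κ A j)
    (hy : y ∈ planCol κ' B j) :
    IsPartialPlan (fun k => κ x ((fun u => cell A j.1 (x, u)) ⁻¹' {k}))
      (fun l => κ' y ((fun v => cell B j.1 (y, v)) ⁻¹' {l})) (ratMass j.2.1 j.2.2) :=
  ⟨hx, hy⟩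

/-- The density of the coupling defined by a plan. -/
def planKernelDensity (κ : Kernel X U) (κ' : Kernel Y V) (A : ℕ → Set (X × U))
    (B : ℕ → Set (Y × V)) (j : PlanIndex) (s : (X × Y) × (U × V)) : ℝ≥0∞ :=
  planDensity (cellMass κ A j.1 s.1.1) (cellMass κ' B j.1 s.1.2) (ratMass j.2.1 j.2.2)
    (cell A j.1 (s.1.1, s.2.1)) (cell B j.1 (s.1.2, s.2.2))

theorem measurable_planKernelDensity [IsSFiniteKernel κ] [IsSFiniteKernel κ']
    (hA : ∀ n, MeasurableSet (A n)) (hB : ∀ n, MeasurableSet (B n)) (j : PlanIndex) :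
    Measurable (planKernelDensity κ κ' A B j) := by
  refine measurable_comp_cell (f := fun (s : (X × Y) × (U × V))
    (k : (Fin j.1 → Bool) × (Fin j.1 → Bool)) => planDensity (cellMass κ A j.1 s.1.1)
      (cellMass κ' B j.1 s.1.2) (ratMass j.2.1 j.2.2) k.1 k.2) (fun k => ?_)
    (a := fun s : (X × Y) × (U × V) =>
      (cell A j.1 (s.1.1, s.2.1), cell B j.1 (s.1.2, s.2.2))) ?_
  · have h1 : Measurable fun s : (X × Y) × (U × V) => cellMass κ A j.1 s.1.1 k.1 :=
      (measurable_cellMass κ hA _ k.1).comp (by fun_prop)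
    have h2 : Measurable fun s : (X × Y) × (U × V) => cellMass κ' B j.1 s.1.2 k.2 :=
      (measurable_cellMass κ' hB _ k.2).comp (by fun_prop)
    exact (measurable_const.div (h1.mul h2)).add
      (((measurable_const.sub (measurable_const.div h1)).mul
        (measurable_const.sub (measurable_const.div h2))).div measurable_const)
  · exact ((measurable_cell hA _).comp (by fun_prop)).prodMk
      ((measurable_cell hB _).comp (by fun_prop))

/-- The infimum of the costs of couplings of the kernels agrees, where the bounds are integrable,
with an infimum of rectangle functions, and there are measurable nearly optimal couplings. -/
theorem exists_isRectInf_transport (κ : Kernel X U) (κ' : Kernel Y V) [IsMarkovKernel κ]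
    [IsMarkovKernel κ'] {D : X × U → Y × V → ℝ≥0∞} (hD : IsRectInf D)
    {α : X × U → ℝ≥0∞} {β : Y × V → ℝ≥0∞} (hα : Measurable α) (hβ : Measurable β)
    (hle : ∀ s t, D s t ≤ α s + β t) :
    ∃ W : X → Y → ℝ≥0∞, IsRectInf W ∧
      (∀ x y, ∫⁻ u, α (x, u) ∂κ x ≠ ∞ → ∫⁻ v, β (y, v) ∂κ' y ≠ ∞ →
        W x y = ⨅ (π : Measure (U × V)) (_ : IsCoupling (κ x) (κ' y) π),
          ∫⁻ z, D (x, z.1) (y, z.2) ∂π) ∧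
      ∀ ε : ℝ≥0∞, ε ≠ 0 → ∃ Γ : Kernel (X × Y) (U × V), IsMarkovKernel Γ ∧
        (∀ x y, IsCoupling (κ x) (κ' y) (Γ (x, y))) ∧
        ∀ x y, ∫⁻ z, D (x, z.1) (y, z.2) ∂Γ (x, y) ≤ W x y + ε := by
  classical
  have hDm := hD.measurable
  obtain ⟨A, B, c, hA, hB, rfl⟩ := hD
  -- A plan is admissible on a rectangle of pairs `(x, y)` and its cost bound is a sum of a function
  -- of `x` and one of `y`; so `C j`, and with it the infimum over countably many plans, stays in
  -- the class of rectangle infima.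
  set C : PlanIndex → X → Y → ℝ≥0∞ := fun j x y =>
    if x ∈ planRow κ A j ∧ y ∈ planCol κ' B j then planBound κ κ' A B c α β j x y else ∞ with hC
  have hCr : ∀ j, IsRectInf (C j) := fun j =>
    (isRectInf_planBound hA hB c hα hβ j).restrict (measurableSet_planRow hA j)
      (measurableSet_planCol hB j)
  set W : X → Y → ℝ≥0∞ := fun x y => ⨅ j, C j x y with hW
  have hWr : IsRectInf W := IsRectInf.iInf hCr
  have hcm : ∀ x n, Measurable fun u => cell A n (x, u) := fun x n =>
    (measurable_cell hA n).comp measurable_prodMk_left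
  have hcm' : ∀ y n, Measurable fun v => cell B n (y, v) := fun y n =>
    (measurable_cell hB n).comp measurable_prodMk_left
  have hub : ∀ j x y, x ∈ planRow κ A j → y ∈ planCol κ' B j →
      ∫⁻ z, rectInf A B c (x, z.1) (y, z.2) ∂planMeasure (κ x) (κ' y)
        (fun u => cell A j.1 (x, u)) (fun v => cell B j.1 (y, v)) (ratMass j.2.1 j.2.2) ≤
        C j x y := by
    intro j x y hx hy
    have e : C j x y = planBound κ κ' A B c α β j x y := if_pos ⟨hx, hy⟩
    rw [e]
    refine lintegral_planMeasure_le (hcm x _) (hcm' y _) (isPartialPlan_of_mem hx hy)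
      (D := fun z => rectInf A B c (x, z.1) (y, z.2)) ?_ ?_ ?_ ?_ ?_
    · exact hDm.comp (f := fun z : U × V => ((x, z.1), (y, z.2))) (by fun_prop)
    · exact hα.comp measurable_prodMk_left
    · exact hβ.comp measurable_prodMk_left
    · intro z
      exact rectInf_le_cellCost (x, z.1) (y, z.2)
    · intro z
      exact hle _ _
  -- The plan that moves nothing is always admissible; a plan is needed even where the infimum is
  -- infinite.
  have hzero : ∀ x y, ∃ j, x ∈ planRow κ A j ∧ y ∈ planCol κ' B j := by
    intro x y
    refine ⟨⟨0, 0, fun _ _ => 0⟩, ?_, ?_⟩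
    · intro k; simp [ratMass]
    · intro k; simp [ratMass]
  refine ⟨W, hWr, ?_, ?_⟩
  · intro x y hαi hβi
    -- An arbitrary coupling is approximated by plans between cells; conversely every admissible
    -- plan induces a coupling whose cost is below its bound.
    refine le_antisymm (le_iInf₂ fun π hπ => ?_) ?_
    · by_cases hfin : ∫⁻ z, rectInf A B c (x, z.1) (y, z.2) ∂π = ∞
      · rw [hfin]; exact le_top
      refine ENNReal.le_of_forall_pos_le_add fun ε hε _ => ?_
      obtain ⟨n, N, K, h1, h2⟩ := exists_partialPlan_cost_le (μ := κ x) (ν := κ' y) hπ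
        (A := fun i => Prod.mk x ⁻¹' A i) (B := fun i => Prod.mk y ⁻¹' B i)
        (fun n => measurable_prodMk_left (hA n)) (fun n => measurable_prodMk_left (hB n)) c
        (α := fun u => α (x, u)) (β := fun v => β (y, v)) (hα.comp measurable_prodMk_left)
        (hβ.comp measurable_prodMk_left) hαi hβi hfin (ENNReal.coe_pos.2 hε).ne'
      have hx : x ∈ planRow κ A ⟨n, N, K⟩ := h1.row_le
      have hy : y ∈ planCol κ' B ⟨n, N, K⟩ := h1.col_le
      refine (iInf_le _ (⟨n, N, K⟩ : PlanIndex)).trans ?_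
      have e : C ⟨n, N, K⟩ x y = planBound κ κ' A B c α β ⟨n, N, K⟩ x y := if_pos ⟨hx, hy⟩
      rw [e]
      exact h2
    · refine le_iInf fun j => ?_
      by_cases hj : x ∈ planRow κ A j ∧ y ∈ planCol κ' B j
      · exact (iInf₂_le _ (isCoupling_planMeasure (hcm x _) (hcm' y _)
          (isPartialPlan_of_mem hj.1 hj.2))).trans (hub j x y hj.1 hj.2)
      · have e : C j x y = ∞ := if_neg hj
        rw [e]; exact le_top
  · intro ε hε
    obtain ⟨e, he⟩ := exists_surjective_nat PlanIndex
    -- The kernel uses the first good plan in an enumeration. Admissibility is demanded separately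
    -- because it does not follow from the cost condition where `W` is infinite.
    set p : X × Y → ℕ → Prop := fun s n => (s.1 ∈ planRow κ A (e n) ∧ s.2 ∈ planCol κ' B (e n)) ∧
      C (e n) s.1 s.2 ≤ W s.1 s.2 + ε with hp
    have hex : ∀ s, ∃ n, p s n := by
      intro s
      by_cases hs : W s.1 s.2 = ∞
      · obtain ⟨j, hj⟩ := hzero s.1 s.2
        obtain ⟨n, rfl⟩ := he j
        exact ⟨n, hj, by rw [hs, top_add]; exact le_top⟩
      · obtain ⟨j, hj⟩ := iInf_lt_iff.1 (ENNReal.lt_add_right hs hε)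
        obtain ⟨n, rfl⟩ := he j
        refine ⟨n, ?_, hj.le⟩
        by_contra h
        have e : C (e n) s.1 s.2 = ∞ := if_neg h
        rw [e] at hj
        exact absurd hj not_top_lt
    have hpm : ∀ n, MeasurableSet {s | p s n} := fun n =>
      ((measurable_fst (measurableSet_planRow hA (e n))).inter
        (measurable_snd (measurableSet_planCol hB (e n)))).inter
        (measurableSet_le (hCr (e n)).measurable (hWr.measurable.add_const ε))
    set J : X × Y → ℕ := fun s => Nat.find (hex s) with hJ
    have hJm : Measurable J := measurable_find hex hpm
    have hJp : ∀ s, p s (J s) := fun s => Nat.find_spec (hex s)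
    set θ : X × Y → U × V → ℝ≥0∞ := fun s z => planKernelDensity κ κ' A B (e (J s)) (s, z) with hθ
    have hθm : Measurable (Function.uncurry θ) :=
      measurable_comp_cell (f := fun (s : (X × Y) × (U × V)) (n : ℕ) =>
        planKernelDensity κ κ' A B (e n) s)
        (fun n => measurable_planKernelDensity hA hB (e n)) (hJm.comp measurable_fst)
    set Γ : Kernel (X × Y) (U × V) := Kernel.withDensity
      ((κ.comap Prod.fst measurable_fst) ×ₖ (κ'.comap Prod.snd measurable_snd)) θ with hΓ
    have hΓa : ∀ x y, Γ (x, y) = planMeasure (κ x) (κ' y)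
        (fun u => cell A (e (J (x, y))).1 (x, u)) (fun v => cell B (e (J (x, y))).1 (y, v))
        (ratMass (e (J (x, y))).2.1 (e (J (x, y))).2.2) := by
      intro x y
      rw [hΓ, Kernel.withDensity_apply _ hθm, Kernel.prod_apply]
      rfl
    have hcoup : ∀ x y, IsCoupling (κ x) (κ' y) (Γ (x, y)) := by
      intro x y
      rw [hΓa]
      exact isCoupling_planMeasure (hcm x _) (hcm' y _)
        (isPartialPlan_of_mem (hJp (x, y)).1.1 (hJp (x, y)).1.2)
    refine ⟨Γ, ⟨fun s => (hcoup s.1 s.2).isProbabilityMeasure⟩, hcoup, fun x y => ?_⟩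
    have h1 := hJp (x, y)
    rw [hΓa]
    exact (hub _ x y h1.1.1 h1.1.2).trans h1.2

end KernelTransport

/-! ### Iterated means along controlled kernels -/

theorem downward_induction {T : ℕ} {p : ℕ → Prop} (hT : ∀ t, T ≤ t → p t)
    (hs : ∀ t, t < T → p (t + 1) → p t) (t : ℕ) : p t := by
  by_cases h : t < T
  · exact hs t h (downward_induction hT hs (t + 1))
  · exact hT t (not_lt.1 h)
termination_by T - t

section IterMean

variable {T : ℕ} {X : Type*} [MeasurableSpace X] {U : Fin T → Type*} [∀ i, MeasurableSpace (U i)]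

/-- The iterated mean `Λ_T = f`, `Λ_t(x) = ∫ Λ_{t+1}(step x u) κ_t(x, du)`. -/
def iterMean (κ : ∀ i, Kernel X (U i)) (step : ∀ i, X → U i → X) (f : X → ℝ≥0∞) (t : ℕ) :
    X → ℝ≥0∞ :=
  if h : t < T then
    fun x => ∫⁻ u, iterMean κ step f (t + 1) (step ⟨t, h⟩ x u) ∂κ ⟨t, h⟩ x
  else f
termination_by T - t

variable {κ : ∀ i, Kernel X (U i)} {step : ∀ i, X → U i → X} {f g : X → ℝ≥0∞}

theorem iterMean_of_lt {t : ℕ} (h : t < T) (x : X) : iterMean κ step f t x =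
    ∫⁻ u, iterMean κ step f (t + 1) (step ⟨t, h⟩ x u) ∂κ ⟨t, h⟩ x := by
  rw [iterMean, dif_pos h]

theorem iterMean_of_le {t : ℕ} (h : T ≤ t) : iterMean κ step f t = f := by
  rw [iterMean, dif_neg (not_lt.2 h)]

theorem measurable_iterMean [∀ i, IsSFiniteKernel (κ i)]
    (hstep : ∀ i, Measurable fun z : X × U i => step i z.1 z.2) (hf : Measurable f) (t : ℕ) :
    Measurable (iterMean κ step f t) := by
  refine downward_induction (T := T) (p := fun t => Measurable (iterMean κ step f t))
    (fun t h => ?_) (fun t h ih => ?_) t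
  · rwa [iterMean_of_le h]
  · have e : iterMean κ step f t = fun x =>
        ∫⁻ u, iterMean κ step f (t + 1) (step ⟨t, h⟩ x u) ∂κ ⟨t, h⟩ x :=
      funext fun x => iterMean_of_lt h x
    rw [e]
    exact (ih.comp (hstep ⟨t, h⟩)).lintegral_kernel_prod_right'

/-- The relation is left abstract so that one induction serves single paths and pairs of paths. -/
theorem iterMean_congr_rel {rel : ℕ → X → X → Prop}
    (hκ : ∀ t (h : t < T) x x', rel t x x' → κ ⟨t, h⟩ x = κ ⟨t, h⟩ x')
    (hstep : ∀ t (h : t < T) x x' u, rel t x x' → rel (t + 1) (step ⟨t, h⟩ x u) (step ⟨t, h⟩ x' u))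
    (hf : ∀ t, T ≤ t → ∀ x x', rel t x x' → f x = f x') (t : ℕ) :
    ∀ x x', rel t x x' → iterMean κ step f t x = iterMean κ step f t x' := by
  refine downward_induction (T := T)
    (p := fun t => ∀ x x', rel t x x' → iterMean κ step f t x = iterMean κ step f t x')
    (fun t h x x' hx => ?_) (fun t h ih x x' hx => ?_) t
  · rw [iterMean_of_le h]
    exact hf t h x x' hx
  · rw [iterMean_of_lt h, iterMean_of_lt h, hκ t h x x' hx]
    exact lintegral_congr fun u => ih _ _ (hstep t h x x' u hx)

theorem iterMean_mono (hfg : ∀ x, f x ≤ g x) (t : ℕ) :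
    ∀ x, iterMean κ step f t x ≤ iterMean κ step g t x := by
  refine downward_induction (T := T)
    (p := fun t => ∀ x, iterMean κ step f t x ≤ iterMean κ step g t x)
    (fun t h => ?_) (fun t h ih x => ?_) t
  · simpa only [iterMean_of_le h] using hfg
  · rw [iterMean_of_lt h, iterMean_of_lt h]
    exact lintegral_mono fun u => ih _

/-- If `φ` and `ψ` intertwine steps and kernels, the iterated means correspond. Projecting pairs of
paths to the second one is the case of interest. -/
theorem iterMean_map {X' : Type*} [MeasurableSpace X'] {U' : Fin T → Type*}
    [∀ i, MeasurableSpace (U' i)] {κ' : ∀ i, Kernel X' (U' i)} [∀ i, IsSFiniteKernel (κ' i)]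
    {step' : ∀ i, X' → U' i → X'} (hstep' : ∀ i, Measurable fun z : X' × U' i => step' i z.1 z.2)
    {φ : X → X'} {ψ : ∀ i, U i → U' i} (hψ : ∀ i, Measurable (ψ i))
    (hφ : ∀ i x u, φ (step i x u) = step' i (φ x) (ψ i u))
    (hκ : ∀ i x, (κ i x).map (ψ i) = κ' i (φ x)) {f' : X' → ℝ≥0∞} (hf' : Measurable f') (t : ℕ) :
    ∀ x, iterMean κ step (fun x => f' (φ x)) t x = iterMean κ' step' f' t (φ x) := by
  refine downward_induction (T := T)
    (p := fun t => ∀ x, iterMean κ step (fun x => f' (φ x)) t x = iterMean κ' step' f' t (φ x))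
    (fun t h x => ?_) (fun t h ih x => ?_) t
  · rw [iterMean_of_le h, iterMean_of_le h]
  · rw [iterMean_of_lt h, iterMean_of_lt h, ← hκ, lintegral_map _ (hψ _)]
    · exact lintegral_congr fun u => by rw [ih, hφ]
    · exact ((measurable_iterMean hstep' hf' (t + 1)).comp (hstep' ⟨t, h⟩)).comp
        measurable_prodMk_left

/-- The iterated `L^r`-norm `Λ_T = f`, `Λ_t(x) = (∫ Λ_{t+1}(step x u)^r κ_t(x, du))^{1/r}`. -/
def iterNorm (r : ℝ) (κ : ∀ i, Kernel X (U i)) (step : ∀ i, X → U i → X) (f : X → ℝ≥0∞) (t : ℕ)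
    (x : X) : ℝ≥0∞ :=
  iterMean κ step (fun x => f x ^ r) t x ^ (1 / r)

variable {r : ℝ}

theorem iterNorm_rpow (hr : 1 ≤ r) (t : ℕ) (x : X) :
    iterNorm r κ step f t x ^ r = iterMean κ step (fun x => f x ^ r) t x := by
  rw [iterNorm, ← ENNReal.rpow_mul, one_div_mul_cancel (by positivity), ENNReal.rpow_one]

/-- Roots and powers cancel between consecutive stages, which is why a single root of an iterated
mean defines the iterated norm. -/
theorem iterNorm_of_lt (hr : 1 ≤ r) {t : ℕ} (h : t < T) (x : X) : iterNorm r κ step f t x =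
    powMean r (κ ⟨t, h⟩ x) fun u => iterNorm r κ step f (t + 1) (step ⟨t, h⟩ x u) := by
  simp only [powMean, iterNorm_rpow hr]
  rw [iterNorm, iterMean_of_lt h]

theorem iterNorm_of_le (hr : 1 ≤ r) {t : ℕ} (h : T ≤ t) : iterNorm r κ step f t = f := by
  funext x
  rw [iterNorm, iterMean_of_le h, ← ENNReal.rpow_mul, mul_one_div_cancel (by positivity),
    ENNReal.rpow_one]

theorem measurable_iterNorm [∀ i, IsSFiniteKernel (κ i)]
    (hstep : ∀ i, Measurable fun z : X × U i => step i z.1 z.2) (hf : Measurable f) (t : ℕ) :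
    Measurable (iterNorm r κ step f t) :=
  (measurable_iterMean hstep (hf.pow_const r) t).pow_const _

theorem iterNorm_mono (hr : 1 ≤ r) (hfg : ∀ x, f x ≤ g x) (t : ℕ) (x : X) :
    iterNorm r κ step f t x ≤ iterNorm r κ step g t x := by
  unfold iterNorm
  have := iterMean_mono (κ := κ) (step := step) (f := fun x => f x ^ r) (g := fun x => g x ^ r)
    (fun x => ENNReal.rpow_le_rpow (hfg x) (by positivity)) t x
  exact ENNReal.rpow_le_rpow this (by positivity)

theorem iterNorm_add_le (hr : 1 ≤ r) [∀ i, IsSFiniteKernel (κ i)]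
    (hstep : ∀ i, Measurable fun z : X × U i => step i z.1 z.2) (hf : Measurable f)
    (hg : Measurable g) (t : ℕ) : ∀ x, iterNorm r κ step (fun x => f x + g x) t x ≤
      iterNorm r κ step f t x + iterNorm r κ step g t x := by
  refine downward_induction (T := T) (p := fun t => ∀ x,
    iterNorm r κ step (fun x => f x + g x) t x ≤
      iterNorm r κ step f t x + iterNorm r κ step g t x) (fun t h x => ?_) (fun t h ih x => ?_) t
  · simp only [iterNorm_of_le hr h, le_refl]
  · rw [iterNorm_of_lt hr h, iterNorm_of_lt hr h, iterNorm_of_lt hr h]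
    refine (powMean_mono_ae hr (Filter.Eventually.of_forall fun u => ih _)).trans ?_
    have hm : ∀ {f}, Measurable f → Measurable fun u =>
        iterNorm r κ step f (t + 1) (step ⟨t, h⟩ x u) := fun hf =>
      ((measurable_iterNorm hstep hf (t + 1)).comp (hstep ⟨t, h⟩)).comp measurable_prodMk_left
    exact powMean_add_le hr (hm hf).aemeasurable (hm hg).aemeasurable

theorem iterNorm_const_mul (hr : 1 ≤ r) (a : ℝ≥0) (t : ℕ) : ∀ x, iterNorm r κ step (fun x => a * f x) t x =
      a * iterNorm r κ step f t x := by
  refine downward_induction (T := T) (p := fun t => ∀ x,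
    iterNorm r κ step (fun x => a * f x) t x = a * iterNorm r κ step f t x)
    (fun t h x => ?_) (fun t h ih x => ?_) t
  · simp only [iterNorm_of_le hr h]
  · rw [iterNorm_of_lt hr h, iterNorm_of_lt hr h]
    simp only [ih]
    exact powMean_const_mul hr ENNReal.coe_ne_top _

theorem iterNorm_const (hr : 1 ≤ r) [∀ i, IsMarkovKernel (κ i)] (a : ℝ≥0∞) (t : ℕ) :
    ∀ x, iterNorm r κ step (fun _ => a) t x = a := by
  refine downward_induction (T := T) (p := fun t => ∀ x,
    iterNorm r κ step (fun _ => a) t x = a) (fun t h x => ?_) (fun t h ih x => ?_) t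
  · simp only [iterNorm_of_le hr h]
  · rw [iterNorm_of_lt hr h]
    simp only [ih]
    exact powMean_const hr a

end IterMean

/-! ### Paths and the laws of their beginnings -/

section Paths

variable {T : ℕ} {Ξ : Fin T → Type*}

/-- The paths `x` and `x'` have the same history before `t`. -/
def Agree (t : ℕ) (x x' : ∀ i, Ξ i) : Prop := ∀ j : Fin T, j.val < t → x j = x' j

theorem Agree.refl (t : ℕ) (x : ∀ i, Ξ i) : Agree t x x := fun _ _ => rfl

theorem Agree.symm {t : ℕ} {x x' : ∀ i, Ξ i} (h : Agree t x x') : Agree t x' x :=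
  fun j hj => (h j hj).symm

theorem Agree.trans {t : ℕ} {x x' x'' : ∀ i, Ξ i} (h : Agree t x x') (h' : Agree t x' x'') :
    Agree t x x'' := fun j hj => (h j hj).trans (h' j hj)

theorem Agree.mono {s t : ℕ} (hst : s ≤ t) {x x' : ∀ i, Ξ i} (h : Agree t x x') : Agree s x x' :=
  fun j hj => h j (hj.trans_le hst)

theorem Agree.eq {t : ℕ} (ht : T ≤ t) {x x' : ∀ i, Ξ i} (h : Agree t x x') : x = x' :=
  funext fun j => h j (j.isLt.trans_le ht)

theorem Agree.update {t : ℕ} (h : t < T) {x x' : ∀ i, Ξ i} (hx : Agree t x x') (u : Ξ ⟨t, h⟩) :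
    Agree (t + 1) (Function.update x ⟨t, h⟩ u) (Function.update x' ⟨t, h⟩ u) :=
  update_agree h hx u

theorem agree_update {t : ℕ} (h : t < T) (x : ∀ i, Ξ i) (u : Ξ ⟨t, h⟩) :
    Agree t (Function.update x ⟨t, h⟩ u) x := fun j hj =>
  Function.update_of_ne (fun e => by subst e; exact lt_irrefl _ hj) _ _

variable [∀ i, Nonempty (Ξ i)]

/-- The path which agrees with `x` before `t` and is constant afterwards. -/
def freeze (t : ℕ) (x : ∀ i, Ξ i) : ∀ i, Ξ i := fun i =>
  if i.val < t then x i else Classical.arbitrary _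

theorem agree_freeze (t : ℕ) (x : ∀ i, Ξ i) : Agree t (freeze t x) x := fun j hj => by
  simp [freeze, hj]

theorem Agree.freeze_eq {t : ℕ} {x x' : ∀ i, Ξ i} (h : Agree t x x') : freeze t x = freeze t x' := by
  funext i
  by_cases hi : i.val < t
  · simp [freeze, hi, h i hi]
  · simp [freeze, hi]

theorem freeze_of_le {t : ℕ} (ht : T ≤ t) (x : ∀ i, Ξ i) : freeze t x = x :=
  (agree_freeze t x).eq ht

theorem freeze_freeze (t : ℕ) (x : ∀ i, Ξ i) : freeze t (freeze t x) = freeze t x :=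
  (agree_freeze t x).freeze_eq

variable [∀ i, MeasurableSpace (Ξ i)]

theorem measurable_freeze (t : ℕ) : Measurable (freeze t : (∀ i, Ξ i) → ∀ i, Ξ i) := by
  refine measurable_pi_lambda _ fun i => ?_
  by_cases hi : i.val < t
  · simpa [freeze, hi] using measurable_pi_apply i
  · simp [freeze, hi]

theorem measurable_pathRestrict (t : ℕ) :
    Measurable (pathRestrict t : (∀ i, Ξ i) → ∀ i : {i : Fin T // i.val < t}, Ξ i.val) :=
  measurable_pi_lambda _ fun i => measurable_pi_apply i.val

theorem measurable_update_prod (i : Fin T) :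
    Measurable fun z : (∀ i, Ξ i) × Ξ i => Function.update z.1 i z.2 := by
  refine measurable_pi_lambda _ fun j => ?_
  by_cases hj : j = i
  · subst hj
    simpa using measurable_snd
  · simp only [Function.update_of_ne hj]
    exact (measurable_pi_apply j).comp measurable_fst

/-- The path with beginning `a`, constant afterwards. -/
def extendPath (t : ℕ) (a : ∀ i : {i : Fin T // i.val < t}, Ξ i.val) : ∀ i, Ξ i := fun i =>
  if h : i.val < t then a ⟨i, h⟩ else Classical.arbitrary _

theorem measurable_extendPath (t : ℕ) :
    Measurable (extendPath t : (∀ i : {i : Fin T // i.val < t}, Ξ i.val) → ∀ i, Ξ i) := by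
  refine measurable_pi_lambda _ fun i => ?_
  by_cases hi : i.val < t
  · simpa [extendPath, hi] using measurable_pi_apply (⟨i, hi⟩ : {i : Fin T // i.val < t})
  · simp [extendPath, hi]

theorem extendPath_pathRestrict (t : ℕ) (x : ∀ i, Ξ i) :
    extendPath t (pathRestrict t x) = freeze t x := by
  funext i
  by_cases hi : i.val < t <;> simp [extendPath, freeze, pathRestrict, hi]

theorem pathRestrict_freeze (t : ℕ) (x : ∀ i, Ξ i) :
    pathRestrict t (freeze t x) = pathRestrict t x := by
  funext i
  exact agree_freeze t x i.val i.property

/-- The law of the beginning of the path before `t`. -/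
def frozenLaw (P : Measure (∀ i, Ξ i)) (t : ℕ) : Measure (∀ i, Ξ i) := P.map (freeze t)

instance (P : Measure (∀ i, Ξ i)) [IsProbabilityMeasure P] (t : ℕ) :
    IsProbabilityMeasure (frozenLaw P t) :=
  Measure.isProbabilityMeasure_map (measurable_freeze t).aemeasurable

theorem frozenLaw_of_le (P : Measure (∀ i, Ξ i)) {t : ℕ} (ht : T ≤ t) : frozenLaw P t = P := by
  have : (freeze t : (∀ i, Ξ i) → ∀ i, Ξ i) = id := funext fun x => freeze_of_le ht x
  rw [frozenLaw, this, Measure.map_id]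

variable [∀ i, StandardBorelSpace (Ξ i)]

/-- The regular conditional distributions of a coordinate given the past, as a kernel. -/
def pathKernel (P : Measure (∀ i, Ξ i)) [IsFiniteMeasure P] (i : Fin T) :
    Kernel (∀ i, Ξ i) (Ξ i) :=
  (condDistrib (fun y : ∀ i, Ξ i => y i) (pathRestrict i.val) P).comap (pathRestrict i.val)
    (measurable_pathRestrict _)

theorem pathKernel_apply (P : Measure (∀ i, Ξ i)) [IsFiniteMeasure P] (i : Fin T) (x : ∀ i, Ξ i) :
    pathKernel P i x = stageKernel P i x := rfl

instance (P : Measure (∀ i, Ξ i)) [IsFiniteMeasure P] (i : Fin T) :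
    IsMarkovKernel (pathKernel P i) := by
  unfold pathKernel
  infer_instance

/-- The joint law of the history and the next coordinate is the composition of the law of the
history with the conditional distribution, here written on whole paths with an arbitrary constant
tail. -/
theorem frozenLaw_succ (P : Measure (∀ i, Ξ i)) [IsProbabilityMeasure P] {t : ℕ} (h : t < T) :
    frozenLaw P (t + 1) = ((frozenLaw P t) ⊗ₘ (pathKernel P ⟨t, h⟩)).map
      fun z => freeze (t + 1) (Function.update z.1 ⟨t, h⟩ z.2) := by
  refine Measure.ext_of_lintegral _ fun g hg => ?_
  have hup : Measurable fun z : (∀ i, Ξ i) × Ξ ⟨t, h⟩ =>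
      freeze (t + 1) (Function.update z.1 ⟨t, h⟩ z.2) :=
    (measurable_freeze _).comp (measurable_update_prod _)
  have hgu : Measurable fun z : (∀ i, Ξ i) × Ξ ⟨t, h⟩ =>
      g (freeze (t + 1) (Function.update z.1 ⟨t, h⟩ z.2)) := hg.comp hup
  rw [lintegral_map hg hup, Measure.lintegral_compProd hgu, frozenLaw, frozenLaw,
    lintegral_map hg (measurable_freeze _),
    lintegral_map hgu.lintegral_kernel_prod_right' (measurable_freeze _)]
  have hdis := compProd_map_condDistrib (mβ := inferInstance) (μ := P)
    (X := pathRestrict t) (Y := fun y : ∀ i, Ξ i => y ⟨t, h⟩)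
    (measurable_pi_apply _).aemeasurable
  set Φ : (∀ i : {i : Fin T // i.val < t}, Ξ i.val) × Ξ ⟨t, h⟩ → ℝ≥0∞ := fun a =>
    g (freeze (t + 1) (Function.update (extendPath t a.1) ⟨t, h⟩ a.2)) with hΦ
  have hΦm : Measurable Φ := hgu.comp
    (((measurable_extendPath t).comp measurable_fst).prodMk measurable_snd)
  have h1 : ∀ x : ∀ i, Ξ i, g (freeze (t + 1) x) = Φ (pathRestrict t x, x ⟨t, h⟩) := by
    -- Freezing `x` at `t` and restoring its coordinate `t` recovers the history before `t + 1`.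
    intro x
    simp only [hΦ, extendPath_pathRestrict]
    congr 1
    refine Agree.freeze_eq ?_
    have := (agree_freeze t x).symm.update h (x ⟨t, h⟩)
    rwa [Function.update_eq_self] at this
  simp only [h1]
  have h2 : ∫⁻ x, Φ (pathRestrict t x, x ⟨t, h⟩) ∂P =
      ∫⁻ a, Φ a ∂(P.map fun x => (pathRestrict t x, x ⟨t, h⟩)) :=
    (lintegral_map hΦm ((measurable_pathRestrict t).prodMk (measurable_pi_apply _))).symm
  rw [h2, ← hdis, Measure.lintegral_compProd hΦm,
    lintegral_map hΦm.lintegral_kernel_prod_right' (measurable_pathRestrict t)]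
  refine lintegral_congr fun x => ?_
  have h3 : pathKernel P ⟨t, h⟩ (freeze t x) =
      condDistrib (fun y : ∀ i, Ξ i => y ⟨t, h⟩) (pathRestrict t) P (pathRestrict t x) := by
    rw [pathKernel_apply, stageKernel]
    simp only [pathRestrict_freeze]
  rw [h3]
  refine lintegral_congr fun u => ?_
  rw [← h1]
  simp only [hΦ, extendPath_pathRestrict]

theorem lintegral_frozenLaw_succ (P : Measure (∀ i, Ξ i)) [IsProbabilityMeasure P] {t : ℕ}
    (h : t < T) {g : (∀ i, Ξ i) → ℝ≥0∞} (hg : Measurable g) :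
    ∫⁻ x, g x ∂frozenLaw P (t + 1) =
      ∫⁻ x, ∫⁻ u, g (freeze (t + 1) (Function.update x ⟨t, h⟩ u)) ∂stageKernel P ⟨t, h⟩ x
        ∂frozenLaw P t := by
  have hup : Measurable fun z : (∀ i, Ξ i) × Ξ ⟨t, h⟩ =>
      freeze (t + 1) (Function.update z.1 ⟨t, h⟩ z.2) :=
    (measurable_freeze _).comp (measurable_update_prod _)
  rw [frozenLaw_succ P h, lintegral_map hg hup]
  exact Measure.lintegral_compProd (f := fun z : (∀ i, Ξ i) × Ξ ⟨t, h⟩ =>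
    g (freeze (t + 1) (Function.update z.1 ⟨t, h⟩ z.2))) (hg.comp hup)

theorem ae_of_ae_frozenLaw_succ (P : Measure (∀ i, Ξ i)) [IsProbabilityMeasure P] {t : ℕ}
    (h : t < T) {p : (∀ i, Ξ i) → Prop} (hp : ∀ᵐ x ∂frozenLaw P (t + 1), p x) :
    ∀ᵐ x ∂frozenLaw P t, ∀ᵐ u ∂stageKernel P ⟨t, h⟩ x,
      p (freeze (t + 1) (Function.update x ⟨t, h⟩ u)) := by
  have hup : Measurable fun z : (∀ i, Ξ i) × Ξ ⟨t, h⟩ =>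
      freeze (t + 1) (Function.update z.1 ⟨t, h⟩ z.2) :=
    (measurable_freeze _).comp (measurable_update_prod _)
  rw [frozenLaw_succ P h] at hp
  have h2 := ae_of_ae_map hup.aemeasurable hp
  have h3 := Measure.ae_ae_of_ae_compProd h2
  filter_upwards [h3] with x hx
  rwa [← pathKernel_apply]

/-- The iterated mean along the conditional distributions of `P`. -/
abbrev pathMean (P : Measure (∀ i, Ξ i)) [IsFiniteMeasure P] (f : (∀ i, Ξ i) → ℝ≥0∞) (t : ℕ) :
    (∀ i, Ξ i) → ℝ≥0∞ :=
  iterMean (pathKernel P) (fun i x u => Function.update x i u) f t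

theorem pathMean_congr (P : Measure (∀ i, Ξ i)) [IsFiniteMeasure P] (f : (∀ i, Ξ i) → ℝ≥0∞)
    (t : ℕ) {x x' : ∀ i, Ξ i} (hx : Agree t x x') : pathMean P f t x = pathMean P f t x' :=
  iterMean_congr_rel (rel := Agree) (fun t h x x' hx => stageKernel_congr P ⟨t, h⟩ hx)
    (fun t h x x' u hx => hx.update h u) (fun t h x x' hx => by rw [hx.eq h]) t x x' hx

theorem measurable_pathMean (P : Measure (∀ i, Ξ i)) [IsFiniteMeasure P] {f : (∀ i, Ξ i) → ℝ≥0∞}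
    (hf : Measurable f) (t : ℕ) : Measurable (pathMean P f t) :=
  measurable_iterMean measurable_update_prod hf t

/-- The tower property of iterated conditional expectations. -/
theorem lintegral_pathMean_frozenLaw (P : Measure (∀ i, Ξ i)) [IsProbabilityMeasure P]
    {f : (∀ i, Ξ i) → ℝ≥0∞} (hf : Measurable f) (t : ℕ) :
    ∫⁻ y, pathMean P f t y ∂frozenLaw P t = ∫⁻ y, f y ∂P := by
  refine downward_induction (T := T)
    (p := fun t => ∫⁻ y, pathMean P f t y ∂frozenLaw P t = ∫⁻ y, f y ∂P)
    (fun t h => ?_) (fun t h ih => ?_) t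
  · rw [frozenLaw_of_le P h, pathMean, iterMean_of_le h]
  · rw [← ih, lintegral_frozenLaw_succ P h (measurable_pathMean P hf _)]
    refine lintegral_congr fun y => ?_
    rw [pathMean, iterMean_of_lt h]
    exact lintegral_congr fun u => pathMean_congr P f (t + 1) (agree_freeze _ _).symm

theorem pathMean_zero (P : Measure (∀ i, Ξ i)) [IsProbabilityMeasure P] {f : (∀ i, Ξ i) → ℝ≥0∞}
    (hf : Measurable f) (x : ∀ i, Ξ i) : pathMean P f 0 x = ∫⁻ y, f y ∂P := by
  rw [← lintegral_pathMean_frozenLaw P hf 0]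
  have h0 : ∀ y, pathMean P f 0 y = pathMean P f 0 x := fun y =>
    pathMean_congr P f 0 fun j hj => absurd hj (Nat.not_lt_zero _)
  simp only [h0, lintegral_const, measure_univ, mul_one]

theorem ae_freeze_eq (P : Measure (∀ i, Ξ i)) (t : ℕ) :
    ∀ᵐ x ∂frozenLaw P t, freeze t x = x := by
  refine (ae_map_iff (measurable_freeze t).aemeasurable
    (measurableSet_eq_fun (measurable_freeze t) measurable_id)).2 ?_
  exact Filter.Eventually.of_forall fun x => freeze_freeze t x

end Paths

/-! ### Nearly optimal couplings for the nested distance -/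

section NestedCouplings

variable {T : ℕ} {Ξ : Fin T → Type*} [∀ i, Nonempty (Ξ i)] [∀ i, MeasurableSpace (Ξ i)]
  [∀ i, StandardBorelSpace (Ξ i)] {P P' : Measure (∀ i, Ξ i)} [IsProbabilityMeasure P]
  [IsProbabilityMeasure P'] {r : ℝ} {c : (∀ i, Ξ i) → (∀ i, Ξ i) → ℝ≥0∞}
  {f g : (∀ i, Ξ i) → ℝ≥0∞}

/-- One stage of a pair of paths. -/
def pairStep (i : Fin T) (z : (∀ i, Ξ i) × (∀ i, Ξ i)) (w : Ξ i × Ξ i) :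
    (∀ i, Ξ i) × (∀ i, Ξ i) :=
  (Function.update z.1 i w.1, Function.update z.2 i w.2)

theorem measurable_pairStep (i : Fin T) :
    Measurable fun s : ((∀ i, Ξ i) × (∀ i, Ξ i)) × (Ξ i × Ξ i) => pairStep i s.1 s.2 :=
  ((measurable_update_prod i).comp (f := fun s : ((∀ i, Ξ i) × (∀ i, Ξ i)) × (Ξ i × Ξ i) =>
    (s.1.1, s.2.1)) (by fun_prop)).prodMk
    ((measurable_update_prod i).comp (f := fun s : ((∀ i, Ξ i) × (∀ i, Ξ i)) × (Ξ i × Ξ i) =>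
    (s.1.2, s.2.2)) (by fun_prop))

instance (P : Measure (∀ i, Ξ i)) [IsFiniteMeasure P] (i : Fin T) (x : ∀ i, Ξ i) :
    IsProbabilityMeasure (stageKernel P i x) := by
  rw [← pathKernel_apply]
  infer_instance

/-- The power is an order isomorphism of `[0, ∞]`, so it passes through the infimum over couplings
and leaves a cost linear in the coupling. -/
theorem costProcess_rpow (hr : 1 ≤ r) {t : ℕ} (h : t < T) (x y : ∀ i, Ξ i) :
    costProcess r c P P' t x y ^ r =
      ⨅ (π : Measure (Ξ ⟨t, h⟩ × Ξ ⟨t, h⟩))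
        (_ : IsCoupling (stageKernel P ⟨t, h⟩ x) (stageKernel P' ⟨t, h⟩ y) π),
        ∫⁻ z, costProcess r c P P' (t + 1) (Function.update x ⟨t, h⟩ z.1)
          (Function.update y ⟨t, h⟩ z.2) ^ r ∂π := by
  have hr0 : 0 < r := by positivity
  rw [costProcess, dif_pos h]
  simp only [wasserstein]
  have e : ∀ s : ℝ≥0∞, s ^ r = ENNReal.orderIsoRpow r hr0 s := fun s => rfl
  rw [e, OrderIso.map_iInf]
  refine iInf_congr fun π => ?_
  rw [OrderIso.map_iInf]
  refine iInf_congr fun _ => ?_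
  rw [← e, ← ENNReal.rpow_mul, one_div_mul_cancel hr0.ne', ENNReal.rpow_one]

variable (P P' r c f g) in
/-- The cost process is, on the paths where the bounds are finite, an infimum of rectangle
functions dominated by the iterated means of the bounds. -/
def HasRectVersion (t : ℕ) : Prop :=
  ∃ R : (∀ i, Ξ i) → (∀ i, Ξ i) → ℝ≥0∞, IsRectInf R ∧
    (∀ x y, R x y ≤ pathMean P f t x + pathMean P' g t y) ∧
    ∀ x y, pathMean P f t x ≠ ∞ → pathMean P' g t y ≠ ∞ → R x y = costProcess r c P P' t x y ^ r

theorem lintegral_coupling_add {X Y : Type*} [MeasurableSpace X] [MeasurableSpace Y]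
    {μ : Measure X} {ν : Measure Y} {π : Measure (X × Y)} (hπ : IsCoupling μ ν π)
    {α : X → ℝ≥0∞} {β : Y → ℝ≥0∞} (hα : Measurable α) (hβ : Measurable β) :
    ∫⁻ z, (α z.1 + β z.2) ∂π = ∫⁻ x, α x ∂μ + ∫⁻ y, β y ∂ν := by
  have hα' : Measurable fun z : X × Y => α z.1 := hα.comp measurable_fst
  rw [lintegral_add_left hα', ← hπ.1, ← hπ.2,
    lintegral_map hα measurable_fst, lintegral_map hβ measurable_snd]

theorem IsCoupling.ae_fst {X Y : Type*} [MeasurableSpace X] [MeasurableSpace Y]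
    {μ : Measure X} {ν : Measure Y} {π : Measure (X × Y)} (hπ : IsCoupling μ ν π) {p : X → Prop}
    (hp : ∀ᵐ x ∂μ, p x) : ∀ᵐ z ∂π, p z.1 := by
  rw [← hπ.1] at hp
  exact ae_of_ae_map measurable_fst.aemeasurable hp

theorem IsCoupling.ae_snd {X Y : Type*} [MeasurableSpace X] [MeasurableSpace Y]
    {μ : Measure X} {ν : Measure Y} {π : Measure (X × Y)} (hπ : IsCoupling μ ν π) {p : Y → Prop}
    (hp : ∀ᵐ y ∂ν, p y) : ∀ᵐ z ∂π, p z.2 := by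
  rw [← hπ.2] at hp
  exact ae_of_ae_map measurable_snd.aemeasurable hp

theorem ae_pathMean_update_lt_top {P : Measure (∀ i, Ξ i)} [IsProbabilityMeasure P]
    {f : (∀ i, Ξ i) → ℝ≥0∞} (hf : Measurable f) {t : ℕ} (h : t < T) {x : ∀ i, Ξ i}
    (hx : pathMean P f t x ≠ ∞) :
    ∀ᵐ u ∂stageKernel P ⟨t, h⟩ x, pathMean P f (t + 1) (Function.update x ⟨t, h⟩ u) ≠ ∞ := by
  rw [pathMean, iterMean_of_lt h] at hx
  have hm : Measurable fun u => pathMean P f (t + 1) (Function.update x ⟨t, h⟩ u) :=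
    (measurable_pathMean P hf (t + 1)).comp
      ((measurable_update_prod ⟨t, h⟩).comp measurable_prodMk_left)
  exact (ae_lt_top hm hx).mono fun u hu => hu.ne

/-- The transport theorem is applied to the rectangle version of the next stage, with the iterated
means as separable bounds. Where these are finite, the version and the cost process agree almost
surely under every coupling, so both have the same transport value. -/
theorem HasRectVersion.stage (hr : 1 ≤ r) (hf : Measurable f) (hg : Measurable g) {t : ℕ}
    (h : t < T) (ih : HasRectVersion P P' r c f g (t + 1)) :
    HasRectVersion P P' r c f g t ∧ ∀ ε : ℝ≥0∞, ε ≠ 0 →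
      ∃ Γ : Kernel ((∀ i, Ξ i) × (∀ i, Ξ i)) (Ξ ⟨t, h⟩ × Ξ ⟨t, h⟩), IsMarkovKernel Γ ∧
        (∀ x y, IsCoupling (stageKernel P ⟨t, h⟩ x) (stageKernel P' ⟨t, h⟩ y) (Γ (x, y))) ∧
        (∀ x x' y y', Agree t x x' → Agree t y y' → Γ (x, y) = Γ (x', y')) ∧
        ∀ x y, pathMean P f t x ≠ ∞ → pathMean P' g t y ≠ ∞ →
          ∫⁻ z, costProcess r c P P' (t + 1) (Function.update x ⟨t, h⟩ z.1)
            (Function.update y ⟨t, h⟩ z.2) ^ r ∂Γ (x, y) ≤ costProcess r c P P' t x y ^ r + ε := by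
  obtain ⟨R, hR, hR1, hR2⟩ := ih
  have hα : Measurable fun z : (∀ i, Ξ i) × Ξ ⟨t, h⟩ =>
      pathMean P f (t + 1) (Function.update z.1 ⟨t, h⟩ z.2) :=
    (measurable_pathMean P hf (t + 1)).comp (measurable_update_prod _)
  have hβ : Measurable fun z : (∀ i, Ξ i) × Ξ ⟨t, h⟩ =>
      pathMean P' g (t + 1) (Function.update z.1 ⟨t, h⟩ z.2) :=
    (measurable_pathMean P' hg (t + 1)).comp (measurable_update_prod _)
  have eα : ∀ x, pathMean P f t x =
      ∫⁻ u, pathMean P f (t + 1) (Function.update x ⟨t, h⟩ u) ∂pathKernel P ⟨t, h⟩ x :=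
    fun x => iterMean_of_lt h x
  have eβ : ∀ y, pathMean P' g t y =
      ∫⁻ v, pathMean P' g (t + 1) (Function.update y ⟨t, h⟩ v) ∂pathKernel P' ⟨t, h⟩ y :=
    fun y => iterMean_of_lt h y
  obtain ⟨W, hW, hW1, hW2⟩ := exists_isRectInf_transport (pathKernel P ⟨t, h⟩)
    (pathKernel P' ⟨t, h⟩)
    (D := fun s w => R (Function.update s.1 ⟨t, h⟩ s.2) (Function.update w.1 ⟨t, h⟩ w.2))
    (hR.comp (measurable_update_prod ⟨t, h⟩) (measurable_update_prod ⟨t, h⟩)) hα hβ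
    fun s w => hR1 _ _
  -- on finite paths the rectangle version and the cost process have the same integrals
  have hcongr : ∀ x y, pathMean P f t x ≠ ∞ → pathMean P' g t y ≠ ∞ →
      ∀ π : Measure (Ξ ⟨t, h⟩ × Ξ ⟨t, h⟩),
        IsCoupling (stageKernel P ⟨t, h⟩ x) (stageKernel P' ⟨t, h⟩ y) π →
        ∫⁻ z, R (Function.update x ⟨t, h⟩ z.1) (Function.update y ⟨t, h⟩ z.2) ∂π =
          ∫⁻ z, costProcess r c P P' (t + 1) (Function.update x ⟨t, h⟩ z.1)
            (Function.update y ⟨t, h⟩ z.2) ^ r ∂π := by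
    intro x y hx hy π hπ
    refine lintegral_congr_ae ?_
    filter_upwards [hπ.ae_fst (ae_pathMean_update_lt_top hf h hx),
      hπ.ae_snd (ae_pathMean_update_lt_top hg h hy)] with z h1 h2
    exact hR2 _ _ h1 h2
  have hWc : ∀ x y, pathMean P f t x ≠ ∞ → pathMean P' g t y ≠ ∞ →
      W x y = costProcess r c P P' t x y ^ r := by
    intro x y hx hy
    rw [hW1 x y (by rwa [← eα]) (by rwa [← eβ]), costProcess_rpow hr h]
    exact iInf_congr fun π => iInf_congr fun hπ => hcongr x y hx hy π hπ
  refine ⟨⟨W, hW, fun x y => ?_, hWc⟩, fun ε hε => ?_⟩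
  · by_cases hx : pathMean P f t x = ∞
    · rw [hx, top_add]; exact le_top
    by_cases hy : pathMean P' g t y = ∞
    · rw [hy, add_top]; exact le_top
    rw [hW1 x y (by rwa [← eα]) (by rwa [← eβ])]
    -- The product coupling shows that the domination by the bounds is inherited.
    have hπ : IsCoupling (pathKernel P ⟨t, h⟩ x) (pathKernel P' ⟨t, h⟩ y)
        ((pathKernel P ⟨t, h⟩ x).prod (pathKernel P' ⟨t, h⟩ y)) :=
      ⟨Measure.map_fst_prod.trans (by simp), Measure.map_snd_prod.trans (by simp)⟩
    refine (iInf₂_le _ hπ).trans ((lintegral_mono fun z => hR1 _ _).trans (le_of_eq ?_))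
    rw [eα, eβ]
    exact lintegral_coupling_add hπ (hα.comp measurable_prodMk_left)
      (hβ.comp measurable_prodMk_left)
  · obtain ⟨Γ, hΓ, hΓ1, hΓ2⟩ := hW2 ε hε
    have hfm : Measurable fun z : (∀ i, Ξ i) × (∀ i, Ξ i) => (freeze t z.1, freeze t z.2) :=
      ((measurable_freeze t).comp measurable_fst).prodMk ((measurable_freeze t).comp measurable_snd)
    have hc1 : ∀ x y, IsCoupling (stageKernel P ⟨t, h⟩ x) (stageKernel P' ⟨t, h⟩ y)
        (Γ (freeze t x, freeze t y)) := by
      intro x y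
      have := hΓ1 (freeze t x) (freeze t y)
      rwa [pathKernel_apply, pathKernel_apply, stageKernel_congr P ⟨t, h⟩ (agree_freeze t x),
        stageKernel_congr P' ⟨t, h⟩ (agree_freeze t y)] at this
    -- The couplings are evaluated at frozen paths, which makes them depend on the histories only.
    refine ⟨Γ.comap _ hfm, inferInstance, hc1, fun x x' y y' hx hy => ?_, fun x y hx hy => ?_⟩
    · rw [Kernel.comap_apply, Kernel.comap_apply]
      simp only [hx.freeze_eq, hy.freeze_eq]
    · have hx' : pathMean P f t (freeze t x) ≠ ∞ := by
        rwa [pathMean_congr P f t (agree_freeze t x)]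
      have hy' : pathMean P' g t (freeze t y) ≠ ∞ := by
        rwa [pathMean_congr P' g t (agree_freeze t y)]
      have h1 := hΓ2 (freeze t x) (freeze t y)
      rw [hWc _ _ hx' hy', costProcess_congr r c P P' t _ x _ y (agree_freeze t x)
        (agree_freeze t y), hcongr _ _ hx' hy' _ (hΓ1 _ _)] at h1
      refine le_trans (le_of_eq (lintegral_congr fun z => ?_)) h1
      rw [costProcess_congr r c P P' (t + 1) _ _ _ _ ((agree_freeze t x).update h z.1).symm
        ((agree_freeze t y).update h z.2).symm]

theorem hasRectVersion (hr : 1 ≤ r) (hf : Measurable f) (hg : Measurable g)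
    (hc : IsRectInf fun x y => c x y ^ r) (hle : ∀ x y, c x y ^ r ≤ f x + g y) (t : ℕ) :
    HasRectVersion P P' r c f g t := by
  refine downward_induction (T := T) (fun t h => ?_) (fun t h ih => (ih.stage hr hf hg h).1) t
  have e : ∀ x y, costProcess r c P P' t x y = c x y := fun x y => by
    rw [costProcess, dif_neg (not_lt.2 h)]
  refine ⟨_, hc, fun x y => ?_, fun x y _ _ => by rw [e]⟩
  simpa only [pathMean, iterMean_of_le h] using hle x y

/-- Nearly optimal couplings of the conditional distributions, depending measurably on the
history. -/
theorem exists_nested_couplings (hr : 1 ≤ r) (hf : Measurable f) (hg : Measurable g)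
    (hc : IsRectInf fun x y => c x y ^ r) (hle : ∀ x y, c x y ^ r ≤ f x + g y)
    (hfi : ∫⁻ x, f x ∂P ≠ ∞) (hgi : ∫⁻ y, g y ∂P' ≠ ∞) {ε : ℝ≥0∞} (hε : ε ≠ 0) :
    ∃ Γ : ∀ i, Kernel ((∀ i, Ξ i) × (∀ i, Ξ i)) (Ξ i × Ξ i), (∀ i, IsMarkovKernel (Γ i)) ∧
      (∀ i x y, IsCoupling (stageKernel P i x) (stageKernel P' i y) (Γ i (x, y))) ∧
      (∀ (i : Fin T) x x' y y', Agree i.val x x' → Agree i.val y y' → Γ i (x, y) = Γ i (x', y')) ∧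
      ∀ x y, iterMean Γ pairStep (fun z => c z.1 z.2 ^ r) 0 (x, y) ≤
        costProcess r c P P' 0 x y ^ r + T * ε := by
  choose Γ hΓ hΓ1 hΓ2 hΓ3 using fun i : Fin T =>
    ((hasRectVersion (P := P) (P' := P') hr hf hg hc hle (i.val + 1)).stage hr hf hg i.isLt).2 ε hε
  refine ⟨Γ, hΓ, hΓ1, hΓ2, fun x y => ?_⟩
  -- Each remaining stage adds at most `ε`.
  have key : ∀ t, t ≤ T → ∀ x y, pathMean P f t x ≠ ∞ → pathMean P' g t y ≠ ∞ →
      iterMean Γ pairStep (fun z => c z.1 z.2 ^ r) t (x, y) ≤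
        costProcess r c P P' t x y ^ r + (T - t : ℕ) * ε := by
    refine downward_induction (T := T) (fun t h _ x y hx hy => ?_)
      (fun t h ih _ x y hx hy => ?_)
    · rw [iterMean_of_le h, costProcess, dif_neg (not_lt.2 h)]
      exact le_self_add
    · rw [iterMean_of_lt h]
      calc ∫⁻ w, iterMean Γ pairStep (fun z => c z.1 z.2 ^ r) (t + 1)
              (pairStep ⟨t, h⟩ (x, y) w) ∂Γ ⟨t, h⟩ (x, y)
          ≤ ∫⁻ w, (costProcess r c P P' (t + 1) (Function.update x ⟨t, h⟩ w.1)
              (Function.update y ⟨t, h⟩ w.2) ^ r + (T - (t + 1) : ℕ) * ε) ∂Γ ⟨t, h⟩ (x, y) := by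
            refine lintegral_mono_ae ?_
            filter_upwards [(hΓ1 ⟨t, h⟩ x y).ae_fst (ae_pathMean_update_lt_top hf h hx),
              (hΓ1 ⟨t, h⟩ x y).ae_snd (ae_pathMean_update_lt_top hg h hy)] with z h1 h2
            exact ih h _ _ h1 h2
        _ = ∫⁻ w, costProcess r c P P' (t + 1) (Function.update x ⟨t, h⟩ w.1)
              (Function.update y ⟨t, h⟩ w.2) ^ r ∂Γ ⟨t, h⟩ (x, y) + (T - (t + 1) : ℕ) * ε := by
            rw [lintegral_add_right _ measurable_const, lintegral_const, measure_univ, mul_one]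
        _ ≤ costProcess r c P P' t x y ^ r + ε + (T - (t + 1) : ℕ) * ε :=
            add_le_add (hΓ3 ⟨t, h⟩ x y hx hy) le_rfl
        _ = _ := by
            have : T - t = T - (t + 1) + 1 := by omega
            rw [this, add_assoc]
            push_cast
            ring
  have := key 0 (Nat.zero_le _) x y (by rwa [pathMean_zero P hf]) (by rwa [pathMean_zero P' hg])
  simpa using this

end NestedCouplings

/-! ### Measurable selection -/

section Selection

/-- Take the least point of each fibre. It is at most `c` exactly over the projection of a compact
set, which is closed. -/
theorem exists_measurable_section_of_isCompact {A : Type*} [TopologicalSpace A] [T2Space A]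
    [MeasurableSpace A] [OpensMeasurableSpace A] {K : Set (A × ℝ)} (hK : IsCompact K) :
    MeasurableSet (Prod.fst '' K) ∧ ∃ σ : A → ℝ, Measurable σ ∧
      ∀ a ∈ Prod.fst '' K, (a, σ a) ∈ K := by
  classical
  have hpm : ∀ {K : Set (A × ℝ)}, IsCompact K → MeasurableSet (Prod.fst '' K) := fun h =>
    (h.image continuous_fst).isClosed.measurableSet
  have hmem : ∀ a ∈ Prod.fst '' K, IsLeast (Prod.mk a ⁻¹' K) (sInf (Prod.mk a ⁻¹' K)) := by
    rintro a ⟨⟨a', v⟩, hv, rfl⟩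
    have hc : IsCompact (Prod.mk a' ⁻¹' K) := by
      have e : Prod.mk a' ⁻¹' K = Prod.snd '' (K ∩ Prod.fst ⁻¹' {a'}) := by
        ext w
        constructor
        · intro hw
          exact ⟨(a', w), ⟨hw, rfl⟩, rfl⟩
        · rintro ⟨⟨b, w'⟩, ⟨h1, h2⟩, h3⟩
          obtain rfl : b = a' := h2
          obtain rfl : w' = w := h3
          exact h1
      rw [e]
      exact (hK.inter_right (isClosed_singleton.preimage continuous_fst)).image continuous_snd
    exact hc.isLeast_sInf ⟨v, hv⟩
  refine ⟨hpm hK, fun a => if a ∈ Prod.fst '' K then sInf (Prod.mk a ⁻¹' K) else 0, ?_, ?_⟩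
  · refine measurable_of_Iic fun c => ?_
    have e : (fun a => if a ∈ Prod.fst '' K then sInf (Prod.mk a ⁻¹' K) else 0) ⁻¹' Iic c =
        (Prod.fst '' (K ∩ Prod.snd ⁻¹' Iic c)) ∪ ((Prod.fst '' K)ᶜ ∩ {_a | (0 : ℝ) ≤ c}) := by
      ext a
      by_cases ha : a ∈ Prod.fst '' K
      · simp only [mem_preimage, mem_union, mem_inter_iff, mem_compl_iff, ha,
          not_true_eq_false, false_and, or_false, mem_Iic]
        constructor
        · intro h
          exact ⟨(a, sInf (Prod.mk a ⁻¹' K)), ⟨(hmem a ha).1, h⟩, rfl⟩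
        · rintro ⟨⟨b, w⟩, ⟨h1, h2⟩, rfl⟩
          exact ((hmem b ha).2 h1).trans h2
      · have h2 : a ∉ Prod.fst '' (K ∩ Prod.snd ⁻¹' Iic c) := fun ⟨z, hz, e⟩ => ha ⟨z, hz.1, e⟩
        simp only [mem_preimage, ↓reduceIte, mem_union, mem_inter_iff, mem_compl_iff, ha, h2,
          not_false_eq_true, true_and, false_or, mem_Iic, mem_ofPred_eq]
    rw [e]
    exact (hpm (hK.inter_right (isClosed_Iic.preimage continuous_snd))).union
      ((hpm hK).compl.inter (MeasurableSet.const _))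
  · intro a ha
    simp only [if_pos ha]
    exact (hmem a ha).1

/-- A measurable set has a measurable section over almost all points of its projection. -/
theorem exists_measurable_section {A V : Type*} [MeasurableSpace A] [StandardBorelSpace A]
    [MeasurableSpace V] [StandardBorelSpace V] [Nonempty V] (m : Measure (A × V))
    [IsFiniteMeasure m] {B : Set (A × V)} (hB : MeasurableSet B) :
    ∃ s : A → V, Measurable s ∧ ∀ᵐ z ∂m, z ∈ B → (z.1, s z.1) ∈ B := by
  classical
  let _ := upgradeStandardBorel A
  have he := measurableEmbedding_embeddingReal V
  set e := embeddingReal V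
  set φ : A × V → A × ℝ := Prod.map id e with hφ
  have hφe : MeasurableEmbedding φ := MeasurableEmbedding.id.prodMap he
  have hB' : MeasurableSet (φ '' B) := hφe.measurableSet_image.2 hB
  -- With `V` embedded in the real line, inner regularity exhausts the set by compact ones up to a
  -- null set; each of them has a measurable section.
  have hcomp : ∀ n : ℕ, ∃ K ⊆ φ '' B, IsCompact K ∧
      m.map φ (φ '' B) < m.map φ K + ((n : ℝ≥0∞) + 1)⁻¹ := fun n =>
    hB'.exists_isCompact_lt_add (measure_ne_top _ _) (ENNReal.inv_ne_zero.2 (by simp))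
  choose K hKB hK hKm using hcomp
  choose hpm σ hσ hσK using fun n => exists_measurable_section_of_isCompact (hK n)
  -- The second alternative makes the search for an index succeed at points over no compact set;
  -- these carry no mass of `B`.
  set p : ℕ → A → Prop := fun n a => a ∈ Prod.fst '' K n ∨ ∀ j, a ∉ Prod.fst '' K j with hp
  have hpms : ∀ n, MeasurableSet {a | p n a} := by
    intro n
    have e : {a | p n a} = (Prod.fst '' K n) ∪ ⋂ j, (Prod.fst '' K j)ᶜ := by
      ext a
      simp only [hp, mem_ofPred_eq, mem_union, mem_iInter, mem_compl_iff]
    rw [e]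
    exact (hpm n).union (MeasurableSet.iInter fun j => (hpm j).compl)
  have hex : ∀ a, ∃ n, p n a := by
    intro a
    by_cases h : ∃ n, a ∈ Prod.fst '' K n
    · obtain ⟨n, hn⟩ := h
      exact ⟨n, Or.inl hn⟩
    · exact ⟨0, Or.inr fun j hj => h ⟨j, hj⟩⟩
  have hm := Measurable.find hσ hpms hex
  set τ : A → ℝ := fun a => σ (Nat.find (hex a)) a with hτ
  refine ⟨fun a => he.invFun (τ a), he.measurable_invFun.comp hm, ?_⟩
  have hτB : ∀ a, (∃ n, a ∈ Prod.fst '' K n) → (a, he.invFun (τ a)) ∈ B := by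
    rintro a ⟨n, hn⟩
    have h1 : a ∈ Prod.fst '' K (Nat.find (hex a)) :=
      (Nat.find_spec (hex a)).resolve_right fun h => h n hn
    obtain ⟨⟨b, v⟩, hbv, hb⟩ := hKB _ (hσK _ a h1)
    have h2 : b = a := congrArg Prod.fst hb
    have h3 : e v = τ a := congrArg Prod.snd hb
    rw [← h3, he.leftInverse_invFun v, ← h2]
    exact hbv
  have hnull : m (B ∩ {z | ∀ n, z.1 ∉ Prod.fst '' K n}) = 0 := by
    refine le_antisymm (ENNReal.le_of_forall_pos_le_add fun ε hε _ => ?_) zero_le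
    obtain ⟨n, hn⟩ := ENNReal.exists_inv_nat_lt (ENNReal.coe_pos.2 hε).ne'
    have h1 : m (B ∩ {z | ∀ n, z.1 ∉ Prod.fst '' K n}) ≤ m.map φ (φ '' B \ K n) := by
      rw [hφe.map_apply]
      refine measure_mono ?_
      rintro z ⟨hz, hzn⟩
      exact ⟨⟨z, hz, rfl⟩, fun h => hzn n ⟨φ z, h, rfl⟩⟩
    have h2 : m.map φ (φ '' B \ K n) ≤ ((n : ℝ≥0∞) + 1)⁻¹ := by
      rw [measure_sdiff (hKB n) (hK n).isClosed.measurableSet.nullMeasurableSet (measure_ne_top _ _)]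
      exact tsub_le_iff_left.2 (hKm n).le
    rw [zero_add]
    exact (h1.trans h2).trans ((ENNReal.inv_le_inv.2 le_self_add).trans hn.le)
  have : ∀ᵐ z ∂m, z ∉ B ∩ {z | ∀ n, z.1 ∉ Prod.fst '' K n} := measure_eq_zero_iff_ae_notMem.1 hnull
  filter_upwards [this] with z hz hzB
  refine hτB z.1 ?_
  by_contra h
  exact hz ⟨hzB, fun n hn => h ⟨n, hn⟩⟩

/-- There is a measurable choice of points at which a function does not exceed its mean. -/
theorem exists_measurable_le_lintegral {A V : Type*} [MeasurableSpace A] [StandardBorelSpace A]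
    [MeasurableSpace V] [StandardBorelSpace V] [Nonempty V] (m : Measure A) [IsFiniteMeasure m]
    (ρ : Kernel A V) [IsMarkovKernel ρ] {F : A × V → ℝ≥0∞} (hF : Measurable F) :
    ∃ s : A → V, Measurable s ∧ ∀ᵐ a ∂m, F (a, s a) ≤ ∫⁻ v, F (a, v) ∂ρ a := by
  have hmean : Measurable fun a => ∫⁻ v, F (a, v) ∂ρ a := hF.lintegral_kernel_prod_right'
  set B : Set (A × V) := {z | F z ≤ ∫⁻ v, F (z.1, v) ∂ρ z.1} with hB
  have hBm : MeasurableSet B := measurableSet_le hF (hmean.comp measurable_fst)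
  obtain ⟨s, hs, h⟩ := exists_measurable_section (m ⊗ₘ ρ) hBm
  refine ⟨s, hs, ?_⟩
  filter_upwards [Measure.ae_ae_of_ae_compProd h] with a ha
  -- A function does not exceed its mean on a set of positive probability, so the almost sure
  -- property of the section can be used at some `v`.
  have hpos : ρ a {v | F (a, v) ≤ ∫⁻ w, F (a, w) ∂ρ a} ≠ 0 := by
    by_cases hfin : ∫⁻ w, F (a, w) ∂ρ a = ∞
    · rw [hfin]
      simp
    · exact (measure_le_lintegral_pos (hF.comp measurable_prodMk_left).aemeasurable).ne'
  by_contra hc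
  refine hpos (measure_mono_null ?_ ha)
  intro v hv
  exact fun h => hc (h hv)

end Selection

/-! ### The risk process -/

section RiskProcess

/-- The product of the bounds `k i` over the stages after time `t`. -/
def tailProd {T : ℕ} (k : Fin T → ℝ≥0) (t : ℕ) : ℝ≥0 :=
  ∏ i ∈ Finset.univ.filter (fun i : Fin T => t ≤ i.val), k i

theorem tailProd_of_le {T : ℕ} (k : Fin T → ℝ≥0) {t : ℕ} (h : T ≤ t) : tailProd k t = 1 := by
  refine Finset.prod_eq_one fun i hi => ?_
  have := (Finset.mem_filter.1 hi).2
  exact absurd i.isLt (by omega)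

theorem tailProd_of_lt {T : ℕ} (k : Fin T → ℝ≥0) {t : ℕ} (h : t < T) :
    tailProd k t = k ⟨t, h⟩ * tailProd k (t + 1) := by
  have e : Finset.univ.filter (fun i : Fin T => t ≤ i.val) =
      insert ⟨t, h⟩ (Finset.univ.filter fun i : Fin T => t + 1 ≤ i.val) := by
    ext i
    simp only [Finset.mem_filter, Finset.mem_univ, true_and, Finset.mem_insert, Fin.ext_iff]
    omega
  rw [tailProd, e, Finset.prod_insert (by simp), tailProd]

theorem tailProd_zero {T : ℕ} (k : Fin T → ℝ≥0) : tailProd k 0 = ∏ i, k i := by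
  simp [tailProd]

variable {T : ℕ} {Ξ : Fin T → Type*} [∀ i, Nonempty (Ξ i)] [∀ i, MeasurableSpace (Ξ i)]
  [∀ i, StandardBorelSpace (Ξ i)] {P : Measure (∀ i, Ξ i)} [IsProbabilityMeasure P]
  {r : ℝ} {q : ℝ≥0∞} {S : Fin T → Set (ℝ → ℝ)} {k : Fin T → ℝ≥0}

/-- The iterated `L^r`-norm along the conditional distributions of `P`. -/
abbrev pathNorm (r : ℝ) (P : Measure (∀ i, Ξ i)) [IsFiniteMeasure P] (f : (∀ i, Ξ i) → ℝ≥0∞)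
    (t : ℕ) : (∀ i, Ξ i) → ℝ≥0∞ :=
  iterNorm r (pathKernel P) (fun i x u => Function.update x i u) f t

theorem riskProcess_of_lt (Y : (∀ i, Ξ i) → ℝ) {t : ℕ} (h : t < T) (x : ∀ i, Ξ i) :
    riskProcess S P Y t x = riskFunctional (S ⟨t, h⟩) (stageKernel P ⟨t, h⟩ x)
      (fun u => riskProcess S P Y (t + 1) (Function.update x ⟨t, h⟩ u)) := by
  rw [riskProcess, dif_pos h]

theorem riskProcess_of_le (Y : (∀ i, Ξ i) → ℝ) {t : ℕ} (h : T ≤ t) :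
    riskProcess S P Y t = Y := by
  rw [riskProcess, dif_neg (not_lt.2 h)]

theorem powMean_enorm_toReal_le {x : ℝ} {a : ℝ≥0∞} {k : ℝ≥0} (ha : a ≠ ∞)
    (h : |x| ≤ k * a.toReal) : ‖x‖ₑ ≤ k * a := by
  rw [Real.enorm_eq_ofReal_abs]
  refine (ENNReal.ofReal_le_ofReal h).trans (le_of_eq ?_)
  rw [ENNReal.ofReal_mul k.coe_nonneg, ENNReal.ofReal_toReal ha, ENNReal.ofReal_coe_nnreal]

/-- The risk process is finite and has a measurable version where the iterated norm is finite. -/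
theorem exists_measurable_riskProcess (hr : 1 ≤ r) (hq : (ENNReal.ofReal r)⁻¹ + q⁻¹ = 1)
    (hS : ∀ i, IsBoundedFamily q (S i) (k i)) {Y : (∀ i, Ξ i) → ℝ} (hY : Measurable Y) (t : ℕ) :
    ∃ G : (∀ i, Ξ i) → ℝ, Measurable G ∧ ∀ x, pathNorm r P (fun x => ‖Y x‖ₑ) t x ≠ ∞ →
      G x = riskProcess S P Y t x ∧
      ‖(riskProcess S P Y t x)‖ₑ ≤ tailProd k t * pathNorm r P (fun x => ‖Y x‖ₑ) t x := by
  refine downward_induction (T := T) (p := fun t =>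
    ∃ G : (∀ i, Ξ i) → ℝ, Measurable G ∧ ∀ x, pathNorm r P (fun x => ‖Y x‖ₑ) t x ≠ ∞ →
      G x = riskProcess S P Y t x ∧
      ‖(riskProcess S P Y t x)‖ₑ ≤ tailProd k t * pathNorm r P (fun x => ‖Y x‖ₑ) t x)
    (fun t h => ?_) (fun t h ih => ?_) t
  · refine ⟨Y, hY, fun x _ => ?_⟩
    rw [riskProcess_of_le Y h, tailProd_of_le k h, pathNorm, iterNorm_of_le hr h]
    simp
  · obtain ⟨G, hG, hG'⟩ := ih
    -- The measurable version of the next stage may replace the process itself, since the two agree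
    -- almost surely under the conditional law.
    obtain ⟨F, hF, hF'⟩ := exists_measurable_riskFunctional hr hq (hS ⟨t, h⟩) (pathKernel P ⟨t, h⟩)
      (hG.comp (measurable_update_prod ⟨t, h⟩))
    refine ⟨F, hF, fun x hx => ?_⟩
    have hN : pathNorm r P (fun x => ‖Y x‖ₑ) t x = powMean r (stageKernel P ⟨t, h⟩ x) fun u =>
        pathNorm r P (fun x => ‖Y x‖ₑ) (t + 1) (Function.update x ⟨t, h⟩ u) :=
      iterNorm_of_lt hr h x
    have hup : Measurable fun u : Ξ ⟨t, h⟩ => Function.update x ⟨t, h⟩ u :=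
      (measurable_update_prod ⟨t, h⟩).comp measurable_prodMk_left
    have hNm : Measurable fun u : Ξ ⟨t, h⟩ =>
        pathNorm r P (fun x => ‖Y x‖ₑ) (t + 1) (Function.update x ⟨t, h⟩ u) :=
      (measurable_iterNorm measurable_update_prod hY.enorm (t + 1)).comp hup
    have hfin := ae_lt_top_of_powMean hr hNm.aemeasurable (hN ▸ hx)
    have hae : ∀ᵐ u ∂stageKernel P ⟨t, h⟩ x, G (Function.update x ⟨t, h⟩ u) =
        riskProcess S P Y (t + 1) (Function.update x ⟨t, h⟩ u) := by
      filter_upwards [hfin] with u hu using (hG' _ hu.ne).1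
    have hpow : powMean r (stageKernel P ⟨t, h⟩ x)
        (fun u => ‖G (Function.update x ⟨t, h⟩ u)‖ₑ) ≤
          tailProd k (t + 1) * pathNorm r P (fun x => ‖Y x‖ₑ) t x := by
      rw [hN, ← powMean_const_mul hr ENNReal.coe_ne_top]
      refine powMean_mono_ae hr ?_
      filter_upwards [hfin] with u hu
      rw [(hG' _ hu.ne).1]
      exact (hG' _ hu.ne).2
    have hpowf : powMean r (stageKernel P ⟨t, h⟩ x)
        (fun u => ‖G (Function.update x ⟨t, h⟩ u)‖ₑ) ≠ ∞ :=
      ne_top_of_le_ne_top (ENNReal.mul_ne_top ENNReal.coe_ne_top hx) hpow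
    have hR : riskProcess S P Y t x = riskFunctional (S ⟨t, h⟩) (stageKernel P ⟨t, h⟩ x)
        fun u => G (Function.update x ⟨t, h⟩ u) := by
      rw [riskProcess_of_lt Y h]
      exact (riskFunctional_congr_ae hae).symm
    refine ⟨?_, ?_⟩
    · rw [hR]
      exact hF' x hpowf
    · have hmem : MemLp (fun u => G (Function.update x ⟨t, h⟩ u)) (ENNReal.ofReal r)
          (stageKernel P ⟨t, h⟩ x) :=
        (memLp_iff_powMean hr (hG.comp hup).aestronglyMeasurable).2 hpowf
      rw [hR]
      refine (powMean_enorm_toReal_le hpowf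
        (abs_riskFunctional_le hr hq (hS ⟨t, h⟩) hmem)).trans ?_
      rw [tailProd_of_lt k h, ENNReal.coe_mul, mul_assoc]
      exact mul_le_mul_right hpow _

theorem memLp_riskProcess_update (hr : 1 ≤ r) (hq : (ENNReal.ofReal r)⁻¹ + q⁻¹ = 1)
    (hS : ∀ i, IsBoundedFamily q (S i) (k i)) {Y : (∀ i, Ξ i) → ℝ} (hY : Measurable Y) {t : ℕ}
    (h : t < T) {x : ∀ i, Ξ i} (hx : pathNorm r P (fun x => ‖Y x‖ₑ) t x ≠ ∞) :
    MemLp (fun u => riskProcess S P Y (t + 1) (Function.update x ⟨t, h⟩ u)) (ENNReal.ofReal r)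
      (stageKernel P ⟨t, h⟩ x) := by
  obtain ⟨G, hG, hG'⟩ := exists_measurable_riskProcess (P := P) hr hq hS hY (t + 1)
  have hN : pathNorm r P (fun x => ‖Y x‖ₑ) t x = powMean r (stageKernel P ⟨t, h⟩ x) fun u =>
      pathNorm r P (fun x => ‖Y x‖ₑ) (t + 1) (Function.update x ⟨t, h⟩ u) :=
    iterNorm_of_lt hr h x
  have hup : Measurable fun u : Ξ ⟨t, h⟩ => Function.update x ⟨t, h⟩ u :=
    (measurable_update_prod ⟨t, h⟩).comp measurable_prodMk_left
  have hNm : Measurable fun u : Ξ ⟨t, h⟩ =>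
      pathNorm r P (fun x => ‖Y x‖ₑ) (t + 1) (Function.update x ⟨t, h⟩ u) :=
    (measurable_iterNorm measurable_update_prod hY.enorm (t + 1)).comp hup
  have hfin := ae_lt_top_of_powMean hr hNm.aemeasurable (hN ▸ hx)
  have hae : ∀ᵐ u ∂stageKernel P ⟨t, h⟩ x, G (Function.update x ⟨t, h⟩ u) =
      riskProcess S P Y (t + 1) (Function.update x ⟨t, h⟩ u) := by
    filter_upwards [hfin] with u hu using (hG' _ hu.ne).1
  refine (memLp_iff_powMean hr ((hG.comp hup).aestronglyMeasurable.congr hae)).2 ?_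
  refine ne_top_of_le_ne_top (ENNReal.mul_ne_top (ENNReal.coe_ne_top (r := tailProd k (t + 1))) hx)
    ?_
  rw [hN, ← powMean_const_mul hr ENNReal.coe_ne_top]
  refine powMean_mono_ae hr ?_
  filter_upwards [hfin] with u hu
  exact (hG' _ hu.ne).2

end RiskProcess

/-! ### Upper bounds for the transferred risk -/

section RiskBound

theorem lintegral_le_powMean {Ω : Type*} [MeasurableSpace Ω] {μ : Measure Ω}
    [IsProbabilityMeasure μ] {r : ℝ} (hr : 1 ≤ r) {f : Ω → ℝ≥0∞} (hf : AEMeasurable f μ) :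
    ∫⁻ ω, f ω ∂μ ≤ powMean r μ f := by
  have h1 : (1 : ℝ≥0∞) ≤ ENNReal.ofReal r := by rwa [ENNReal.one_le_ofReal]
  have h := eLpNorm_le_eLpNorm_of_exponent_le h1 hf.aestronglyMeasurable
  have h0 : ENNReal.ofReal r ≠ 0 := (zero_lt_one.trans_le h1).ne'
  rw [eLpNorm_one_eq_lintegral_enorm, eLpNorm_eq_lintegral_rpow_enorm_toReal h0
    ENNReal.ofReal_ne_top, ENNReal.toReal_ofReal (by positivity)] at h
  simpa [powMean] using h

theorem lintegral_rpow_le_lintegral {Ω : Type*} [MeasurableSpace Ω] {μ : Measure Ω}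
    [IsProbabilityMeasure μ] {r : ℝ} (hr : 1 ≤ r) {f : Ω → ℝ≥0∞} (hf : AEMeasurable f μ) :
    (∫⁻ ω, f ω ∂μ) ^ r ≤ ∫⁻ ω, f ω ^ r ∂μ := by
  rw [← powMean_rpow hr]
  exact ENNReal.rpow_le_rpow (lintegral_le_powMean hr hf) (by positivity)

theorem compProd_condKernel_sectR {X U V : Type*} [MeasurableSpace X] [MeasurableSpace U]
    [MeasurableSpace V] [StandardBorelSpace V] [Nonempty V]
    [MeasurableSpace.CountableOrCountablyGenerated X U] (κ : Kernel X (U × V)) [IsMarkovKernel κ]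
    (x : X) : (κ x).fst ⊗ₘ (κ.condKernel.sectR x) = κ x := by
  have := congrArg (fun k => k x) (κ.disintegrate κ.condKernel)
  simp only [Kernel.compProd_apply_eq_compProd_sectR, Kernel.fst_apply] at this
  exact this

variable {Z W : Type*} {K a : ℝ≥0} {Λ : Z → ℝ≥0∞} {G : Z → ℝ}

open Classical in
/-- A nonnegative bound `G + K (Λ + a)`, infinite where `Λ` is infinite. -/
def riskBound (K a : ℝ≥0) (Λ : Z → ℝ≥0∞) (G : Z → ℝ) (z : Z) : ℝ≥0∞ :=
  if Λ z = ∞ then ∞ else ENNReal.ofReal (G z + K * (Λ z).toReal + K * a)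

theorem measurable_riskBound [MeasurableSpace Z] (hΛ : Measurable Λ) (hG : Measurable G) :
    Measurable (riskBound K a Λ G) := by
  refine Measurable.ite (hΛ (measurableSet_singleton ∞)) measurable_const ?_
  exact ((hG.add (hΛ.ennreal_toReal.const_mul _)).add_const _).ennreal_ofReal

theorem riskBound_of_ne_top {z : Z} (h : Λ z ≠ ∞) :
    riskBound K a Λ G z = ENNReal.ofReal (G z + K * (Λ z).toReal + K * a) := if_neg h

/-- The hypothesis gives `G ≥ -K a - K Λ / 2`. The offset `K a` thus makes the bound nonnegative, as
the selection by means of extended nonnegative integrals requires. -/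
theorem riskBound_nonneg {z : Z} (hG : 2 * |G z| ≤ K * (2 * a + (Λ z).toReal)) :
    K * (Λ z).toReal ≤ 2 * (G z + K * (Λ z).toReal + K * a) := by
  have := neg_abs_le (G z)
  linarith

/-- Half of `K Λ` survives in the bound, so selecting a point with a small bound also controls `Λ`
there. -/
theorem mul_le_riskBound {z : Z} (hG : Λ z ≠ ∞ → 2 * |G z| ≤ K * (2 * a + (Λ z).toReal)) :
    K * Λ z ≤ 2 * riskBound K a Λ G z := by
  by_cases h : Λ z = ∞
  · rw [riskBound, if_pos h, ENNReal.mul_top (by simp)]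
    exact le_top
  · rw [riskBound_of_ne_top h]
    have h1 := ENNReal.ofReal_le_ofReal (riskBound_nonneg (hG h))
    rwa [ENNReal.ofReal_mul K.coe_nonneg, ENNReal.ofReal_toReal h, ENNReal.ofReal_coe_nnreal,
      ENNReal.ofReal_mul (by norm_num), ENNReal.ofReal_ofNat] at h1

theorem riskBound_le (hK : K ≠ 0) {z : Z}
    (hG : Λ z ≠ ∞ → 2 * |G z| ≤ K * (2 * a + (Λ z).toReal)) :
    riskBound K a Λ G z ≤ K * (2 * a + 2 * Λ z) := by
  by_cases h : Λ z = ∞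
  · rw [h, ENNReal.mul_top (by simp), add_top, ENNReal.mul_top (by simpa using hK)]
    exact le_top
  · rw [riskBound_of_ne_top h]
    obtain ⟨l, hl⟩ : ∃ l : ℝ≥0, (l : ℝ≥0∞) = Λ z := ⟨_, ENNReal.coe_toNNReal h⟩
    have h1 := hG h
    rw [← hl] at h1 ⊢
    have h2 : G z + K * ((l : ℝ≥0∞)).toReal + K * a ≤ ((K * (2 * a + 2 * l) : ℝ≥0) : ℝ) := by
      push_cast
      have := le_abs_self (G z)
      have h3 : (0 : ℝ) ≤ K * l := by positivity
      simp only [ENNReal.coe_toReal] at h1 ⊢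
      nlinarith
    refine (ENNReal.ofReal_le_ofReal h2).trans (le_of_eq ?_)
    rw [ENNReal.ofReal_coe_nnreal]
    push_cast
    rfl

theorem two_mul_abs_le {x : ℝ} {n l : ℝ≥0∞} (hl : l ≠ ∞) (hx : ‖x‖ₑ ≤ K * n)
    (hn : 2 * n ≤ 2 * a + l) : 2 * |x| ≤ K * (2 * a + l.toReal) := by
  have h1 : 2 * ‖x‖ₑ ≤ K * (2 * a + l) :=
    calc 2 * ‖x‖ₑ ≤ 2 * (K * n) := mul_le_mul_right hx _
      _ = K * (2 * n) := by ring
      _ ≤ _ := mul_le_mul_right hn _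
  have h2 := ENNReal.toReal_mono (ENNReal.mul_ne_top ENNReal.coe_ne_top
    (ENNReal.add_ne_top.2 ⟨ENNReal.mul_ne_top (by simp) ENNReal.coe_ne_top, hl⟩)) h1
  rw [ENNReal.toReal_mul, ENNReal.toReal_mul, ENNReal.toReal_add
    (ENNReal.mul_ne_top (by simp) ENNReal.coe_ne_top) hl, ENNReal.toReal_mul] at h2
  simpa using h2

end RiskBound

/-! ### Norms along couplings -/

section PairNorm

variable {T : ℕ} {Ξ : Fin T → Type*} [∀ i, Nonempty (Ξ i)] [∀ i, MeasurableSpace (Ξ i)]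
  [∀ i, StandardBorelSpace (Ξ i)] {P P' : Measure (∀ i, Ξ i)} [IsProbabilityMeasure P]
  [IsProbabilityMeasure P'] {r : ℝ}
  {Γ : ∀ i, Kernel ((∀ i, Ξ i) × (∀ i, Ξ i)) (Ξ i × Ξ i)}
  {ℓ : (∀ i, Ξ i) × (∀ i, Ξ i) → ℝ≥0∞}

variable (P P' Γ) in
/-- The kernels `Γ` couple the conditional distributions of `P` and `P'`, depending on the history
only. -/
structure IsNestedCoupling : Prop where
  isCoupling : ∀ i x y, IsCoupling (stageKernel P i x) (stageKernel P' i y) (Γ i (x, y))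
  congr : ∀ (i : Fin T) x x' y y', Agree i.val x x' → Agree i.val y y' →
    Γ i (x, y) = Γ i (x', y')

/-- The iterated `L^r`-norm along the couplings. -/
abbrev pairNorm (r : ℝ) (Γ : ∀ i, Kernel ((∀ i, Ξ i) × (∀ i, Ξ i)) (Ξ i × Ξ i))
    (ℓ : (∀ i, Ξ i) × (∀ i, Ξ i) → ℝ≥0∞) (t : ℕ) : (∀ i, Ξ i) × (∀ i, Ξ i) → ℝ≥0∞ :=
  iterNorm r Γ pairStep ℓ t

theorem IsNestedCoupling.pairNorm_congr (hΓ : IsNestedCoupling P P' Γ) (t : ℕ)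
    {x x' y y' : ∀ i, Ξ i} (hx : Agree t x x') (hy : Agree t y y') :
    pairNorm r Γ ℓ t (x, y) = pairNorm r Γ ℓ t (x', y') := by
  refine congrArg (fun s : ℝ≥0∞ => s ^ (1 / r)) ?_
  refine iterMean_congr_rel (rel := fun t z z' => Agree t z.1 z'.1 ∧ Agree t z.2 z'.2)
    (fun t h z z' hz => hΓ.congr ⟨t, h⟩ _ _ _ _ hz.1 hz.2)
    (fun t h z z' w hz => ⟨hz.1.update h w.1, hz.2.update h w.2⟩)
    (fun t h z z' hz => ?_) t _ _ ⟨hx, hy⟩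
  rw [Prod.ext (hz.1.eq h) (hz.2.eq h)]

theorem IsNestedCoupling.pathNorm_snd (hΓ : IsNestedCoupling P P' Γ)
    {f : (∀ i, Ξ i) → ℝ≥0∞} (hf : Measurable f) (t : ℕ) (z : (∀ i, Ξ i) × (∀ i, Ξ i)) :
    pairNorm r Γ (fun z => f z.2) t z = pathNorm r P' f t z.2 := by
  refine congrArg (fun s : ℝ≥0∞ => s ^ (1 / r)) ?_
  exact iterMean_map (κ' := pathKernel P') measurable_update_prod (φ := Prod.snd)
    (ψ := fun i => Prod.snd) (fun i => measurable_snd) (fun i x u => rfl)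
    (fun i z => (hΓ.isCoupling i z.1 z.2).2) (hf.pow_const r) t z

/-- Monotonicity and Minkowski's inequality along the stages; a constant is its own iterated norm.
-/
theorem IsNestedCoupling.two_mul_pathNorm_le [∀ i, IsMarkovKernel (Γ i)] (hr : 1 ≤ r)
    (hΓ : IsNestedCoupling P P' Γ) {f : (∀ i, Ξ i) → ℝ≥0∞} (hf : Measurable f)
    (hℓ : Measurable ℓ) {a : ℝ≥0} (h : ∀ z, 2 * f z.2 ≤ 2 * a + ℓ z) (t : ℕ)
    (z : (∀ i, Ξ i) × (∀ i, Ξ i)) :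
    2 * pathNorm r P' f t z.2 ≤ 2 * a + pairNorm r Γ ℓ t z := by
  rw [← hΓ.pathNorm_snd hf]
  have h2 : (2 : ℝ≥0∞) = ((2 : ℝ≥0) : ℝ≥0∞) := rfl
  rw [h2, ← iterNorm_const_mul hr 2]
  refine (iterNorm_mono hr (g := fun z => ((2 * a : ℝ≥0) : ℝ≥0∞) + ℓ z) (fun z => ?_) t z).trans ?_
  · rw [ENNReal.coe_mul]
    exact h z
  · refine (iterNorm_add_le hr measurable_pairStep measurable_const hℓ t z).trans ?_
    rw [iterNorm_const hr, ENNReal.coe_mul]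

end PairNorm

/-! ### Transfer of policies -/

section Transfer

variable {T : ℕ} {Ξ : Fin T → Type*} [∀ i, Nonempty (Ξ i)] [∀ i, MeasurableSpace (Ξ i)]
  [∀ i, StandardBorelSpace (Ξ i)] {P P' : Measure (∀ i, Ξ i)} [IsProbabilityMeasure P]
  [IsProbabilityMeasure P'] {r : ℝ} {q : ℝ≥0∞} {S : Fin T → Set (ℝ → ℝ)} {k : Fin T → ℝ≥0}
  {Γ : ∀ i, Kernel ((∀ i, Ξ i) × (∀ i, Ξ i)) (Ξ i × Ξ i)} [∀ i, IsMarkovKernel (Γ i)]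
  {ℓ : (∀ i, Ξ i) × (∀ i, Ξ i) → ℝ≥0∞} {a : ℝ≥0} {H : (∀ i, Ξ i) → (∀ i, Ξ i) → ℝ}

/-- The beginning of the image path depends on the beginning of the path only. -/
def Causal (η : (∀ i, Ξ i) → ∀ i, Ξ i) : Prop :=
  ∀ s x x', Agree s x x' → Agree s (η x) (η x')

/-- A function of two paths which depends on their histories before `t` only. -/
def DependsOnPast {β : Type*} (t : ℕ) (F : (∀ i, Ξ i) × (∀ i, Ξ i) → β) : Prop :=
  ∀ x x' y y', Agree t x x' → Agree t y y' → F (x, y) = F (x', y')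

variable (P Γ) in
/-- The kernel `ρ` disintegrates the coupling of stage `i` along the map `η`. -/
structure IsStageDisintegration (i : Fin T) (η : (∀ i, Ξ i) → ∀ i, Ξ i)
    (ρ : Kernel ((∀ i, Ξ i) × Ξ i) (Ξ i)) : Prop where
  compProd_eq : ∀ x, stageKernel P i x ⊗ₘ ρ.sectR x = Γ i (x, η x)
  congr : ∀ x x' u, Agree i.val x x' → ρ (x, u) = ρ (x', u)

theorem exists_stageDisintegration (hΓ : IsNestedCoupling P P' Γ) (i : Fin T)
    {η : (∀ i, Ξ i) → ∀ i, Ξ i} (hη : Measurable η) (hc : Causal η) :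
    ∃ ρ : Kernel ((∀ i, Ξ i) × Ξ i) (Ξ i), IsMarkovKernel ρ ∧
      IsStageDisintegration P Γ i η ρ := by
  set π : Kernel (∀ i, Ξ i) (Ξ i × Ξ i) :=
    (Γ i).comap (fun x => (x, η x)) (measurable_id.prodMk hη) with hπ
  have hm : Measurable fun z : (∀ i, Ξ i) × Ξ i => (freeze i.val z.1, z.2) :=
    ((measurable_freeze _).comp measurable_fst).prodMk measurable_snd
  -- Conditioning is done at the frozen history, so that the disintegration forgets the future
  -- coordinates of `x`.
  refine ⟨π.condKernel.comap _ hm, inferInstance, fun x => ?_, fun x x' u hx => ?_⟩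
  · have h1 := compProd_condKernel_sectR π (freeze i.val x)
    have h2 : π (freeze i.val x) = Γ i (x, η x) :=
      hΓ.congr i _ _ _ _ (agree_freeze _ _) (hc _ _ _ (agree_freeze _ _))
    rw [h2] at h1
    rw [← h1]
    congr 1
    exact (hΓ.isCoupling i x (η x)).1.symm
  · rw [Kernel.comap_apply, Kernel.comap_apply, hx.freeze_eq]

/-- The selection is made on complete histories `x'` up to `t + 1`, the one-stage estimate on pairs
of a history `x` and a new coordinate `u`. This translates between the two. -/
theorem IsStageDisintegration.lintegral_freeze {t : ℕ} (h : t < T) {η : (∀ i, Ξ i) → ∀ i, Ξ i}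
    (hc : Causal η) {ρ : Kernel ((∀ i, Ξ i) × Ξ ⟨t, h⟩) (Ξ ⟨t, h⟩)}
    (hρ : IsStageDisintegration P Γ ⟨t, h⟩ η ρ) {F : (∀ i, Ξ i) × (∀ i, Ξ i) → ℝ≥0∞}
    (hF : DependsOnPast (t + 1) F) (x : ∀ i, Ξ i) (u : Ξ ⟨t, h⟩) (x' : ∀ i, Ξ i)
    (hx' : x' = freeze (t + 1) (Function.update x ⟨t, h⟩ u)) :
    ∫⁻ v, F (x', Function.update (η x') ⟨t, h⟩ v) ∂ρ (x', x' ⟨t, h⟩) =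
      ∫⁻ v, F (Function.update x ⟨t, h⟩ u, Function.update (η x) ⟨t, h⟩ v) ∂ρ (x, u) := by
  have h1 : Agree (t + 1) x' (Function.update x ⟨t, h⟩ u) := hx' ▸ agree_freeze _ _
  have h2 : Agree t x' x := (h1.mono t.le_succ).trans (agree_update h x u)
  have h3 : x' ⟨t, h⟩ = u := by rw [h1 ⟨t, h⟩ (Nat.lt_succ_self t)]; simp
  rw [h3, hρ.congr x' x u h2]
  exact lintegral_congr fun v => hF _ _ _ _ h1 ((hc t _ _ h2).update h v)

theorem IsStageDisintegration.lintegral_eq {t : ℕ} (h : t < T) {η : (∀ i, Ξ i) → ∀ i, Ξ i}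
    {ρ : Kernel ((∀ i, Ξ i) × Ξ ⟨t, h⟩) (Ξ ⟨t, h⟩)} [IsMarkovKernel ρ]
    (hρ : IsStageDisintegration P Γ ⟨t, h⟩ η ρ) {F : (∀ i, Ξ i) × (∀ i, Ξ i) → ℝ≥0∞}
    (hF : Measurable F) (x : ∀ i, Ξ i) :
    ∫⁻ u, ∫⁻ v, F (Function.update x ⟨t, h⟩ u, Function.update (η x) ⟨t, h⟩ v) ∂ρ (x, u)
      ∂stageKernel P ⟨t, h⟩ x = ∫⁻ w, F (pairStep ⟨t, h⟩ (x, η x) w) ∂Γ ⟨t, h⟩ (x, η x) := by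
  rw [← hρ.compProd_eq, Measure.lintegral_compProd]
  · rfl
  · exact hF.comp ((measurable_pairStep ⟨t, h⟩).comp measurable_prodMk_left)

/-- A measurable causal choice of the next coordinate, with cost below the mean. -/
theorem exists_causal_update {t : ℕ} (h : t < T) {η : (∀ i, Ξ i) → ∀ i, Ξ i}
    (hη : Measurable η) (hc : Causal η) (ρ : Kernel ((∀ i, Ξ i) × Ξ ⟨t, h⟩) (Ξ ⟨t, h⟩))
    [IsMarkovKernel ρ] {F : (∀ i, Ξ i) × (∀ i, Ξ i) → ℝ≥0∞} (hF : Measurable F) :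
    ∃ η' : (∀ i, Ξ i) → ∀ i, Ξ i, Measurable η' ∧ Causal η' ∧
      ∀ᵐ x ∂frozenLaw P (t + 1), F (x, η' x) ≤
        ∫⁻ v, F (x, Function.update (η x) ⟨t, h⟩ v) ∂ρ (x, x ⟨t, h⟩) := by
  have hm : Measurable fun x : ∀ i, Ξ i => (x, x ⟨t, h⟩) :=
    measurable_id.prodMk (measurable_pi_apply _)
  have hF' : Measurable fun z : (∀ i, Ξ i) × Ξ ⟨t, h⟩ =>
      F (z.1, Function.update (η z.1) ⟨t, h⟩ z.2) :=
    hF.comp (measurable_fst.prodMk ((measurable_update_prod ⟨t, h⟩).comp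
      ((hη.comp measurable_fst).prodMk measurable_snd)))
  obtain ⟨s, hs, hsF⟩ := exists_measurable_le_lintegral (frozenLaw P (t + 1)) (ρ.comap _ hm) hF'
  -- Coordinate `t` of the image uses `x` only through its coordinates up to and including `t`,
  -- which keeps the new map causal.
  refine ⟨fun x => Function.update (η x) ⟨t, h⟩ (s (freeze (t + 1) x)), ?_, ?_, ?_⟩
  · exact (measurable_update_prod ⟨t, h⟩).comp (hη.prodMk (hs.comp (measurable_freeze _)))
  · intro m x x' hx
    by_cases hm : m ≤ t
    · exact ((agree_update h _ _).mono hm).trans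
        ((hc m x x' hx).trans ((agree_update h _ _).mono hm).symm)
    · have e : freeze (t + 1) x = freeze (t + 1) x' :=
        (hx.mono (by omega)).freeze_eq
      intro j hj
      simp only [e]
      by_cases hjt : j = ⟨t, h⟩
      · subst hjt; simp
      · rw [Function.update_of_ne hjt, Function.update_of_ne hjt]
        exact hc m x x' hx j hj
  · filter_upwards [hsF, ae_freeze_eq P (t + 1)] with x h1 h2
    simp only [h2]
    exact h1

variable (ℓ a H) in
/-- The cost `H y x` of the decisions made for the path `y` when the path is `x`, and the bound `ℓ`
for the error caused by this. -/
structure IsTransferCost : Prop where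
  measurable_value : Measurable fun z : (∀ i, Ξ i) × (∀ i, Ξ i) => H z.1 z.2
  measurable_cost : Measurable ℓ
  cost_ne_top : ∀ z, ℓ z ≠ ∞
  two_mul_le : ∀ z, 2 * ‖H z.2 z.2‖ₑ ≤ 2 * a + ℓ z
  enorm_sub_le : ∀ x y, ‖H y x - H y y‖ₑ ≤ ℓ (x, y)

theorem IsTransferCost.measurable_diag (hH : IsTransferCost ℓ a H) : Measurable fun y => H y y :=
  hH.measurable_value.comp (measurable_id.prodMk measurable_id)

theorem IsTransferCost.measurable_comp (hH : IsTransferCost ℓ a H) {η : (∀ i, Ξ i) → ∀ i, Ξ i}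
    (hη : Measurable η) : Measurable fun x => H (η x) x :=
  hH.measurable_value.comp (hη.prodMk measurable_id)

variable (P P' r S k Γ ℓ H) in
/-- Every causal map with finite iterated norm at time `t` can be continued to a causal map for
which the risk at time `t` under `P` is controlled by the risk under `P'`. -/
def TransferAt (t : ℕ) : Prop :=
  ∀ η : (∀ i, Ξ i) → ∀ i, Ξ i, Measurable η → Causal η →
    ∫⁻ x, pairNorm r Γ ℓ t (x, η x) ^ r ∂frozenLaw P t ≠ ∞ →
    ∃ η' : (∀ i, Ξ i) → ∀ i, Ξ i, Measurable η' ∧ Causal η' ∧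
      MemLp (fun x => H (η' x) x) (ENNReal.ofReal r) P ∧
      ∀ᵐ x ∂frozenLaw P t, riskProcess S P (fun x => H (η' x) x) t x ≤
        riskProcess S P' (fun y => H y y) t (η x) +
          tailProd k t * (pairNorm r Γ ℓ t (x, η x)).toReal

/-- After the last stage the risk is the cost itself, and the bound on the error is the claim; `η`
needs no change. -/
theorem transferAt_of_le (hr : 1 ≤ r) (hH : IsTransferCost ℓ a H) {t : ℕ} (h : T ≤ t) :
    TransferAt P P' r S k Γ ℓ H t := by
  intro η hη hc hfin
  rw [frozenLaw_of_le P h] at hfin ⊢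
  simp only [pairNorm, iterNorm_of_le hr h, riskProcess_of_le _ h, tailProd_of_le k h] at hfin ⊢
  refine ⟨η, hη, hc, ?_, Filter.Eventually.of_forall fun x => ?_⟩
  · refine (memLp_iff_powMean hr (hH.measurable_comp hη).aestronglyMeasurable).2 ?_
    have hm : Measurable fun x => ℓ (x, η x) :=
      hH.measurable_cost.comp (measurable_id.prodMk hη)
    -- One `ℓ` pays for replacing `x` by `η x`, another one for the size of the cost at `η x` beyond
    -- `a`.
    have hb : ∀ x, ‖H (η x) x‖ₑ ≤ a + 2 * ℓ (x, η x) := by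
      intro x
      have h1 := hH.two_mul_le (x, η x)
      have h2 := hH.enorm_sub_le x (η x)
      have h3 : ‖H (η x) x‖ₑ ≤ ‖H (η x) x - H (η x) (η x)‖ₑ + ‖H (η x) (η x)‖ₑ := by
        have := enorm_add_le (H (η x) x - H (η x) (η x)) (H (η x) (η x))
        rwa [sub_add_cancel] at this
      have h4 : ‖H (η x) (η x)‖ₑ ≤ a + ℓ (x, η x) := by
        have h5 : 2 * ‖H (η x) (η x)‖ₑ ≤ 2 * (a + ℓ (x, η x)) := by
          refine h1.trans ?_
          rw [mul_add]
          refine add_le_add le_rfl ?_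
          rw [two_mul]
          exact le_self_add
        exact (ENNReal.mul_le_mul_iff_right (by simp) (by simp)).1 h5
      calc ‖H (η x) x‖ₑ ≤ ℓ (x, η x) + (a + ℓ (x, η x)) := h3.trans (add_le_add h2 h4)
        _ = _ := by ring
    have hpf : powMean r P (fun x => ℓ (x, η x)) ≠ ∞ := by
      rw [powMean]
      exact ENNReal.rpow_ne_top_of_nonneg (by positivity) hfin
    refine ne_top_of_le_ne_top ?_ ((powMean_mono_ae hr (Filter.Eventually.of_forall hb)).trans
      (powMean_add_le hr aemeasurable_const (hm.const_mul 2).aemeasurable))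
    rw [powMean_const hr, powMean_const_mul hr (by simp)]
    exact ENNReal.add_ne_top.2 ⟨ENNReal.coe_ne_top, ENNReal.mul_ne_top (by simp) hpf⟩
  · have h2 := hH.enorm_sub_le x (η x)
    rw [Real.enorm_eq_ofReal_abs, ENNReal.ofReal_le_iff_le_toReal (hH.cost_ne_top _)] at h2
    have := le_abs_self (H (η x) x - H (η x) (η x))
    simp only [NNReal.coe_one, one_mul]
    linarith

end Transfer

/-! ### One stage of the transfer, and the induction over all stages. -/

section TransferStep

variable {T : ℕ} {Ξ : Fin T → Type*} [∀ i, Nonempty (Ξ i)] [∀ i, MeasurableSpace (Ξ i)]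
  [∀ i, StandardBorelSpace (Ξ i)] {P P' : Measure (∀ i, Ξ i)} [IsProbabilityMeasure P]
  [IsProbabilityMeasure P'] {r : ℝ} {q : ℝ≥0∞} {S : Fin T → Set (ℝ → ℝ)} {k : Fin T → ℝ≥0}
  {Γ : ∀ i, Kernel ((∀ i, Ξ i) × (∀ i, Ξ i)) (Ξ i × Ξ i)} [∀ i, IsMarkovKernel (Γ i)]
  {ℓ : (∀ i, Ξ i) × (∀ i, Ξ i) → ℝ≥0∞} {a : ℝ≥0} {H : (∀ i, Ξ i) → (∀ i, Ξ i) → ℝ}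

theorem tailProd_ne_zero (hk : ∀ i, k i ≠ 0) (t : ℕ) : tailProd k t ≠ 0 :=
  Finset.prod_ne_zero_iff.2 fun i _ => hk i

/-- The iterated norm of the next stage, averaged over the disintegration. -/
theorem IsStageDisintegration.lintegral_pairNorm (hr : 1 ≤ r) (hΓ : IsNestedCoupling P P' Γ)
    (hℓ : Measurable ℓ) {t : ℕ} (h : t < T) {η : (∀ i, Ξ i) → ∀ i, Ξ i} (hη : Measurable η)
    (hc : Causal η) {ρ : Kernel ((∀ i, Ξ i) × Ξ ⟨t, h⟩) (Ξ ⟨t, h⟩)} [IsMarkovKernel ρ]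
    (hρ : IsStageDisintegration P Γ ⟨t, h⟩ η ρ) :
    ∫⁻ x, ∫⁻ v, pairNorm r Γ ℓ (t + 1) (x, Function.update (η x) ⟨t, h⟩ v) ^ r
      ∂ρ (x, x ⟨t, h⟩) ∂frozenLaw P (t + 1) =
      ∫⁻ x, pairNorm r Γ ℓ t (x, η x) ^ r ∂frozenLaw P t := by
  have hΛ : Measurable (pairNorm r Γ ℓ (t + 1)) := measurable_iterNorm measurable_pairStep hℓ _
  have hm : Measurable fun x : ∀ i, Ξ i => (x, x ⟨t, h⟩) :=
    measurable_id.prodMk (measurable_pi_apply _)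
  have hF' : Measurable fun z : (∀ i, Ξ i) × Ξ ⟨t, h⟩ =>
      pairNorm r Γ ℓ (t + 1) (z.1, Function.update (η z.1) ⟨t, h⟩ z.2) ^ r :=
    (hΛ.comp (measurable_fst.prodMk ((measurable_update_prod ⟨t, h⟩).comp
      ((hη.comp measurable_fst).prodMk measurable_snd)))).pow_const r
  have hI : Measurable fun x => ∫⁻ v, pairNorm r Γ ℓ (t + 1)
      (x, Function.update (η x) ⟨t, h⟩ v) ^ r ∂ρ (x, x ⟨t, h⟩) :=
    hF'.lintegral_kernel_prod_right' (κ := ρ.comap _ hm)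
  rw [lintegral_frozenLaw_succ P h hI]
  refine lintegral_congr fun x => ?_
  have hdep : DependsOnPast (t + 1) fun z => pairNorm r Γ ℓ (t + 1) z ^ r :=
    fun x x' y y' hx hy => by simp only [hΓ.pairNorm_congr (t + 1) hx hy]
  calc ∫⁻ u, ∫⁻ v, pairNorm r Γ ℓ (t + 1) (freeze (t + 1) (Function.update x ⟨t, h⟩ u),
          Function.update (η (freeze (t + 1) (Function.update x ⟨t, h⟩ u))) ⟨t, h⟩ v) ^ r
          ∂ρ (freeze (t + 1) (Function.update x ⟨t, h⟩ u),
            freeze (t + 1) (Function.update x ⟨t, h⟩ u) ⟨t, h⟩) ∂stageKernel P ⟨t, h⟩ x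
      = ∫⁻ u, ∫⁻ v, pairNorm r Γ ℓ (t + 1) (Function.update x ⟨t, h⟩ u,
          Function.update (η x) ⟨t, h⟩ v) ^ r ∂ρ (x, u) ∂stageKernel P ⟨t, h⟩ x :=
        lintegral_congr fun u => hρ.lintegral_freeze h hc hdep x u _ rfl
    _ = ∫⁻ w, pairNorm r Γ ℓ (t + 1) (pairStep ⟨t, h⟩ (x, η x) w) ^ r ∂Γ ⟨t, h⟩ (x, η x) :=
        hρ.lintegral_eq h (F := fun z => pairNorm r Γ ℓ (t + 1) z ^ r) (hΛ.pow_const r) x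
    _ = _ := by
        rw [show pairNorm r Γ ℓ t (x, η x) = _ from iterNorm_of_lt hr h (x, η x), powMean_rpow hr]

/-- If the bound at the chosen point does not exceed its mean, the iterated norm at this point has a
finite moment. -/
theorem lintegral_pairNorm_ne_top (hr : 1 ≤ r) {t : ℕ} (h : t < T)
    {η η' : (∀ i, Ξ i) → ∀ i, Ξ i} (hη : Measurable η)
    {ρ : Kernel ((∀ i, Ξ i) × Ξ ⟨t, h⟩) (Ξ ⟨t, h⟩)} [IsMarkovKernel ρ]
    {Λ F : (∀ i, Ξ i) × (∀ i, Ξ i) → ℝ≥0∞} (hΛ : Measurable Λ) {K : ℝ≥0} (hK : K ≠ 0)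
    (hF1 : ∀ z, K * Λ z ≤ 2 * F z) (hF2 : ∀ z, F z ≤ K * (2 * a + 2 * Λ z))
    (hsel : ∀ᵐ x ∂frozenLaw P (t + 1), F (x, η' x) ≤
        ∫⁻ v, F (x, Function.update (η x) ⟨t, h⟩ v) ∂ρ (x, x ⟨t, h⟩))
    (hfin : ∫⁻ x, ∫⁻ v, Λ (x, Function.update (η x) ⟨t, h⟩ v) ^ r ∂ρ (x, x ⟨t, h⟩)
      ∂frozenLaw P (t + 1) ≠ ∞) :
    ∫⁻ x, Λ (x, η' x) ^ r ∂frozenLaw P (t + 1) ≠ ∞ := by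
  have hm : Measurable fun x : ∀ i, Ξ i => (x, x ⟨t, h⟩) :=
    measurable_id.prodMk (measurable_pi_apply _)
  have hup : Measurable fun z : (∀ i, Ξ i) × Ξ ⟨t, h⟩ =>
      Λ (z.1, Function.update (η z.1) ⟨t, h⟩ z.2) :=
    hΛ.comp (measurable_fst.prodMk ((measurable_update_prod ⟨t, h⟩).comp
      ((hη.comp measurable_fst).prodMk measurable_snd)))
  have hI : Measurable fun x => ∫⁻ v, Λ (x, Function.update (η x) ⟨t, h⟩ v) ∂ρ (x, x ⟨t, h⟩) :=
    hup.lintegral_kernel_prod_right' (κ := ρ.comap _ hm)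
  -- The constants come from `K Λ ≤ 2 F` at the selected point and `F ≤ K (2 a + 2 Λ)` under the
  -- mean.
  have hle : ∀ᵐ x ∂frozenLaw P (t + 1), Λ (x, η' x) ≤
      4 * a + 4 * ∫⁻ v, Λ (x, Function.update (η x) ⟨t, h⟩ v) ∂ρ (x, x ⟨t, h⟩) := by
    filter_upwards [hsel] with x hx
    have hs : Measurable fun v => Λ (x, Function.update (η x) ⟨t, h⟩ v) :=
      hup.comp measurable_prodMk_left
    refine (ENNReal.mul_le_mul_iff_right (ENNReal.coe_ne_zero.2 hK) ENNReal.coe_ne_top).1 ?_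
    calc K * Λ (x, η' x) ≤ 2 * F (x, η' x) := hF1 _
      _ ≤ 2 * ∫⁻ v, K * (2 * a + 2 * Λ (x, Function.update (η x) ⟨t, h⟩ v)) ∂ρ (x, x ⟨t, h⟩) :=
          mul_le_mul_right (hx.trans (lintegral_mono fun v => hF2 _)) _
      _ = _ := by
          rw [lintegral_const_mul' _ _ ENNReal.coe_ne_top,
            lintegral_add_left measurable_const, lintegral_const, measure_univ, mul_one,
            lintegral_const_mul' _ _ (by simp)]
          ring
  have hpow : powMean r (frozenLaw P (t + 1)) (fun x => Λ (x, η' x)) ≠ ∞ := by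
    refine ne_top_of_le_ne_top ?_ ((powMean_mono_ae hr hle).trans
      (powMean_add_le hr aemeasurable_const (hI.const_mul 4).aemeasurable))
    rw [powMean_const hr, powMean_const_mul hr (by simp)]
    refine ENNReal.add_ne_top.2 ⟨ENNReal.mul_ne_top (by simp) ENNReal.coe_ne_top,
      ENNReal.mul_ne_top (by simp) ?_⟩
    refine ENNReal.rpow_ne_top_of_nonneg (by positivity) (ne_top_of_le_ne_top hfin ?_)
    exact lintegral_mono fun x => lintegral_rpow_le_lintegral hr
      (hup.comp measurable_prodMk_left).aemeasurable
  rw [← powMean_rpow hr]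
  exact ENNReal.rpow_ne_top_of_nonneg (by positivity) hpow

/-- The coordinate `t` of `η` is reset to a point where the bound `F`, built from the risk under
`P'` and the remaining norm, does not exceed its mean over the disintegrated coupling. The induction
hypothesis continues the map from there, and the averaged comparison of risks converts the
inequality between means into one between risks. -/
theorem TransferAt.stage (hr : 1 ≤ r) (hq : (ENNReal.ofReal r)⁻¹ + q⁻¹ = 1)
    (hS : ∀ i, IsBoundedFamily q (S i) (k i)) (hk : ∀ i, k i ≠ 0)
    (hΓ : IsNestedCoupling P P' Γ) (hH : IsTransferCost ℓ a H) {t : ℕ} (h : t < T)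
    (ih : TransferAt P P' r S k Γ ℓ H (t + 1)) : TransferAt P P' r S k Γ ℓ H t := by
  intro η hη hc hfin
  obtain ⟨G, hG, hG'⟩ := exists_measurable_riskProcess (P := P') hr hq hS hH.measurable_diag (t + 1)
  set K := tailProd k (t + 1) with hKdef
  have hK : K ≠ 0 := tailProd_ne_zero hk _
  set Λ := pairNorm r Γ ℓ (t + 1) with hΛdef
  have hΛ : Measurable Λ := measurable_iterNorm measurable_pairStep hH.measurable_cost _
  have hN : ∀ s z, 2 * pathNorm r P' (fun y => ‖H y y‖ₑ) s z.2 ≤ 2 * a + pairNorm r Γ ℓ s z :=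
    fun s z => hΓ.two_mul_pathNorm_le hr hH.measurable_diag.enorm hH.measurable_cost hH.two_mul_le s z
  -- Finiteness along the couplings controls the norm under `P'`, because `ℓ` dominates the excess
  -- of the cost over `a`.
  have hNfin : ∀ s z, pairNorm r Γ ℓ s z ≠ ∞ → pathNorm r P' (fun y => ‖H y y‖ₑ) s z.2 ≠ ∞ := by
    intro s z hz hc
    have := hN s z
    rw [hc, ENNReal.mul_top (by simp), top_le_iff] at this
    exact ENNReal.add_ne_top.2 ⟨ENNReal.mul_ne_top (by simp) ENNReal.coe_ne_top, hz⟩ this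
  have hGR : ∀ z, Λ z ≠ ∞ → G z.2 = riskProcess S P' (fun y => H y y) (t + 1) z.2 :=
    fun z hz => (hG' _ (hNfin _ z hz)).1
  have hGb : ∀ z : (∀ i, Ξ i) × (∀ i, Ξ i), Λ z ≠ ∞ →
      2 * |G z.2| ≤ K * (2 * a + (Λ z).toReal) := by
    intro z hz
    have h1 := hG' _ (hNfin _ z hz)
    refine two_mul_abs_le hz ?_ (hN _ z)
    rw [h1.1]
    exact h1.2
  set F := riskBound K a Λ (fun z => G z.2) with hFdef
  have hFm : Measurable F := measurable_riskBound hΛ (hG.comp measurable_snd)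
  have hFdep : DependsOnPast (t + 1) F := by
    intro x x' y y' hx hy
    have e : Λ (x, y) = Λ (x', y') := hΓ.pairNorm_congr (t + 1) hx hy
    by_cases hz : Λ (x, y) = ∞
    · rw [hFdef, riskBound, riskBound, if_pos hz, if_pos (e ▸ hz)]
    · have hz' : Λ (x', y') ≠ ∞ := e ▸ hz
      rw [hFdef, riskBound_of_ne_top hz, riskBound_of_ne_top hz', hGR _ hz, hGR _ hz', e,
        riskProcess_congr S P' _ (t + 1) _ _ hy]
  obtain ⟨ρ, hρM, hρ⟩ := exists_stageDisintegration hΓ ⟨t, h⟩ hη hc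
  obtain ⟨η₁, hη₁, hc₁, hsel⟩ := exists_causal_update (P := P) h hη hc ρ hFm
  -- The selected path need not follow the coupling, so the moment required by the induction
  -- hypothesis has to be recovered from the two-sided bounds on `F`.
  have hfin₁ : ∫⁻ x, Λ (x, η₁ x) ^ r ∂frozenLaw P (t + 1) ≠ ∞ :=
    lintegral_pairNorm_ne_top hr h hη hΛ hK (fun z => mul_le_riskBound (hGb z))
      (fun z => riskBound_le hK (hGb z)) hsel
      (by rwa [hρ.lintegral_pairNorm hr hΓ hH.measurable_cost h hη hc])
  obtain ⟨η', hη', hc', hmem, hle⟩ := ih η₁ hη₁ hc₁ hfin₁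
  refine ⟨η', hη', hc', hmem, ?_⟩
  have hΛ₁ : ∀ᵐ x ∂frozenLaw P (t + 1), Λ (x, η₁ x) < ∞ := by
    have hm : Measurable fun x => Λ (x, η₁ x) ^ r :=
      (hΛ.comp (measurable_id.prodMk hη₁)).pow_const r
    filter_upwards [ae_lt_top hm hfin₁] with x hx
    exact (ENNReal.rpow_lt_top_iff_of_pos (by positivity)).1 hx
  have hΛt : ∀ᵐ x ∂frozenLaw P t, pairNorm r Γ ℓ t (x, η x) < ∞ := by
    have hm : Measurable fun x => pairNorm r Γ ℓ t (x, η x) ^ r :=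
      ((measurable_iterNorm measurable_pairStep hH.measurable_cost t).comp
        (measurable_id.prodMk hη)).pow_const r
    filter_upwards [ae_lt_top hm hfin] with x hx
    exact (ENNReal.rpow_lt_top_iff_of_pos (by positivity)).1 hx
  have hYm : Measurable fun x => H (η' x) x := hH.measurable_comp hη'
  have hNt : ∀ᵐ x ∂frozenLaw P t, pathNorm r P (fun x => ‖H (η' x) x‖ₑ) t x ≠ ∞ := by
    have hm := measurable_pathMean P (hYm.enorm.pow_const r) t
    have h1 := lintegral_pathMean_frozenLaw P (hYm.enorm.pow_const r) t
    have h2 := (memLp_iff_powMean hr hYm.aestronglyMeasurable).1 hmem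
    have h3 : ∫⁻ x, ‖H (η' x) x‖ₑ ^ r ∂P ≠ ∞ := by
      rw [← powMean_rpow hr]
      exact ENNReal.rpow_ne_top_of_nonneg (by positivity) h2
    filter_upwards [ae_lt_top hm (h1 ▸ h3)] with x hx
    exact ENNReal.rpow_ne_top_of_nonneg (by positivity) hx.ne
  filter_upwards [hΛt, hNt, ae_of_ae_frozenLaw_succ P h (hle.and (hsel.and hΛ₁))]
    with x hx1 hx2 hx3
  -- the one stage estimate at the history `x`
  have hcoup : IsCoupling (stageKernel P ⟨t, h⟩ x) (stageKernel P' ⟨t, h⟩ (η x))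
      (stageKernel P ⟨t, h⟩ x ⊗ₘ ρ.sectR x) := by
    rw [hρ.compProd_eq]
    exact hΓ.isCoupling _ _ _
  have hV := memLp_riskProcess_update (P := P) hr hq hS hYm h hx2
  have hW := memLp_riskProcess_update (P := P') hr hq hS hH.measurable_diag h
    (hNfin t (x, η x) hx1.ne)
  have hps : Measurable fun w : Ξ ⟨t, h⟩ × Ξ ⟨t, h⟩ => Λ (pairStep ⟨t, h⟩ (x, η x) w) :=
    hΛ.comp ((measurable_pairStep ⟨t, h⟩).comp measurable_prodMk_left)
  have hΛstep : powMean r (Γ ⟨t, h⟩ (x, η x)) (fun w => Λ (pairStep ⟨t, h⟩ (x, η x) w)) =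
      pairNorm r Γ ℓ t (x, η x) := (iterNorm_of_lt hr h _).symm
  have hpow : powMean r (stageKernel P ⟨t, h⟩ x ⊗ₘ ρ.sectR x)
      (fun w => K * Λ (pairStep ⟨t, h⟩ (x, η x) w)) = K * pairNorm r Γ ℓ t (x, η x) := by
    rw [hρ.compProd_eq, powMean_const_mul hr ENNReal.coe_ne_top, hΛstep]
  have hpowfin : powMean r (stageKernel P ⟨t, h⟩ x ⊗ₘ ρ.sectR x)
      (fun w => K * Λ (pairStep ⟨t, h⟩ (x, η x) w)) ≠ ∞ := by
    rw [hpow]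
    exact ENNReal.mul_ne_top ENNReal.coe_ne_top hx1.ne
  have hprob := hcoup.isProbabilityMeasure
  have hr1 : (1 : ℝ≥0∞) ≤ ENNReal.ofReal r := by rwa [ENNReal.one_le_ofReal]
  have hint := ((hcoup.memLp_snd hW).add
    (memLp_toReal hr (hps.const_mul (K : ℝ≥0∞)).aemeasurable hpowfin)).integrable hr1
  have hΛw : ∀ᵐ w ∂(stageKernel P ⟨t, h⟩ x ⊗ₘ ρ.sectR x), Λ (pairStep ⟨t, h⟩ (x, η x) w) < ∞ := by
    refine ae_lt_top_of_powMean hr hps.aemeasurable ?_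
    rw [hρ.compProd_eq, hΛstep]
    exact hx1.ne
  -- The error `K Λ` of the next stage has norm `K` times the iterated norm at `t`; the factor of
  -- the present stage completes `K` to `tailProd k t`.
  have hfinal := riskFunctional_le_add_of_average hr hq (hS ⟨t, h⟩) hcoup hV hW
    (hps.const_mul (K : ℝ≥0∞)).aemeasurable hpowfin ?_
  · rw [hpow, ENNReal.toReal_mul, ENNReal.coe_toReal, ← mul_assoc] at hfinal
    rw [riskProcess_of_lt _ h, riskProcess_of_lt _ h, tailProd_of_lt k h, NNReal.coe_mul]
    exact hfinal
  · filter_upwards [hx3, ((Measure.integrable_compProd_iff hint.aestronglyMeasurable).1 hint).1,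
      Measure.ae_ae_of_ae_compProd hΛw] with u hu hui huΛ
    obtain ⟨hu1, hu2, hu3⟩ := hu
    set x' := freeze (t + 1) (Function.update x ⟨t, h⟩ u) with hx'
    have e1 : riskProcess S P (fun x => H (η' x) x) (t + 1) (Function.update x ⟨t, h⟩ u) =
        riskProcess S P (fun x => H (η' x) x) (t + 1) x' :=
      riskProcess_congr S P _ (t + 1) _ _ (agree_freeze _ _).symm
    -- The selection inequality now speaks of the conditional law of `v` given `u` at the history
    -- `x`; what follows rewrites it as an inequality between real integrals.
    rw [hρ.lintegral_freeze h hc hFdep x u x' hx'] at hu2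
    have hcongr : ∀ᵐ v ∂ρ.sectR x u,
        F (Function.update x ⟨t, h⟩ u, Function.update (η x) ⟨t, h⟩ v) =
        ENNReal.ofReal (riskProcess S P' (fun y => H y y) (t + 1)
          (Function.update (η x) ⟨t, h⟩ v) +
            (K * Λ (pairStep ⟨t, h⟩ (x, η x) (u, v))).toReal + K * a) := by
      filter_upwards [huΛ] with v hv
      have hv' : Λ (Function.update x ⟨t, h⟩ u, Function.update (η x) ⟨t, h⟩ v) ≠ ∞ := hv.ne
      rw [hFdef, riskBound_of_ne_top hv', hGR _ hv', ENNReal.toReal_mul, ENNReal.coe_toReal]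
      rfl
    have hnn : ∀ᵐ v ∂ρ.sectR x u, 0 ≤ riskProcess S P' (fun y => H y y) (t + 1)
          (Function.update (η x) ⟨t, h⟩ v) +
            (K * Λ (pairStep ⟨t, h⟩ (x, η x) (u, v))).toReal + K * a := by
      filter_upwards [huΛ] with v hv
      have hv' : Λ (Function.update x ⟨t, h⟩ u, Function.update (η x) ⟨t, h⟩ v) ≠ ∞ := hv.ne
      have h1 := riskBound_nonneg (G := fun z : (∀ i, Ξ i) × (∀ i, Ξ i) => G z.2) (hGb _ hv')
      rw [hGR _ hv'] at h1
      rw [ENNReal.toReal_mul, ENNReal.coe_toReal]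
      have h2 : 0 ≤ K * (Λ (Function.update x ⟨t, h⟩ u, Function.update (η x) ⟨t, h⟩ v)).toReal :=
        by positivity
      have h3 := h2.trans h1
      exact (mul_nonneg_iff_of_pos_left two_pos).1 h3
    have hint' : Integrable (fun v => riskProcess S P' (fun y => H y y) (t + 1)
          (Function.update (η x) ⟨t, h⟩ v) +
            (K * Λ (pairStep ⟨t, h⟩ (x, η x) (u, v))).toReal) (ρ.sectR x u) := hui
    have hmean := integral_add hint' (integrable_const (μ := ρ.sectR x u) ((K : ℝ) * a))
    rw [integral_const, probReal_univ, one_smul] at hmean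
    have e2 : ∫⁻ v, F (Function.update x ⟨t, h⟩ u, Function.update (η x) ⟨t, h⟩ v) ∂ρ (x, u) =
        ENNReal.ofReal (∫ v, (riskProcess S P' (fun y => H y y) (t + 1)
          (Function.update (η x) ⟨t, h⟩ v) +
            (K * Λ (pairStep ⟨t, h⟩ (x, η x) (u, v))).toReal) ∂ρ.sectR x u + K * a) := by
      rw [← hmean]
      exact (lintegral_congr_ae hcongr).trans
        (ofReal_integral_eq_lintegral_ofReal (hint'.add (integrable_const _)) hnn).symm
    rw [e2, hFdef, riskBound_of_ne_top hu3.ne] at hu2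
    have h0 : 0 ≤ ∫ v, (riskProcess S P' (fun y => H y y) (t + 1)
          (Function.update (η x) ⟨t, h⟩ v) +
            (K * Λ (pairStep ⟨t, h⟩ (x, η x) (u, v))).toReal) ∂ρ.sectR x u + K * a := by
      rw [← hmean]
      exact integral_nonneg_of_ae hnn
    rw [ENNReal.ofReal_le_ofReal_iff h0, hGR _ hu3.ne] at hu2
    rw [e1]
    -- The offset `K a` stands on both sides and cancels.
    have hu2' := (add_le_add_iff_right _).1 hu2
    exact hu1.trans hu2'

theorem transferAt (hr : 1 ≤ r) (hq : (ENNReal.ofReal r)⁻¹ + q⁻¹ = 1)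
    (hS : ∀ i, IsBoundedFamily q (S i) (k i)) (hk : ∀ i, k i ≠ 0)
    (hΓ : IsNestedCoupling P P' Γ) (hH : IsTransferCost ℓ a H) (t : ℕ) :
    TransferAt P P' r S k Γ ℓ H t :=
  downward_induction (T := T) (fun _ h => transferAt_of_le hr hH h)
    (fun _ h ih => ih.stage hr hq hS hk hΓ hH h) t

/-- The risk under `P` of a suitable causal transform of the decisions exceeds the risk under `P'`
by at most the iterated norm of the error bound. -/
theorem exists_causal_nestedRisk_le (hr : 1 ≤ r) (hq : (ENNReal.ofReal r)⁻¹ + q⁻¹ = 1)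
    (hS : ∀ i, IsBoundedFamily q (S i) (k i)) (hk : ∀ i, k i ≠ 0)
    (hΓ : IsNestedCoupling P P' Γ) (hH : IsTransferCost ℓ a H) (z : (∀ i, Ξ i) × (∀ i, Ξ i))
    (hfin : pairNorm r Γ ℓ 0 z ≠ ∞) :
    ∃ η : (∀ i, Ξ i) → ∀ i, Ξ i, Measurable η ∧ Causal η ∧
      MemLp (fun x => H (η x) x) (ENNReal.ofReal r) P ∧
      nestedRisk S P (fun x => H (η x) x) ≤ nestedRisk S P' (fun y => H y y) +
        (∏ i, k i : ℝ≥0) * (pairNorm r Γ ℓ 0 z).toReal := by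
  have h0 : ∀ x x' : ∀ i, Ξ i, Agree 0 x x' := fun x x' j hj => absurd hj (Nat.not_lt_zero _)
  have e : ∀ x y, pairNorm r Γ ℓ 0 (x, y) = pairNorm r Γ ℓ 0 z := fun x y =>
    hΓ.pairNorm_congr 0 (h0 _ _) (h0 _ _)
  -- A constant map can serve as a start: at time zero no coordinate of it matters.
  obtain ⟨η, hη, hc, hmem, hle⟩ := transferAt hr hq hS hk hΓ hH 0 (fun _ => z.2) measurable_const
    (fun s x x' _ => Agree.refl _ _) (by
      simp only [e, lintegral_const, measure_univ, mul_one]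
      exact ENNReal.rpow_ne_top_of_nonneg (by positivity) hfin)
  obtain ⟨x, hx⟩ := hle.exists
  refine ⟨η, hη, hc, hmem, ?_⟩
  rw [nestedRisk_eq S P _ x, nestedRisk_eq S P' _ z.2, ← tailProd_zero, ← e x z.2]
  exact hx

end TransferStep

/-! ### Symmetry of the nested distance -/

section Symmetry

theorem wasserstein_swap_le {X Y : Type*} [MeasurableSpace X] [MeasurableSpace Y] (r : ℝ)
    (μ : Measure X) (ν : Measure Y) (c : X → Y → ℝ≥0∞) :
    wasserstein r μ ν c ≤ wasserstein r ν μ (fun y x => c x y) := by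
  refine le_iInf₂ fun π hπ => (iInf₂_le (π.map Prod.swap) hπ.swap).trans (le_of_eq ?_)
  have : π.map Prod.swap = π.map (MeasurableEquiv.prodComm : Y × X ≃ᵐ X × Y) := rfl
  rw [this, lintegral_map_equiv]
  rfl

theorem wasserstein_swap {X Y : Type*} [MeasurableSpace X] [MeasurableSpace Y] (r : ℝ)
    (μ : Measure X) (ν : Measure Y) (c : X → Y → ℝ≥0∞) :
    wasserstein r μ ν c = wasserstein r ν μ (fun y x => c x y) :=
  le_antisymm (wasserstein_swap_le r μ ν c) (wasserstein_swap_le r ν μ _)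

variable {T : ℕ} {Ξ : Fin T → Type*} [∀ i, Nonempty (Ξ i)] [∀ i, MeasurableSpace (Ξ i)]
  [∀ i, StandardBorelSpace (Ξ i)]

theorem costProcess_of_lt {r : ℝ} {c : (∀ i, Ξ i) → (∀ i, Ξ i) → ℝ≥0∞}
    {P P' : Measure (∀ i, Ξ i)} [IsFiniteMeasure P] [IsFiniteMeasure P'] {t : ℕ} (h : t < T)
    (x y : ∀ i, Ξ i) : costProcess r c P P' t x y =
      wasserstein r (stageKernel P ⟨t, h⟩ x) (stageKernel P' ⟨t, h⟩ y)
        (fun u v => costProcess r c P P' (t + 1)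
          (Function.update x ⟨t, h⟩ u) (Function.update y ⟨t, h⟩ v)) := by
  rw [costProcess, dif_pos h]

theorem costProcess_swap (r : ℝ) {c : (∀ i, Ξ i) → (∀ i, Ξ i) → ℝ≥0∞} (hc : ∀ x y, c x y = c y x)
    (P P' : Measure (∀ i, Ξ i)) [IsFiniteMeasure P] [IsFiniteMeasure P'] (t : ℕ) :
    ∀ x y, costProcess r c P P' t x y = costProcess r c P' P t y x := by
  refine downward_induction (T := T)
    (p := fun t => ∀ x y, costProcess r c P P' t x y = costProcess r c P' P t y x)
    (fun t h x y => ?_) (fun t h ih x y => ?_) t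
  · rw [costProcess, dif_neg (not_lt.2 h), costProcess, dif_neg (not_lt.2 h)]
    exact hc x y
  · rw [costProcess_of_lt h, costProcess_of_lt h]
    simp only [ih]
    exact wasserstein_swap _ _ _ _

theorem nestedDist_comm (r : ℝ) {d : (∀ i, Ξ i) → (∀ i, Ξ i) → ℝ} (hd : ∀ x y, d x y = d y x)
    (P P' : Measure (∀ i, Ξ i)) [IsFiniteMeasure P] [IsFiniteMeasure P'] :
    nestedDist r d P P' = nestedDist r d P' P :=
  costProcess_swap r (fun x y => by rw [hd]) P P' 0 _ _

end Symmetry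

/-! ### Bounds for the families of distortion functions -/

section Families

/-- The distortion functions of different stages are chosen independently, so the supremum of the
products is the product of the suprema. Each of these is finite because all the other factors are at
least one. -/
theorem exists_isBoundedFamily {T : ℕ} {q : ℝ≥0∞} (hq : 1 ≤ q) {S : Fin T → Set (ℝ → ℝ)}
    (hne : ∀ i, (S i).Nonempty) (hS : ∀ i, ∀ σ ∈ S i, IsDistortion σ)
    (hfin : (⨆ σ : (∀ i, S i), ∏ i, distortionNorm q (σ i)) ≠ ∞) :
    ∃ k : Fin T → ℝ≥0, (∀ i, IsBoundedFamily q (S i) (k i)) ∧ (∀ i, k i ≠ 0) ∧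
      ((∏ i, k i : ℝ≥0) : ℝ≥0∞) ≤ ⨆ σ : (∀ i, S i), ∏ i, distortionNorm q (σ i) := by
  set M := ⨆ σ : (∀ i, S i), ∏ i, distortionNorm q (σ i) with hM
  have hne' : ∀ i, Nonempty (S i) := fun i => (hne i).to_subtype
  have hone : ∀ i (σ : S i), 1 ≤ distortionNorm q σ := fun i σ =>
    (hS i σ σ.2).one_le_distortionNorm hq
  have hle : ∀ i (σ : S i), distortionNorm q σ ≤ M := by
    intro i σ
    -- Any choice at the other stages will do, since it can only increase the product.
    let τ : ∀ i, S i := Function.update (fun i => Classical.arbitrary (S i)) i σ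
    have h1 : ∏ j, distortionNorm q (τ j) ≤ M := le_iSup (fun σ : (∀ i, S i) =>
      ∏ i, distortionNorm q (σ i)) τ
    refine le_trans ?_ h1
    rw [← Finset.mul_prod_erase _ _ (Finset.mem_univ i)]
    have h2 : distortionNorm q (τ i) = distortionNorm q σ := by simp [τ]
    rw [h2]
    exact le_mul_of_one_le_right' (Finset.one_le_prod' fun j _ => hone j (τ j))
  set s : Fin T → ℝ≥0∞ := fun i => ⨆ σ : S i, distortionNorm q σ with hs
  have hsM : ∀ i, s i ≤ M := fun i => iSup_le (hle i)
  have hst : ∀ i, s i ≠ ∞ := fun i => ne_top_of_le_ne_top hfin (hsM i)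
  refine ⟨fun i => (s i).toNNReal, fun i => ⟨hne i, hS i, fun σ hσ => ?_⟩, fun i h0 => ?_, ?_⟩
  · rw [ENNReal.coe_toNNReal (hst i)]
    exact le_iSup (fun σ : S i => distortionNorm q σ) ⟨σ, hσ⟩
  · have h1 : 1 ≤ s i := (hone i (Classical.arbitrary _)).trans
      (le_iSup (fun σ : S i => distortionNorm q σ) _)
    have h2 : (s i).toNNReal = 0 := h0
    rw [← ENNReal.coe_toNNReal (hst i), h2] at h1
    simp at h1
  · push_cast
    simp only [ENNReal.coe_toNNReal (hst _)]
    -- Sequences approaching the supremum at each stage are multiplied; the limit of the product is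
    -- legitimate as all suprema are finite.
    choose u _ hu hur using fun i => exists_seq_tendsto_sSup
      (range_nonempty fun σ : S i => distortionNorm q σ) (OrderTop.bddAbove _)
    choose τ hτ using hur
    have hlim : Filter.Tendsto (fun n => ∏ i, u i n) Filter.atTop (nhds (∏ i, s i)) :=
      ENNReal.tendsto_finsetProd_of_ne_top _ (fun i _ => hu i) fun i _ => hst i
    refine le_of_tendsto' hlim fun n => ?_
    have e : ∏ i, u i n = ∏ i, distortionNorm q (τ i n) :=
      Finset.prod_congr rfl fun i _ => (hτ i n).symm
    rw [e]
    exact le_iSup (fun σ : (∀ i, S i) => ∏ i, distortionNorm q (σ i)) fun i => τ i n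

end Families

/-! ### Comparison of optimal values -/

section OptimalValue

variable {T : ℕ} {Ξ : Fin T → Type*} [∀ i, Nonempty (Ξ i)] [∀ i, MeasurableSpace (Ξ i)]
  [∀ i, StandardBorelSpace (Ξ i)] {P P' : Measure (∀ i, Ξ i)} [IsProbabilityMeasure P]
  [IsProbabilityMeasure P'] {r : ℝ} {q : ℝ≥0∞} {S : Fin T → Set (ℝ → ℝ)} {k : Fin T → ℝ≥0}

/-- Dominated convergence. It makes the term added to the error for the sake of integrability
negligible. -/
theorem exists_powMean_excess_le {Ω : Type*} [MeasurableSpace Ω] {μ : Measure Ω} (hr : 1 ≤ r)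
    {Y : Ω → ℝ} (hY : Measurable Y) (hY' : MemLp Y (ENNReal.ofReal r) μ) {e : ℝ≥0∞} (he : e ≠ 0) :
    ∃ a : ℝ≥0, powMean r μ (fun ω => ‖Y ω‖ₑ - a) ≤ e := by
  have hr0 : 0 < r := by positivity
  have hfin : ∫⁻ ω, ‖Y ω‖ₑ ^ r ∂μ ≠ ∞ := by
    rw [← powMean_rpow hr]
    exact ENNReal.rpow_ne_top_of_nonneg hr0.le
      ((memLp_iff_powMean hr hY.aestronglyMeasurable).1 hY')
  have hlim : Filter.Tendsto (fun n : ℕ => ∫⁻ ω, (‖Y ω‖ₑ - ((n : ℝ≥0) : ℝ≥0∞)) ^ r ∂μ) Filter.atTop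
      (nhds (∫⁻ _, 0 ∂μ)) := by
    refine tendsto_lintegral_of_dominated_convergence (fun ω => ‖Y ω‖ₑ ^ r)
      (fun n => (hY.enorm.sub_const _).pow_const r)
      (fun n => Filter.Eventually.of_forall fun ω => ENNReal.rpow_le_rpow tsub_le_self hr0.le) hfin
      (Filter.Eventually.of_forall fun ω => ?_)
    obtain ⟨n, hn⟩ := exists_nat_ge ‖Y ω‖₊
    refine tendsto_const_nhds.congr' ?_
    filter_upwards [Filter.eventually_ge_atTop n] with m hm
    have : ‖Y ω‖ₑ ≤ ((m : ℝ≥0) : ℝ≥0∞) :=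
      ENNReal.coe_le_coe.2 (hn.trans (by exact_mod_cast hm))
    rw [tsub_eq_zero_of_le this, ENNReal.zero_rpow_of_pos hr0]
  rw [lintegral_zero] at hlim
  have he' : 0 < e ^ r := ENNReal.rpow_pos_of_nonneg (pos_iff_ne_zero.2 he) hr0.le
  obtain ⟨n, hn⟩ := (hlim.eventually (gt_mem_nhds he')).exists
  refine ⟨n, ?_⟩
  rw [powMean, one_div, ENNReal.rpow_inv_le_iff hr0]
  exact hn.le

theorem hasFiniteMoment_at {X : Type*} [MeasurableSpace X] {μ : Measure X} [IsProbabilityMeasure μ]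
    (hr : 1 ≤ r) {d : X → X → ℝ} (hd : Measurable fun z : X × X => d z.1 z.2)
    (htri : ∀ x y z, d x z ≤ d x y + d y z) (hμ : HasFiniteMoment r d μ) (x₀ : X) :
    ∫⁻ x, (2 * ENNReal.ofReal (d x₀ x)) ^ r ∂μ ≠ ∞ := by
  obtain ⟨x₁, h⟩ := hμ
  have hm : Measurable fun x => ENNReal.ofReal (d x₁ x) :=
    (hd.comp measurable_prodMk_left).ennreal_ofReal
  have h1 : powMean r μ (fun x => ENNReal.ofReal (d x₁ x)) ≠ ∞ :=
    ENNReal.rpow_ne_top_of_nonneg (by positivity) h.ne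
  have h2 : powMean r μ (fun x => 2 * ENNReal.ofReal (d x₀ x)) ≠ ∞ := by
    rw [powMean_const_mul hr (by simp)]
    refine ENNReal.mul_ne_top (by simp) ?_
    refine ne_top_of_le_ne_top ?_ ((powMean_mono_ae hr (Filter.Eventually.of_forall fun x =>
      (ENNReal.ofReal_le_ofReal (htri x₀ x₁ x)).trans ENNReal.ofReal_add_le)).trans
      (powMean_add_le hr aemeasurable_const hm.aemeasurable))
    rw [powMean_const hr]
    exact ENNReal.add_ne_top.2 ⟨ENNReal.ofReal_ne_top, h1⟩
  rw [← powMean_rpow hr]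
  exact ENNReal.rpow_ne_top_of_nonneg (by positivity) h2

/-- The properties of the metric on the path space which are needed. -/
structure IsPathMetric (r : ℝ) (d : (∀ i, Ξ i) → (∀ i, Ξ i) → ℝ) : Prop where
  measurable : Measurable fun z : (∀ i, Ξ i) × (∀ i, Ξ i) => d z.1 z.2
  symm : ∀ x y, d x y = d y x
  triangle : ∀ x y z, d x z ≤ d x y + d y z
  isRectInf : IsRectInf fun x y => ENNReal.ofReal (d x y) ^ r

variable {d : (∀ i, Ξ i) → (∀ i, Ξ i) → ℝ}

/-- The distance is at most twice the larger of the distances to `x₀`. The separated form of the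
bound is what the construction of couplings needs. -/
theorem IsPathMetric.rpow_le (hr : 1 ≤ r) (hd : IsPathMetric r d) (x₀ x y : ∀ i, Ξ i) :
    ENNReal.ofReal (d x y) ^ r ≤
      (2 * ENNReal.ofReal (d x₀ x)) ^ r + (2 * ENNReal.ofReal (d x₀ y)) ^ r := by
  have hr0 : 0 ≤ r := by positivity
  have h1 : ENNReal.ofReal (d x y) ≤ ENNReal.ofReal (d x₀ x) + ENNReal.ofReal (d x₀ y) := by
    refine (ENNReal.ofReal_le_ofReal (hd.triangle x x₀ y)).trans ?_
    rw [hd.symm x x₀]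
    exact ENNReal.ofReal_add_le
  rcases le_total (ENNReal.ofReal (d x₀ x)) (ENNReal.ofReal (d x₀ y)) with h | h
  · refine le_trans (ENNReal.rpow_le_rpow (h1.trans ?_) hr0) le_add_self
    rw [two_mul]
    exact add_le_add h le_rfl
  · refine le_trans (ENNReal.rpow_le_rpow (h1.trans ?_) hr0) le_self_add
    rw [two_mul]
    exact add_le_add le_rfl h

theorem IsPathMetric.measurable_bound (hd : IsPathMetric r d) (x₀ : ∀ i, Ξ i) :
    Measurable fun x => (2 * ENNReal.ofReal (d x₀ x)) ^ r :=
  ((hd.measurable.comp measurable_prodMk_left).ennreal_ofReal.const_mul 2).pow_const r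

/-- At time zero the iterated means of the separable bounds are moments of `P` and `P'`. -/
theorem IsPathMetric.nestedDist_ne_top (hr : 1 ≤ r) (hd : IsPathMetric r d)
    (hP : HasFiniteMoment r d P) (hP' : HasFiniteMoment r d P') : nestedDist r d P P' ≠ ∞ := by
  have x₀ : ∀ i, Ξ i := fun _ => Classical.arbitrary _
  obtain ⟨R, -, hR1, hR2⟩ := hasRectVersion (P := P) (P' := P') hr (hd.measurable_bound x₀)
    (hd.measurable_bound x₀) hd.isRectInf (hd.rpow_le hr x₀) 0
  have h1 : pathMean P (fun x => (2 * ENNReal.ofReal (d x₀ x)) ^ r) 0 x₀ ≠ ∞ := by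
    rw [pathMean_zero P (hd.measurable_bound x₀)]
    exact hasFiniteMoment_at hr hd.measurable hd.triangle hP x₀
  have h2 : pathMean P' (fun x => (2 * ENNReal.ofReal (d x₀ x)) ^ r) 0 x₀ ≠ ∞ := by
    rw [pathMean_zero P' (hd.measurable_bound x₀)]
    exact hasFiniteMoment_at hr hd.measurable hd.triangle hP' x₀
  have h3 := hR1 x₀ x₀
  rw [hR2 x₀ x₀ h1 h2] at h3
  rw [nestedDist_eq r d P P' x₀ x₀]
  have h4 := ne_top_of_le_ne_top (ENNReal.add_ne_top.2 ⟨h1, h2⟩) h3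
  intro h
  rw [h, ENNReal.top_rpow_of_pos (by positivity)] at h4
  exact h4 rfl

/-- Couplings of the conditional distributions whose iterated norm is close to the nested
distance. -/
theorem IsPathMetric.exists_nestedCoupling (hr : 1 ≤ r) (hd : IsPathMetric r d)
    (hP : HasFiniteMoment r d P) (hP' : HasFiniteMoment r d P') {e : ℝ≥0∞} (he : e ≠ 0) :
    ∃ Γ : ∀ i, Kernel ((∀ i, Ξ i) × (∀ i, Ξ i)) (Ξ i × Ξ i), (∀ i, IsMarkovKernel (Γ i)) ∧
      IsNestedCoupling P P' Γ ∧
      ∀ z, pairNorm r Γ (fun z => ENNReal.ofReal (d z.1 z.2)) 0 z ≤ nestedDist r d P P' + e := by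
  have hr0 : 0 < r := by positivity
  have x₀ : ∀ i, Ξ i := fun _ => Classical.arbitrary _
  set D := nestedDist r d P P' with hD
  have hDt : D ≠ ∞ := hd.nestedDist_ne_top hr hP hP'
  have hlt : D ^ r < (D + e) ^ r := ENNReal.rpow_lt_rpow (ENNReal.lt_add_right hDt he) hr0
  -- The `T` stages together may add no more than the gap between the powers; `T + 1` avoids
  -- division by zero.
  set ε := ((D + e) ^ r - D ^ r) / (T + 1) with hε
  have hε0 : ε ≠ 0 := ENNReal.div_ne_zero.2 ⟨(tsub_pos_of_lt hlt).ne', by finiteness⟩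
  obtain ⟨Γ, hΓ, hΓ1, hΓ2, hΓ3⟩ := exists_nested_couplings (P := P) (P' := P') hr
    (hd.measurable_bound x₀) (hd.measurable_bound x₀) hd.isRectInf (hd.rpow_le hr x₀)
    (hasFiniteMoment_at hr hd.measurable hd.triangle hP x₀)
    (hasFiniteMoment_at hr hd.measurable hd.triangle hP' x₀) hε0
  refine ⟨Γ, hΓ, ⟨hΓ1, hΓ2⟩, fun z => ?_⟩
  rw [pairNorm, iterNorm, one_div, ENNReal.rpow_inv_le_iff hr0]
  refine (hΓ3 z.1 z.2).trans ?_
  rw [← nestedDist_eq r d P P' z.1 z.2]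
  have h1 : T * ε ≤ (D + e) ^ r - D ^ r := by
    rw [hε, mul_div_assoc']
    refine ENNReal.div_le_of_le_mul ?_
    rw [mul_comm]
    exact mul_le_mul_right le_self_add _
  exact (add_le_add le_rfl h1).trans (le_of_eq (add_tsub_cancel_of_le hlt.le))

variable {E : Fin (T + 1) → Type*} [∀ t, MeasurableSpace (E t)] {Z : ∀ t, Set (E t)}
  {Q : (∀ t, E t) → (∀ i, Ξ i) → ℝ} {L : ℝ≥0}

/-- By causality the beginning of `η x` can be computed from the beginning of `x`, extended by a
constant tail. -/
theorem Causal.measurable_coordFiltration {η : (∀ i, Ξ i) → ∀ i, Ξ i} (hc : Causal η)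
    (hη : Measurable η) (t : ℕ) : Measurable[coordFiltration Ξ t, coordFiltration Ξ t] η := by
  refine measurable_comap_iff.2 ?_
  have e : pathRestrict t ∘ η =
      (fun b => pathRestrict t (η (extendPath t b))) ∘ pathRestrict t := by
    funext x
    simp only [Function.comp_apply, extendPath_pathRestrict]
    funext j
    exact (hc t _ _ (agree_freeze t x) j.val j.property).symm
  rw [e]
  exact ((measurable_pathRestrict t).comp (hη.comp (measurable_extendPath t))).comp
    (comap_measurable _)

theorem coordFiltration_le (t : ℕ) :
    coordFiltration Ξ t ≤ (MeasurableSpace.pi : MeasurableSpace (∀ i, Ξ i)) :=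
  (measurable_pathRestrict t).comap_le

/-- The optimal value for `P` does not exceed the risk of a policy for `P'` by more than the
multiple of the nested distance. -/
theorem optimalValue_le_nestedRisk_add (hr : 1 ≤ r) (hq : (ENNReal.ofReal r)⁻¹ + q⁻¹ = 1)
    (hS : ∀ i, IsBoundedFamily q (S i) (k i)) (hk : ∀ i, k i ≠ 0) (hd : IsPathMetric r d)
    (hQm : ∀ z : ∀ t, (∀ i, Ξ i) → E t, (∀ t, Measurable (z t)) → (∀ t x, z t x ∈ Z t) →
      Measurable fun p : (∀ i, Ξ i) × (∀ i, Ξ i) => Q (fun t => z t p.1) p.2)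
    (hQ_lip : ∀ z ∈ Set.pi Set.univ Z, ∀ x y, |Q z x - Q z y| ≤ L * d x y)
    (hP : HasFiniteMoment r d P) (hP' : HasFiniteMoment r d P')
    {z : ∀ t, (∀ i, Ξ i) → E t} (hz : IsPolicy r Z Q P' z) {e : ℝ≥0} (he : e ≠ 0) :
    optimalValue r Z Q S P ≤ ((nestedRisk S P' (fun x => Q (fun t => z t x) x) +
      (∏ i, k i : ℝ≥0) * (L * (nestedDist r d P P').toReal + (2 + L) * e) : ℝ) : EReal) := by
  have hzm : ∀ t, Measurable (z t) := fun t =>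
    (hz.adapted t).mono (coordFiltration_le _) le_rfl
  set H : (∀ i, Ξ i) → (∀ i, Ξ i) → ℝ := fun y x => Q (fun t => z t y) x with hH
  have hHm : Measurable fun p : (∀ i, Ξ i) × (∀ i, Ξ i) => H p.1 p.2 := hQm z hzm hz.mem
  have hHd : Measurable fun y => H y y := hHm.comp (measurable_id.prodMk measurable_id)
  obtain ⟨a, ha⟩ := exists_powMean_excess_le hr hHd hz.memLp (ENNReal.coe_ne_zero.2 he)
  obtain ⟨Γ, hΓM, hΓ, hΓd⟩ := hd.exists_nestedCoupling (P := P) (P' := P') hr hP hP'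
    (ENNReal.coe_ne_zero.2 he)
  set g : (∀ i, Ξ i) → ℝ≥0∞ := fun y => ‖H y y‖ₑ - a with hg
  have hgm : Measurable g := hHd.enorm.sub_const _
  set δ : (∀ i, Ξ i) × (∀ i, Ξ i) → ℝ≥0∞ := fun p => ENNReal.ofReal (d p.1 p.2) with hδ
  have hδm : Measurable δ := hd.measurable.ennreal_ofReal
  -- The Lipschitz error plus twice the excess of the cost over `a`; the latter gives `2 |H| ≤ 2 a +
  -- ℓ` on the diagonal.
  set ℓ : (∀ i, Ξ i) × (∀ i, Ξ i) → ℝ≥0∞ := fun p =>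
    ((2 : ℝ≥0) : ℝ≥0∞) * g p.2 + L * δ p with hℓ
  have h1m : Measurable fun p : (∀ i, Ξ i) × (∀ i, Ξ i) => ((2 : ℝ≥0) : ℝ≥0∞) * g p.2 :=
    (hgm.comp measurable_snd).const_mul _
  have hcost : IsTransferCost ℓ a H := by
    refine ⟨hHm, h1m.add (hδm.const_mul _), fun p => ?_, fun p => ?_, fun x y => ?_⟩
    · exact ENNReal.add_ne_top.2 ⟨ENNReal.mul_ne_top ENNReal.coe_ne_top
        (ne_top_of_le_ne_top enorm_ne_top tsub_le_self),
        ENNReal.mul_ne_top ENNReal.coe_ne_top ENNReal.ofReal_ne_top⟩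
    · calc 2 * ‖H p.2 p.2‖ₑ ≤ 2 * (a + g p.2) := mul_le_mul_right le_add_tsub _
        _ = 2 * a + 2 * g p.2 := mul_add _ _ _
        _ ≤ 2 * a + ℓ p := add_le_add le_rfl le_self_add
    · refine le_trans ?_ (le_add_self (a := L * δ (x, y)))
      rw [Real.enorm_eq_ofReal_abs]
      refine (ENNReal.ofReal_le_ofReal (hQ_lip _ (fun t _ => hz.mem t y) x y)).trans ?_
      rw [ENNReal.ofReal_mul L.coe_nonneg, ENNReal.ofReal_coe_nnreal]
  set p₀ : (∀ i, Ξ i) × (∀ i, Ξ i) :=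
    (fun _ => Classical.arbitrary _, fun _ => Classical.arbitrary _) with hp₀
  have hDt := hd.nestedDist_ne_top hr hP hP'
  have hnorm : pairNorm r Γ ℓ 0 p₀ ≤ L * nestedDist r d P P' + (2 + L) * e := by
    -- By Minkowski's inequality the two errors separate. The excess depends on the second path
    -- only, so its iterated norm is its `L^r` norm under `P'`.
    refine (iterNorm_add_le hr measurable_pairStep h1m (hδm.const_mul _) 0 p₀).trans ?_
    rw [iterNorm_const_mul hr, iterNorm_const_mul hr]
    have h1 : pairNorm r Γ (fun p => g p.2) 0 p₀ ≤ e := by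
      rw [hΓ.pathNorm_snd hgm, pathNorm, iterNorm]
      have := pathMean_zero P' (hgm.pow_const r) p₀.2
      rw [pathMean] at this
      rw [this]
      exact ha
    calc ((2 : ℝ≥0) : ℝ≥0∞) * iterNorm r Γ pairStep (fun p => g p.2) 0 p₀ +
          L * iterNorm r Γ pairStep δ 0 p₀
        ≤ ((2 : ℝ≥0) : ℝ≥0∞) * e + L * (nestedDist r d P P' + e) :=
          add_le_add (mul_le_mul_right h1 _) (mul_le_mul_right (hΓd p₀) _)
      _ = _ := by push_cast; ring
  have hbt : (L : ℝ≥0∞) * nestedDist r d P P' + (2 + L) * e ≠ ∞ :=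
    ENNReal.add_ne_top.2 ⟨ENNReal.mul_ne_top ENNReal.coe_ne_top hDt,
      ENNReal.mul_ne_top (by finiteness) ENNReal.coe_ne_top⟩
  obtain ⟨η, hη, hc, hmem, hle⟩ := exists_causal_nestedRisk_le hr hq hS hk hΓ hcost p₀
    (ne_top_of_le_ne_top hbt hnorm)
  have hpol : IsPolicy r Z Q P (fun t x => z t (η x)) :=
    ⟨fun t x => hz.mem t _, fun t => (hz.adapted t).comp (hc.measurable_coordFiltration hη _), hmem⟩
  refine (iInf₂_le (fun t x => z t (η x)) hpol).trans (EReal.coe_le_coe_iff.2 ?_)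
  refine hle.trans (add_le_add le_rfl (mul_le_mul_of_nonneg_left ?_ (NNReal.coe_nonneg _)))
  refine (ENNReal.toReal_mono hbt hnorm).trans (le_of_eq ?_)
  rw [ENNReal.toReal_add (ENNReal.mul_ne_top ENNReal.coe_ne_top hDt)
    (ENNReal.mul_ne_top (by finiteness) ENNReal.coe_ne_top), ENNReal.toReal_mul, ENNReal.toReal_mul,
    ENNReal.toReal_add (by simp) (by simp)]
  simp

/-- The distance term is finite, so it can be moved to the left in order to pass to the infimum over
the policies for `P'`; then `e` tends to zero. -/
theorem optimalValue_le_add (hr : 1 ≤ r) (hq : (ENNReal.ofReal r)⁻¹ + q⁻¹ = 1)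
    (hS : ∀ i, IsBoundedFamily q (S i) (k i)) (hk : ∀ i, k i ≠ 0) (hd : IsPathMetric r d)
    (hQm : ∀ z : ∀ t, (∀ i, Ξ i) → E t, (∀ t, Measurable (z t)) → (∀ t x, z t x ∈ Z t) →
      Measurable fun p : (∀ i, Ξ i) × (∀ i, Ξ i) => Q (fun t => z t p.1) p.2)
    (hQ_lip : ∀ z ∈ Set.pi Set.univ Z, ∀ x y, |Q z x - Q z y| ≤ L * d x y)
    (hP : HasFiniteMoment r d P) (hP' : HasFiniteMoment r d P') :
    optimalValue r Z Q S P ≤ optimalValue r Z Q S P' +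
      ((((∏ i, k i : ℝ≥0) : ℝ≥0∞) * L * nestedDist r d P P' : ℝ≥0∞) : EReal) := by
  set K : ℝ≥0 := ∏ i, k i with hK
  have hDt := hd.nestedDist_ne_top hr hP hP'
  have hc : (((K : ℝ≥0∞) * L * nestedDist r d P P' : ℝ≥0∞) : EReal) =
      ((K * L * (nestedDist r d P P').toReal : ℝ) : EReal) := by
    have hne : (K : ℝ≥0∞) * L * nestedDist r d P P' ≠ ∞ :=
      ENNReal.mul_ne_top (ENNReal.mul_ne_top ENNReal.coe_ne_top ENNReal.coe_ne_top) hDt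
    rw [← EReal.coe_ennreal_toReal hne, ENNReal.toReal_mul, ENNReal.toReal_mul]
    rfl
  rw [hc]
  refine (EReal.sub_le_iff_le_add (Or.inl (EReal.coe_ne_bot _)) (Or.inl (EReal.coe_ne_top _))).1 ?_
  refine le_iInf₂ fun z hz => ?_
  refine (EReal.sub_le_iff_le_add (Or.inl (EReal.coe_ne_bot _)) (Or.inl (EReal.coe_ne_top _))).2 ?_
  rw [← EReal.coe_add]
  refine EReal.le_of_forall_lt_iff_le.1 fun w hw => ?_
  set R := nestedRisk S P' (fun x => Q (fun t => z t x) x) with hR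
  -- The coefficient of `e` in the estimate, increased by one to be positive; `e` is the available
  -- gap divided by it.
  set C : ℝ := K * (2 + L) + 1 with hC
  have hC0 : 0 < C := by positivity
  have hw' := sub_pos.2 (EReal.coe_lt_coe_iff.1 hw)
  set e : ℝ := (w - (R + K * L * (nestedDist r d P P').toReal)) / C with he
  have he0 : 0 < e := div_pos hw' hC0
  have h := optimalValue_le_nestedRisk_add hr hq hS hk hd hQm hQ_lip hP hP' hz
    (Real.toNNReal_pos.2 he0).ne'
  refine h.trans (EReal.coe_le_coe_iff.2 ?_)
  rw [Real.coe_toNNReal _ he0.le, ← hK, ← hR]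
  have h1 : e * C = w - (R + K * L * (nestedDist r d P P').toReal) := div_mul_cancel₀ _ hC0.ne'
  have h2 : K * (L * (nestedDist r d P P').toReal + (2 + L) * e) =
      K * L * (nestedDist r d P P').toReal + (e * C - e) := by
    rw [hC]
    ring
  rw [h2, h1]
  linarith

end OptimalValue

/-! ### The continuity theorem -/

theorem measurable_comp_of_lowerSemicontinuousOn {X Y : Type*} [TopologicalSpace X]
    [MeasurableSpace X] [BorelSpace X] [MeasurableSpace Y] {s : Set X}
    {f : X → ℝ} (hf : LowerSemicontinuousOn f s) {g : Y → X} (hg : Measurable g)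
    (hgs : ∀ y, g y ∈ s) : Measurable fun y => f (g y) := by
  have h : LowerSemicontinuous (s.domRestrict f) := lowerSemicontinuous_restrict_iff.2 hf
  exact h.measurable.comp (hg.subtype_mk (h := hgs))
end

theorem theorem4p7 {T : ℕ}
    -- the state spaces: Polish spaces with their Borel sets
    (Ξ : Fin T → Type*) [∀ i, TopologicalSpace (Ξ i)] [∀ i, PolishSpace (Ξ i)]
    [∀ i, MeasurableSpace (Ξ i)] [∀ i, BorelSpace (Ξ i)] [∀ i, Nonempty (Ξ i)]
    -- the metric on the product space, inducing the product topology
    (d : MetricSpace (∀ i, Ξ i))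
    (hd : d.toUniformSpace.toTopologicalSpace = Pi.topologicalSpace)
    -- the decision spaces: closed convex subsets of separable Banach spaces
    (E : Fin (T + 1) → Type*) [∀ t, NormedAddCommGroup (E t)] [∀ t, NormedSpace ℝ (E t)]
    [∀ t, CompleteSpace (E t)] [∀ t, SecondCountableTopology (E t)]
    [∀ t, MeasurableSpace (E t)] [∀ t, BorelSpace (E t)]
    (Z : ∀ t, Set (E t)) (hZ_closed : ∀ t, IsClosed (Z t)) (hZ_convex : ∀ t, Convex ℝ (Z t))
    -- the Hölder conjugate exponents
    (r : ℝ) (hr : 1 ≤ r) (q : ℝ≥0∞) (hq : (ENNReal.ofReal r)⁻¹ + q⁻¹ = 1)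
    -- the collections of distortion functions
    (S : Fin T → Set (ℝ → ℝ)) (hS_nonempty : ∀ i, (S i).Nonempty)
    (hS : ∀ i, ∀ σ ∈ S i, IsDistortion σ)
    (hS_finite : (⨆ σ : (∀ i, S i), ∏ i, distortionNorm q (σ i)) ≠ ∞)
    -- the cost function
    (Q : (∀ t, E t) → (∀ i, Ξ i) → ℝ)
    (hQ_lsc : LowerSemicontinuousOn (fun p : (∀ t, E t) × (∀ i, Ξ i) => Q p.1 p.2)
      (Set.pi Set.univ Z ×ˢ Set.univ))
    (L : ℝ≥0)
    (hQ_lip : ∀ z ∈ Set.pi Set.univ Z, ∀ x y, |Q z x - Q z y| ≤ L * d.dist x y)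
    (hQ_convex : ∀ x, ConvexOn ℝ (Set.pi Set.univ Z) (fun z => Q z x))
    -- the two probability measures
    (P P' : Measure (∀ i, Ξ i)) [IsProbabilityMeasure P] [IsProbabilityMeasure P']
    (hP : HasFiniteMoment r d.dist P) (hP' : HasFiniteMoment r d.dist P') :
    optimalValue r Z Q S P ≤ optimalValue r Z Q S P' +
        (((⨆ σ : (∀ i, S i), ∏ i, distortionNorm q (σ i)) * L * nestedDist r d.dist P P' : ℝ≥0∞)
          : EReal) ∧
      optimalValue r Z Q S P' ≤ optimalValue r Z Q S P +
        (((⨆ σ : (∀ i, S i), ∏ i, distortionNorm q (σ i)) * L * nestedDist r d.dist P P' : ℝ≥0∞)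
          : EReal) := by
  have hc : @Continuous _ _ (@instTopologicalSpaceProd _ _ Pi.topologicalSpace Pi.topologicalSpace) _
      fun z : (∀ i, Ξ i) × (∀ i, Ξ i) => d.dist z.1 z.2 := by
    -- A metric is continuous for its own topology, which is the product topology.
    rw [← hd]
    exact @continuous_dist _ d.toPseudoMetricSpace
  have hpath : IsPathMetric r fun x y : ∀ i, Ξ i => d.dist x y :=
    ⟨hc.measurable, fun x y => d.dist_comm x y, fun x y z => d.dist_triangle x y z,
      isRectInf_of_continuous
        ((ENNReal.continuous_rpow_const (y := r)).comp (ENNReal.continuous_ofReal.comp hc))⟩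
  obtain ⟨k, hk, hk0, hkle⟩ :=
    exists_isBoundedFamily (one_lt_conjugate hq).le hS_nonempty hS hS_finite
  have hQm : ∀ z : ∀ t, (∀ i, Ξ i) → E t, (∀ t, Measurable (z t)) → (∀ t x, z t x ∈ Z t) →
      Measurable fun p : (∀ i, Ξ i) × (∀ i, Ξ i) => Q (fun t => z t p.1) p.2 := fun z hz hzZ =>
    measurable_comp_of_lowerSemicontinuousOn hQ_lsc
      (g := fun p : (∀ i, Ξ i) × (∀ i, Ξ i) => (fun t => z t p.1, p.2))
      ((measurable_pi_lambda _ fun t => (hz t).comp measurable_fst).prodMk measurable_snd)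
      fun p => ⟨fun t _ => hzZ t p.1, mem_univ _⟩
  have hmono : ∀ D : ℝ≥0∞, ((((∏ i, k i : ℝ≥0) : ℝ≥0∞) * L * D : ℝ≥0∞) : EReal) ≤
      (((⨆ σ : (∀ i, S i), ∏ i, distortionNorm q (σ i)) * L * D : ℝ≥0∞) : EReal) := fun D =>
    EReal.coe_ennreal_le_coe_ennreal_iff.2 (mul_le_mul_left (mul_le_mul_left hkle _) _)
  refine ⟨?_, ?_⟩
  · exact (optimalValue_le_add hr hq hk hk0 hpath hQm hQ_lip hP hP').trans
      (add_le_add le_rfl (hmono _))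
  -- The construction treats the two measures differently, but the nested distance is symmetric.
  · rw [nestedDist_comm r hpath.symm P P']
    exact (optimalValue_le_add hr hq hk hk0 hpath hQm hQ_lip hP' hP).trans
      (add_le_add le_rfl (hmono _))
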